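/- Let $n\in\mathbb N$, $3/2<s<2$, $\mathbb T=\mathbb R/\mathbb Z$ with Lebesgue measure $\lambda$ and intrinsic distance $d_{\mathbb T}$. Let $H^s=H^s(\mathbb T;\mathbb R^n)$ be the Sobolev--Slobodeckij space of all $u\in L^2$ with weak derivative $u'\in L^2$ and finite norm $$\|u\|_{H^s}^2=\int_{\mathbb T}|u|^2\,d\lambda+\int_{\mathbb T}|u'|^2\,d\lambda+\int_{\mathbb T}\int_{\mathbb T}\frac{|u'(y)-u'(x)|^2}{d_{\mathbb T}(y,x)^{2(s-1)}}\,\frac{d\lambda(y)\,d\lambda(x)}{d_{\mathbb T}(y,x)},$$ and let $\mathcal M\subset H^s$ be the set of those $\gamma\in H^s$ that are embeddings (i.e. $\gamma$ is $C^1$ with $\gamma'\neq0$ everywhere, and is a homeomorphism onto its image). For $\gamma\in\mathcal M$ and $u,v\in T_\gamma\mathcal M=H^s$ put $d\omega_\gamma=|\gamma'|\,d\lambda$, $d\mu_\gamma(x,y)=\dfrac{d\omega_\gamma(y)\,d\omega_\gamma(x)}{|\gamma(y)-\gamma(x)|}$, $D_\gamma u=u'/|\gamma'|$, $\mathcal D_\gamma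 u(x)=D_\gamma u(x)\,(D_\gamma\gamma(x))^{\top}$, $$R_\gamma^s u(x,y)=\frac{u(y)-u(x)-\mathcal D_\gamma u(x)\,(\gamma(y)-\gamma(x))}{|\gamma(y)-\gamma(x)|^s},$$ and define the Riemannian metric $$\begin{aligned}G_\gamma(u,v)={}&2\iint\langle R^s_\gamma u,R^s_\gamma v\rangle\,d\mu_\gamma+(2s+1)\iint|R^s_\gamma\gamma(x,y)|^2\,\frac{\langle u(y)-u(x),v(y)-v(x)\rangle}{|\gamma(y)-\gamma(x)|^2}\,d\mu_\gamma(x,y)\\&+\iint|R^s_\gamma\gamma(x,y)|^2\big(\langle D_\gamma u(x),D_\gamma v(x)\rangle+\langle D_\gamma u(y),D_\gamma v(y)\rangle\big)\,d\mu_\gamma(x,y)\\&+\int\langle D_\gamma u,D_\gamma v\rangle\,d\omega_\gamma+\int\langle u,v\rangle\,d\omega_\gamma .\end{aligned}$$ Write $(DG(\gamma)h)(u,v)$ for the derivative of $\eta\mapsto G_\eta(u,v)$ at $\gamma$ in direction $h$, and let the Christoffel symbol $A_\gamma(u)v\in H^s$ be given by the Koszul formula $$G_\gamma(A_\gamma(u)v,w)=\tfrac12\big((DG(\gamma)u)(v,w)+(DG(\gamma)v)(u,w)-(DG(\gamma)w)(u,v)\big)\quad\text{for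 all }w\in H^s.$$ **Theorem (Short-time existence).** 1. The geodesic equation is well posed as a smooth first-order ODE: $\mathcal M$ is open in $H^s$; $(\gamma,u,v)\mapsto G_\gamma(u,v)$ is $C^\infty$ on $\mathcal M\times H^s\times H^s$; for all $\gamma\in\mathcal M$ and $u,v\in H^s$ there is exactly one $A_\gamma(u)v\in H^s$ satisfying the Koszul formula; and the geodesic spray $(\gamma,v)\mapsto(v,-A_\gamma(v)v)$ is $C^\infty$ from $\mathcal M\times H^s$ to $H^s\times H^s$. 2. For every $\gamma_0\in\mathcal M$ and every $v_0\in H^s$ there is $T>0$ such that the geodesic initial value problem $$\ddot\Gamma+A_\Gamma(\dot\Gamma)\,\dot\Gamma=0,\qquad\Gamma(0)=\gamma_0,\qquad\dot\Gamma(0)=v_0$$ has a unique (twice differentiable) solution $\Gamma\colon[0,T]\to\mathcal M$. -/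

import Mathlib

open MeasureTheory Set
open scoped ContDiff

noncomputable section

namespace SobolevCurves

/-- The Euclidean space `ℝⁿ`. -/
abbrev E (n : ℕ) : Type := EuclideanSpace ℝ (Fin n)

/-! ### The Sobolev--Slobodeckij space `H^s(𝕋; ℝⁿ)`

The circle `𝕋 = ℝ / ℤ` is `UnitAddCircle`; its distance `dist` is the intrinsic (arc length) distance
and its `volume` is Lebesgue measure of total mass one. -/

/-- `g` is the weak derivative of `u` on the circle: `∫ φ' u = - ∫ φ g` for all smooth test
functions `φ` on the circle, i.e. all smooth 1-periodic functions on the line. -/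
def HasWeakDeriv {n : ℕ} (u g : UnitAddCircle → E n) : Prop :=
  ∀ φ : UnitAddCircle → ℝ, ContDiff ℝ ∞ (fun t : ℝ => φ t) →
    ∫ t in (0 : ℝ)..1, deriv (fun r : ℝ => φ r) t • u t = - ∫ t in (0 : ℝ)..1, φ t • g t

/-- The measure `dμ(x,y) = dλ(y) dλ(x) / dist(y,x)` on `𝕋 × 𝕋`. -/
def mu : Measure (UnitAddCircle × UnitAddCircle) :=
  ((volume : Measure UnitAddCircle).prod volume).withDensity
    (fun p => ENNReal.ofReal (1 / dist p.2 p.1))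

/-- The fractional difference operator `(f(y) - f(x)) / dist(y,x)^σ`. -/
def fracDiff {n : ℕ} (σ : ℝ) (f : UnitAddCircle → E n) (p : UnitAddCircle × UnitAddCircle) : E n :=
  (dist p.2 p.1 ^ σ)⁻¹ • (f p.2 - f p.1)

/-- The Hilbert space `L²(𝕋; ℝⁿ) × L²(𝕋; ℝⁿ) × L²(μ; ℝⁿ)` (Hilbert sum). -/
abbrev Ambient (n : ℕ) : Type :=
  WithLp 2 (Lp (E n) 2 (volume : Measure UnitAddCircle) ×
    WithLp 2 (Lp (E n) 2 (volume : Measure UnitAddCircle) × Lp (E n) 2 mu))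

lemma intervalIntegrable_smul {n : ℕ} {ψ : ℝ → ℝ} (hψ : Continuous ψ)
    (f : Lp (E n) 2 (volume : Measure UnitAddCircle)) :
    IntervalIntegrable (fun t : ℝ => ψ t • f (t : UnitAddCircle)) volume 0 1 := by
  have h1 : Integrable f (volume : Measure UnitAddCircle) :=
    (Lp.memLp f).integrable (by norm_num)
  have h2 : IntervalIntegrable (fun t : ℝ => f (t : UnitAddCircle)) volume 0 1 := by
    rw [intervalIntegrable_iff_integrableOn_Ioc_of_le zero_le_one]
    have h3 := UnitAddCircle.measurePreserving_mk 0
    rw [zero_add] at h3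
    exact h3.integrable_comp_of_integrable h1
  exact h2.continuousOn_smul hψ.continuousOn

lemma ae_coe (P : UnitAddCircle → Prop) (h : ∀ᵐ x, P x) :
    ∀ᵐ t : ℝ ∂volume.restrict (uIoc (0 : ℝ) 1), P (t : UnitAddCircle) := by
  rw [uIoc_of_le zero_le_one]
  have h3 := UnitAddCircle.measurePreserving_mk 0
  rw [zero_add] at h3
  exact h3.quasiMeasurePreserving.ae h

lemma integral_smul_congr {n : ℕ} (ψ : ℝ → ℝ) {f g : UnitAddCircle → E n}
    (h : f =ᵐ[volume] g) :
    ∫ t in (0 : ℝ)..1, ψ t • f t = ∫ t in (0 : ℝ)..1, ψ t • g t := by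
  apply intervalIntegral.integral_congr_ae_restrict
  filter_upwards [ae_coe _ h] with t ht
  rw [ht]

lemma ae_mu_fst {P : UnitAddCircle → Prop} (h : ∀ᵐ x, P x) : ∀ᵐ p ∂mu, P p.1 :=
  (withDensity_absolutelyContinuous _ _).ae_le (Measure.quasiMeasurePreserving_fst.ae h)

lemma ae_mu_snd {P : UnitAddCircle → Prop} (h : ∀ᵐ x, P x) : ∀ᵐ p ∂mu, P p.2 :=
  (withDensity_absolutelyContinuous _ _).ae_le (Measure.quasiMeasurePreserving_snd.ae h)

/-- The Sobolev--Slobodeckij space of order `s`: all `u ∈ L²` that have a weak derivative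
`u' ∈ L²` with `(u'(y) - u'(x)) / dist(y,x)^(s-1) ∈ L²(μ)`. It is realised as the space of triples
`(u, u', (u'(y) - u'(x)) / dist(y,x)^(s-1))`, in which the last two entries are determined by the
first. The inner product inherited from the ambient Hilbert sum is therefore
`⟨u,v⟩_{L²} + ⟨u',v'⟩_{L²} + ∫∫ ⟨u'(y)-u'(x), v'(y)-v'(x)⟩ / dist(y,x)^(2(s-1)) dμ`. -/
def sobolevSlobodeckij (s : ℝ) (n : ℕ) : Submodule ℝ (Ambient n) where
  carrier := {w | HasWeakDeriv w.fst w.snd.fst ∧ w.snd.snd =ᵐ[mu] fracDiff (s - 1) w.snd.fst}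
  zero_mem' := by
    have h0 : ((0 : Lp (E n) 2 (volume : Measure UnitAddCircle)) : UnitAddCircle → E n)
      =ᵐ[volume] 0 := Lp.coeFn_zero _ _ _
    refine ⟨fun φ _ => ?_, ?_⟩
    · have e1 := integral_smul_congr (deriv (fun r : ℝ => φ r)) h0
      have e2 := integral_smul_congr (fun r : ℝ => φ r) h0
      simp only [WithLp.zero_fst, WithLp.zero_snd]
      rw [e1, e2]; simp
    · simp only [WithLp.zero_fst, WithLp.zero_snd]
      filter_upwards [Lp.coeFn_zero (E n) 2 mu, ae_mu_fst h0, ae_mu_snd h0] with p h1 h2 h3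
      rw [h1, fracDiff, h2, h3]
      simp
  add_mem' := by
    rintro a b ⟨ha, ha'⟩ ⟨hb, hb'⟩
    have h1 := Lp.coeFn_add a.fst b.fst
    have h2 := Lp.coeFn_add a.snd.fst b.snd.fst
    refine ⟨fun φ hφ => ?_, ?_⟩
    · have e1 := integral_smul_congr (deriv (fun r : ℝ => φ r)) h1
      have e2 := integral_smul_congr (fun r : ℝ => φ r) h2
      have hφ' : Continuous (deriv (fun r : ℝ => φ r)) := hφ.continuous_deriv (by simp)
      simp only [WithLp.add_fst, WithLp.add_snd]
      rw [e1, e2]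
      simp only [Pi.add_apply, smul_add]
      rw [intervalIntegral.integral_add (intervalIntegrable_smul hφ' _)
        (intervalIntegrable_smul hφ' _), intervalIntegral.integral_add
        (intervalIntegrable_smul hφ.continuous _) (intervalIntegrable_smul hφ.continuous _),
        ha φ hφ, hb φ hφ, neg_add]
    · simp only [WithLp.add_fst, WithLp.add_snd]
      filter_upwards [Lp.coeFn_add a.snd.snd b.snd.snd, ae_mu_fst h2, ae_mu_snd h2, ha', hb']
        with p e1 e2 e3 e4 e5
      simp only [e1, Pi.add_apply, e4, e5, fracDiff, e2, e3, ← smul_add]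
      congr 1; abel
  smul_mem' := by
    rintro c a ⟨ha, ha'⟩
    have h1 := Lp.coeFn_smul c a.fst
    have h2 := Lp.coeFn_smul c a.snd.fst
    refine ⟨fun φ hφ => ?_, ?_⟩
    · have e1 := integral_smul_congr (deriv (fun r : ℝ => φ r)) h1
      have e2 := integral_smul_congr (fun r : ℝ => φ r) h2
      simp only [WithLp.smul_fst, WithLp.smul_snd]
      rw [e1, e2]
      simp only [Pi.smul_apply, smul_comm _ c]
      rw [intervalIntegral.integral_smul, intervalIntegral.integral_smul, ha φ hφ, smul_neg]
    · simp only [WithLp.smul_fst, WithLp.smul_snd]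
      filter_upwards [Lp.coeFn_smul c a.snd.snd, ae_mu_fst h2, ae_mu_snd h2, ha']
        with p e1 e2 e3 e4
      simp only [e1, Pi.smul_apply, e4, fracDiff, e2, e3, ← smul_sub]
      rw [smul_comm]

/-- The space `H^s(𝕋; ℝⁿ)` as a normed (inner product) space. -/
abbrev Hs (s : ℝ) (n : ℕ) : Type := sobolevSlobodeckij s n

variable {s : ℝ} {n : ℕ}

/-- The function `u : 𝕋 → ℝⁿ` (up to null sets) underlying an element of `H^s`. -/
def Hs.fn (u : Hs s n) : UnitAddCircle → E n := u.1.fst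

/-- The weak derivative `u' : 𝕋 → ℝⁿ` (up to null sets) of an element of `H^s`. -/
def Hs.wderiv (u : Hs s n) : UnitAddCircle → E n := u.1.snd.fst

/-- The `H^s`-embeddings: those `γ ∈ H^s` whose `C¹` representative `c` is an immersion and a
homeomorphism onto its image. -/
def embeddings (s : ℝ) (n : ℕ) : Set (Hs s n) :=
  {γ | ∃ c : UnitAddCircle → E n, c =ᵐ[volume] γ.fn ∧
    ContDiff ℝ 1 (fun t : ℝ => c t) ∧ (∀ t : ℝ, deriv (fun r : ℝ => c r) t ≠ 0) ∧
    Topology.IsEmbedding c}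

/-! ### The Riemannian metric -/

/-- The line element `dω_γ(x) = |γ'(x)| dλ(x)`. -/
def lineElement (γ : Hs s n) : Measure UnitAddCircle :=
  volume.withDensity (fun x => ENNReal.ofReal ‖γ.wderiv x‖)

/-- The measure `dμ_γ(x,y) = dω_γ(y) dω_γ(x) / |γ(y) - γ(x)|`. -/
def muGeom (γ : Hs s n) : Measure (UnitAddCircle × UnitAddCircle) :=
  ((lineElement γ).prod (lineElement γ)).withDensity
    (fun p => ENNReal.ofReal (1 / ‖γ.fn p.2 - γ.fn p.1‖))

/-- The arc length derivative `D_γ u(x) = u'(x) / |γ'(x)|`. -/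
def arcDeriv (γ u : Hs s n) (x : UnitAddCircle) : E n := ‖γ.wderiv x‖⁻¹ • u.wderiv x

/-- The operator `𝒟_γ u(x) = (u'(x) / |γ'(x)|) (γ'(x) / |γ'(x)|)ᵀ`, applied to the vector `z`. -/
def fullDeriv (γ u : Hs s n) (x : UnitAddCircle) (z : E n) : E n :=
  inner ℝ (arcDeriv γ γ x) z • arcDeriv γ u x

/-- `R_γ^s u(x,y) = (u(y) - u(x) - 𝒟_γ u(x) (γ(y) - γ(x))) / |γ(y) - γ(x)|^s`. -/
def opR (γ u : Hs s n) (p : UnitAddCircle × UnitAddCircle) : E n :=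
  (‖γ.fn p.2 - γ.fn p.1‖ ^ s)⁻¹ •
    (u.fn p.2 - u.fn p.1 - fullDeriv γ u p.1 (γ.fn p.2 - γ.fn p.1))

/-- `B¹_γ(u,v)`. -/
def B1 (γ u v : Hs s n) : ℝ := ∫ p, inner ℝ (opR γ u p) (opR γ v p) ∂(muGeom γ)

/-- `B²_γ(u,v)`. -/
def B2 (γ u v : Hs s n) : ℝ :=
  ∫ p, ‖opR γ γ p‖ ^ 2 *
    inner ℝ (‖γ.fn p.2 - γ.fn p.1‖⁻¹ • (u.fn p.2 - u.fn p.1))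
      (‖γ.fn p.2 - γ.fn p.1‖⁻¹ • (v.fn p.2 - v.fn p.1)) ∂(muGeom γ)

/-- `B³_γ(u,v)`. -/
def B3 (γ u v : Hs s n) : ℝ :=
  ∫ p, ‖opR γ γ p‖ ^ 2 *
    (inner ℝ (arcDeriv γ u p.1) (arcDeriv γ v p.1)
      + inner ℝ (arcDeriv γ u p.2) (arcDeriv γ v p.2)) ∂(muGeom γ)

/-- The geometric `H¹` product `∫ ⟨D_γ u, D_γ v⟩ dω_γ`. -/
def innerH1 (γ u v : Hs s n) : ℝ :=
  ∫ x, inner ℝ (arcDeriv γ u x) (arcDeriv γ v x) ∂(lineElement γ)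

/-- The geometric `L²` product `∫ ⟨u, v⟩ dω_γ`. -/
def innerL2 (γ u v : Hs s n) : ℝ := ∫ x, inner ℝ (u.fn x) (v.fn x) ∂(lineElement γ)

/-- The metric `G_γ(u,v)`. -/
def metricG (γ u v : Hs s n) : ℝ :=
  2 * B1 γ u v + (2 * s + 1) * B2 γ u v + B3 γ u v + innerH1 γ u v + innerL2 γ u v

/-! ### The geodesic equation -/

/-- `(DG(γ) h)(u,v)`: the derivative of `η ↦ G_η(u,v)` at `γ` in the direction `h`. -/
def derivG (γ h u v : Hs s n) : ℝ := fderiv ℝ (fun η : Hs s n => metricG η u v) γ h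

/-- Koszul's formula for `a = A_γ(u) v`. -/
def Koszul (γ u v a : Hs s n) : Prop :=
  ∀ w : Hs s n, metricG γ a w = 1 / 2 * (derivG γ u v w + derivG γ v u w - derivG γ w u v)

/-- The Christoffel symbol `A_γ(u) v`, given implicitly by Koszul's formula. -/
def christoffel (γ u v : Hs s n) : Hs s n := Classical.epsilon (Koszul γ u v)

/-- The geodesic spray `(γ, v) ↦ (v, -A_γ(v) v)`. -/
def spray (p : Hs s n × Hs s n) : Hs s n × Hs s n := (p.2, - christoffel p.1 p.2 p.2)

/-- `Γ : [0,T] → M` solves the geodesic initial value problem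
`Γ'' + A_Γ(Γ') Γ' = 0`, `Γ(0) = γ₀`, `Γ'(0) = v₀` (with one-sided derivatives at `0` and `T`);
`V` is the velocity `Γ'`. -/
def IsGeodesicIVPSolution (γ₀ v₀ : Hs s n) (T : ℝ) (Γ : ℝ → Hs s n) : Prop :=
  (∀ t ∈ Icc 0 T, Γ t ∈ embeddings s n) ∧ Γ 0 = γ₀ ∧
  ∃ V : ℝ → Hs s n, V 0 = v₀ ∧
    (∀ t ∈ Icc 0 T, HasDerivWithinAt Γ (V t) (Icc 0 T) t) ∧
    (∀ t ∈ Icc 0 T, ∃ a : Hs s n, HasDerivWithinAt V a (Icc 0 T) t ∧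
      a + christoffel (Γ t) (V t) (V t) = 0)

end SobolevCurves

end

open SobolevCurves

open MeasureTheory Set
open scoped ContDiff

noncomputable section

namespace SobolevCurves

/-! ### Powers of positive continuous functions -/

/-! The metric turns out to be a smooth strong Riemannian metric on an open subset of a Hilbert
space. Its spray is then a smooth vector field, and Picard–Lindelöf applies. Three points carry the
argument: smoothness of `G`, coercivity of `G`, and completeness of `H^s`.

Smoothness. Write a pair of points as `(x, x + t)` with `|t| ≤ 1/2`. Then `γ(x + t) - γ(x) = t
q_γ(x, t)`, where `q_γ` is the mean of `γ'` over the segment. Since `s - 1 > 1/2`, `H^s` embeds in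
`C¹`, so `q_γ` is a continuous function on a compact strip depending linearly and boundedly on `γ`.
The curve `γ` is an embedding exactly when `q_γ` has no zero (`mem_embeddings_iff`), which is an
open condition. The Taylor remainder `ρ(u) = |t|^{-(s-1/2)} (q_u - u'(x))` is bounded and linear
from `H^s` to `L²`. Up to a scalar factor, `R_γ^s u` is `S_γ u = ρ(u) - |γ'|⁻² ⟨γ', ρ(γ)⟩ u'`
(`ae_opR`), and in `G` all powers of `|t|` cancel (`rpow_weight_identity`). What remains
(`metricModel`) is built from bounded multilinear maps and powers of positive functions in the
Banach algebra `C(K)`. These powers are smooth by the binomial series.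

Coercivity. The first term of `G` controls `‖S_γ u‖`, which differs from `‖ρ(u)‖` by at most `M
‖u'‖_∞`, and `‖ρ(u)‖` controls the Slobodeckij seminorm (`lintegral_fracDiff_le_remainder`). The sup
norm is bounded by `ε ‖u‖_{H^s} + C ‖u'‖_{L²}` (`norm_derivCLM_le`), so for small `ε` it is
absorbed. The two lower-order terms of `G` supply the `L²` norms of `u` and `u'`.

Conclusion. By Lax–Milgram `G_γ` is an isomorphism onto the dual. Applying its inverse, which
depends smoothly on `γ`, to the Koszul functional gives the Christoffel symbol
(`exists_christoffel`). -/

section Power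

variable {X : Type*} [TopologicalSpace X]

open Classical in
/-- The pointwise power `f ^ r` of a positive continuous function. -/
def rpowMap (r : ℝ) (f : C(X, ℝ)) : C(X, ℝ) :=
  if h : ∀ x, 0 < f x then ⟨fun x => f x ^ r, f.continuous.rpow_const fun x => Or.inl (h x).ne'⟩
  else 0

lemma rpowMap_apply (r : ℝ) {f : C(X, ℝ)} (h : ∀ x, 0 < f x) (x : X) :
    rpowMap r f x = f x ^ r := by
  simp [rpowMap, h]

lemma isOpen_forall_pos [CompactSpace X] : IsOpen {f : C(X, ℝ) | ∀ x, 0 < f x} := by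
  have h := ContinuousMap.isOpen_setOfPred_mapsTo (X := X) (Y := ℝ) isCompact_univ (isOpen_Ioi (a := 0))
  convert h using 1
  ext f; simp [MapsTo]

variable [CompactSpace X] [Nonempty X]

/-- The coefficients are real scalars, so each term has the same norm over `C(X, ℝ)` as over `ℝ`,
and the radius bound carries over. -/
lemma one_le_radius_binomialSeries (r : ℝ) : 1 ≤ (binomialSeries C(X, ℝ) r).radius := by
  refine ENNReal.le_of_forall_nnreal_lt fun ρ hρ => ?_
  apply FormalMultilinearSeries.le_radius_of_summable
  have h := (binomialSeries ℝ r).summable_norm_mul_pow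
    (hρ.trans_le (binomialSeries_radius_ge_one (𝕂 := ℝ) (𝔸 := ℝ) (a := r)))
  simpa only [binomialSeries, FormalMultilinearSeries.ofScalars_norm] using h

/-- Evaluation at `x` is a continuous algebra homomorphism, so it carries the series in `C(X, ℝ)` to
the scalar binomial series at `h x`. -/
lemma binomialSeries_sum_apply (r : ℝ) {h : C(X, ℝ)} (hh : ‖h‖ < 1) (x : X) :
    (binomialSeries C(X, ℝ) r).sum h x = (1 + h x) ^ r := by
  have h1 := one_le_radius_binomialSeries (X := X) r
  have h2 := ((binomialSeries C(X, ℝ) r).hasFPowerSeriesOnBall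
    (zero_lt_one.trans_le h1)).hasSum (y := h) (by
      refine Metric.eball_subset_eball h1 ?_
      rw [← ENNReal.ofReal_one, Metric.eball_ofReal]; simpa using hh)
  have hx : ‖h x‖ < 1 := (h.norm_coe_le_norm x).trans_lt hh
  have h3 := (Real.one_add_rpow_hasFPowerSeriesOnBall_zero (a := r)).hasSum (y := h x) (by
      rw [← ENNReal.ofReal_one, Metric.eball_ofReal]; simpa using hx)
  have h4 := h2.mapL (ContinuousMap.evalCLM ℝ x)
  simp only [zero_add] at h3 h4
  refine h4.unique ?_
  have e : (fun k => (ContinuousMap.evalCLM ℝ x) ((binomialSeries C(X, ℝ) r k) fun _ => h)) =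
      fun k => (binomialSeries ℝ r k) fun _ => h x := by
    ext k; rw [binomialSeries_apply, binomialSeries_apply]; simp
  rwa [e]

/-- Near `f₀`, `f ^ r = f₀ ^ r (1 + f₀⁻¹ (f - f₀)) ^ r`, and the second factor is an analytic
function on the unit ball of the Banach algebra. -/
lemma contDiffOn_rpowMap (r : ℝ) :
    ContDiffOn ℝ ∞ (rpowMap (X := X) r) {f | ∀ x, 0 < f x} := by
  intro f₀ hf₀
  apply ContDiffAt.contDiffWithinAt
  set i := rpowMap (-1) f₀ with hi
  have hi' : ∀ x, i x = (f₀ x)⁻¹ := fun x => by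
    rw [hi, rpowMap_apply _ hf₀, Real.rpow_neg_one]
  have h1 := one_le_radius_binomialSeries (X := X) r
  have han : ContDiffAt ℝ ∞ (binomialSeries C(X, ℝ) r).sum 0 :=
    (((binomialSeries C(X, ℝ) r).hasFPowerSeriesOnBall
      (zero_lt_one.trans_le h1)).analyticAt).contDiffAt
  have hd : ContDiffAt ℝ ∞ (fun f : C(X, ℝ) => i * (f - f₀)) f₀ :=
    contDiffAt_const.mul (contDiffAt_id.sub contDiffAt_const)
  have hc : ContDiffAt ℝ ∞
      (fun f => rpowMap r f₀ * (binomialSeries C(X, ℝ) r).sum (i * (f - f₀))) f₀ :=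
    contDiffAt_const.mul (ContDiffAt.comp f₀ (g := (binomialSeries C(X, ℝ) r).sum)
      (by simpa using han) hd)
  refine hc.congr_of_eventuallyEq ?_
  have e1 : ∀ᶠ f in nhds f₀, ‖i * (f - f₀)‖ < 1 := by
    have := hd.continuousAt.norm
    exact this.eventually_lt continuousAt_const (by simp)
  filter_upwards [e1, isOpen_forall_pos.mem_nhds hf₀] with f hf hf'
  ext x
  have hp : 0 < f₀ x := hf₀ x
  have hq : 0 < f x := hf' x
  rw [rpowMap_apply _ hf', ContinuousMap.mul_apply, rpowMap_apply _ hf₀,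
    binomialSeries_sum_apply r hf]
  have e2 : 1 + (i * (f - f₀)) x = f x / f₀ x := by
    simp [hi']; field_simp; ring
  rw [e2, Real.div_rpow hq.le hp.le]
  field_simp

end Power

/-! ### Smooth families of linear maps -/

section Families

variable {X Y Z : Type*} [NormedAddCommGroup X] [NormedSpace ℝ X] [NormedAddCommGroup Y]
  [NormedSpace ℝ Y] [NormedAddCommGroup Z] [NormedSpace ℝ Z]

lemma ContDiffOn.bilin {W : Type*} [NormedAddCommGroup W] [NormedSpace ℝ W]
    (B : X →L[ℝ] Y →L[ℝ] Z) {f : W → X} {g : W → Y} {U : Set W} {m : WithTop ℕ∞}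
    (hf : ContDiffOn ℝ m f U) (hg : ContDiffOn ℝ m g U) :
    ContDiffOn ℝ m (fun x => B (f x) (g x)) U :=
  (B.contDiff.comp_contDiffOn hf).clm_apply hg

/-- A smooth map that is linear in the second variable is a smooth family of linear maps. -/
lemma exists_contDiffOn_clm {F : X → Y → Z} {U : Set X} (hU : IsOpen U)
    (hF : ContDiffOn ℝ ∞ (fun p : X × Y => F p.1 p.2) (U ×ˢ univ))
    (hlin : ∀ x ∈ U, IsLinearMap ℝ (F x)) :
    ∃ L : X → Y →L[ℝ] Z, ContDiffOn ℝ ∞ L U ∧ ∀ x ∈ U, ∀ y, L x y = F x y := by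
  have hO : IsOpen (U ×ˢ (univ : Set Y)) := hU.prod isOpen_univ
  -- A linear map is its own derivative, so the partial derivative at `y = 0` recovers `F x`. It
  -- depends smoothly on `x` in operator norm, which pointwise smoothness does not give directly.
  refine ⟨fun x => (fderiv ℝ (fun p : X × Y => F p.1 p.2) (x, 0)).comp
    (ContinuousLinearMap.inr ℝ X Y), ?_, fun x hx y => ?_⟩
  · refine ContDiffOn.clm_comp ?_ contDiffOn_const
    exact (hF.fderiv_of_isOpen hO (by simp)).comp (f := fun x : X => (x, (0 : Y)))
      (contDiff_id.prodMk contDiff_const).contDiffOn (fun x hx => ⟨hx, mem_univ _⟩)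
  · have hd : HasFDerivAt (fun p : X × Y => F p.1 p.2) _ (x, 0) :=
      ((hF.contDiffAt (hO.mem_nhds ⟨hx, mem_univ _⟩)).differentiableAt (by simp)).hasFDerivAt
    have h1 : HasDerivAt (fun t : ℝ => (x, t • y)) ((0 : X), y) 0 := by
      refine (hasDerivAt_const _ _).prodMk ?_
      simpa using (hasDerivAt_id (0 : ℝ)).smul_const y
    have h2 := HasFDerivAt.comp_hasDerivAt (0 : ℝ) (f := fun t : ℝ => (x, t • y))
      (by simpa using hd) h1
    have h3 : HasDerivAt (fun t : ℝ => F x (t • y)) (F x y) 0 := by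
      have : (fun t : ℝ => F x (t • y)) = fun t => t • F x y := by
        ext t; exact (hlin x hx).map_smul t y
      rw [this]; simpa using (hasDerivAt_id (0 : ℝ)).smul_const (F x y)
    exact h2.unique h3

/-- A smooth map that is bilinear in the last two variables is a smooth family of bilinear maps. -/
lemma exists_contDiffOn_bilin {F : X → Y → Y → Z} {U : Set X} (hU : IsOpen U)
    (hF : ContDiffOn ℝ ∞ (fun p : X × Y × Y => F p.1 p.2.1 p.2.2) (U ×ˢ univ))
    (h1 : ∀ x ∈ U, ∀ v, IsLinearMap ℝ fun u => F x u v)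
    (h2 : ∀ x ∈ U, ∀ u, IsLinearMap ℝ (F x u)) :
    ∃ L : X → Y →L[ℝ] Y →L[ℝ] Z, ContDiffOn ℝ ∞ L U ∧ ∀ x ∈ U, ∀ u v, L x u v = F x u v := by
  -- Currying happens in two stages: `v` first, with `(x, u)` as parameter, then `u`.
  obtain ⟨L, hL, hL'⟩ := exists_contDiffOn_clm (F := fun (q : X × Y) v => F q.1 q.2 v)
    (U := U ×ˢ univ) (hU.prod isOpen_univ)
    (hF.comp (f := fun p : (X × Y) × Y => (p.1.1, p.1.2, p.2)) (by fun_prop)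
      (fun p hp => ⟨hp.1.1, mem_univ _⟩)) (fun q hq => h2 q.1 hq.1 q.2)
  obtain ⟨M, hM, hM'⟩ := exists_contDiffOn_clm (F := fun x u => L (x, u)) hU hL (fun x hx => by
    constructor
    · intro u u'; ext v
      simp [hL' (x, u + u') ⟨hx, mem_univ _⟩, hL' (x, u) ⟨hx, mem_univ _⟩,
        hL' (x, u') ⟨hx, mem_univ _⟩, (h1 x hx v).map_add]
    · intro c u; ext v
      simp [hL' (x, c • u) ⟨hx, mem_univ _⟩, hL' (x, u) ⟨hx, mem_univ _⟩, (h1 x hx v).map_smul])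
  exact ⟨M, hM, fun x hx u v => by rw [hM' x hx, hL' (x, u) ⟨hx, mem_univ _⟩]⟩

end Families

/-! ### Autonomous equations with a `C¹` right-hand side -/

section ODE

variable {X : Type*} [NormedAddCommGroup X] [NormedSpace ℝ X]

lemma exists_solution_Icc [CompleteSpace X] {f : X → X} {U : Set X} (hU : IsOpen U)
    (hf : ContDiffOn ℝ 1 f U) {x₀ : X} (hx₀ : x₀ ∈ U) :
    ∃ T : ℝ, 0 < T ∧ ∃ α : ℝ → X, α 0 = x₀ ∧ (∀ t ∈ Icc 0 T, α t ∈ U) ∧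
      ∀ t ∈ Icc 0 T, HasDerivWithinAt α (f (α t)) (Icc 0 T) t := by
  obtain ⟨r, hr, ε, hε, H⟩ := (hf.contDiffAt
    (hU.mem_nhds hx₀)).exists_forall_mem_closedBall_exists_eq_forall_mem_Ioo_hasDerivAt 0
  obtain ⟨α, hα0, hα⟩ := H x₀ (Metric.mem_closedBall_self hr.le)
  have h0 : ContinuousAt α 0 := (hα 0 (by simp [hε])).continuousAt
  have h1 : ∀ᶠ t in nhds (0 : ℝ), α t ∈ U ∧ t ∈ Ioo (0 - ε) (0 + ε) :=
    (h0.eventually (by rw [hα0]; exact hU.mem_nhds hx₀)).and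
      (Ioo_mem_nhds (by linarith) (by linarith))
  obtain ⟨δ, hδ, hδ'⟩ := Metric.eventually_nhds_iff.1 h1
  have h2 : ∀ t ∈ Icc (0 : ℝ) (δ / 2), dist t 0 < δ := fun t ht => by
    rw [Real.dist_eq, sub_zero, abs_of_nonneg ht.1]; linarith [ht.2]
  exact ⟨δ / 2, by positivity, α, hα0, fun t ht => (hδ' (h2 t ht)).1,
    fun t ht => (hα t (hδ' (h2 t ht)).2).hasDerivWithinAt⟩

/-- The coincidence set is closed. It extends to the right of each of its points, because `f` is
Lipschitz near the common value, where Grönwall applies. Only `α` has to stay in `U`: `β` is near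
`α` just after a coincidence time. -/
lemma solution_unique_Icc {f : X → X} {U : Set X} (hU : IsOpen U)
    (hf : ContDiffOn ℝ 1 f U) {T : ℝ} {α β : ℝ → X} (h0 : α 0 = β 0)
    (hαU : ∀ t ∈ Icc 0 T, α t ∈ U)
    (hα : ∀ t ∈ Icc 0 T, HasDerivWithinAt α (f (α t)) (Icc 0 T) t)
    (hβ : ∀ t ∈ Icc 0 T, HasDerivWithinAt β (f (β t)) (Icc 0 T) t) :
    EqOn α β (Icc 0 T) := by
  have hαc : ContinuousOn α (Icc 0 T) := fun t ht => (hα t ht).continuousWithinAt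
  have hβc : ContinuousOn β (Icc 0 T) := fun t ht => (hβ t ht).continuousWithinAt
  have key : Icc 0 T ⊆ {t | α t = β t} := by
    refine IsClosed.Icc_subset_of_forall_mem_nhdsWithin ?_ h0 ?_
    · have : {t | α t = β t} ∩ Icc 0 T = Icc 0 T ∩ (fun t => α t - β t) ⁻¹' {0} := by
        ext t; simp [sub_eq_zero, and_comm]
      rw [this]
      exact (hαc.sub hβc).preimage_isClosed_of_isClosed isClosed_Icc isClosed_singleton
    · rintro t ⟨ht, ht'⟩
      have htI : t ∈ Icc 0 T := Ico_subset_Icc_self ht'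
      have hαβ : α t = β t := ht
      obtain ⟨K, S, hS, hK⟩ := (hf.contDiffAt (hU.mem_nhds (hαU t htI))).exists_lipschitzOnWith
      have hmem : Icc 0 T ∈ nhdsWithin t (Ici t) :=
        Filter.mem_of_superset (Icc_mem_nhdsGE ht'.2) (Icc_subset_Icc_left ht'.1)
      have e1 : ∀ᶠ r in nhdsWithin t (Ici t), α r ∈ S :=
        ((hαc t htI).mono_of_mem_nhdsWithin hmem).eventually hS
      have e2 : ∀ᶠ r in nhdsWithin t (Ici t), β r ∈ S :=
        ((hβc t htI).mono_of_mem_nhdsWithin hmem).eventually (by rw [← hαβ]; exact hS)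
      obtain ⟨b, hb, hb'⟩ := (mem_nhdsGE_iff_exists_Icc_subset).1
        ((e1.and e2).and (Filter.eventually_mem_set.2 hmem))
      have hsub : Icc t b ⊆ Icc 0 T := fun r hr => (hb' hr).2
      have hder : ∀ {δ : ℝ → X}, (∀ t ∈ Icc 0 T, HasDerivWithinAt δ (f (δ t)) (Icc 0 T) t) →
          ∀ r ∈ Ico t b, HasDerivWithinAt δ (f (δ r)) (Ici r) r := fun hδ r hr =>
        (hδ r (hsub (Ico_subset_Icc_self hr))).mono_of_mem_nhdsWithin
          (Filter.mem_of_superset (Icc_mem_nhdsGE hr.2)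
            ((Icc_subset_Icc_left hr.1).trans hsub))
      have := ODE_solution_unique_of_mem_Icc_right (v := fun _ => f) (s := fun _ => S) (K := K)
        (fun _ _ => hK) (hαc.mono hsub) (hder hα)
        (fun r hr => (hb' (Ico_subset_Icc_self hr)).1.1) (hβc.mono hsub) (hder hβ)
        (fun r hr => (hb' (Ico_subset_Icc_self hr)).1.2) hαβ
      exact Filter.mem_of_superset (Ioc_mem_nhdsGT hb) fun r hr => this (Ioc_subset_Icc_self hr)
  exact key

end ODE

section Morrey

/-! ### Continuity of functions of fractional smoothness larger than `1/2` -/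

/-- Cauchy–Schwarz against the constant function `1`. -/
lemma lintegral_sq_le_mul {X : Type*} [MeasurableSpace X] (μ : Measure X) {f : X → ENNReal}
    (hf : AEMeasurable f μ) : (∫⁻ x, f x ∂μ) ^ 2 ≤ μ univ * ∫⁻ x, f x ^ 2 ∂μ := by
  have h := ENNReal.lintegral_mul_le_Lp_mul_Lq μ Real.HolderConjugate.two_two
    (aemeasurable_const (b := (1 : ENNReal))) hf
  have e : ∀ a : ENNReal, (a ^ (1 / 2 : ℝ)) ^ 2 = a := fun a => by
    rw [← ENNReal.rpow_natCast, ← ENNReal.rpow_mul]; norm_num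
  have h' : ∫⁻ x, f x ∂μ ≤ μ univ ^ (1 / 2 : ℝ) * (∫⁻ x, f x ^ 2 ∂μ) ^ (1 / 2 : ℝ) := by
    simpa using h
  calc (∫⁻ x, f x ∂μ) ^ 2 ≤ _ := pow_le_pow_left' h' 2
    _ = μ univ * ∫⁻ x, f x ^ 2 ∂μ := by
        rw [mul_pow, e, e]

/-- A difference of two means is the mean of the differences over the product measure, to which
Jensen's inequality applies. -/
lemma enorm_integral_sub_sq_le {V X : Type*} [NormedAddCommGroup V] [NormedSpace ℝ V]
    [MeasurableSpace X] {α β : Measure X} [IsProbabilityMeasure α]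
    [IsProbabilityMeasure β] {f : X → V} (hα : Integrable f α) (hβ : Integrable f β) :
    ‖∫ y, f y ∂α - ∫ z, f z ∂β‖ₑ ^ 2 ≤ ∫⁻ p, ‖f p.1 - f p.2‖ₑ ^ 2 ∂(α.prod β) := by
  have h1 : Integrable (fun p : X × X => f p.1) (α.prod β) := hα.comp_fst β
  have h2 : Integrable (fun p : X × X => f p.2) (α.prod β) := hβ.comp_snd α
  have e : ∫ y, f y ∂α - ∫ z, f z ∂β = ∫ p, (f p.1 - f p.2) ∂(α.prod β) := by
    rw [integral_sub h1 h2, integral_fun_fst, integral_fun_snd]; simp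
  rw [e]
  calc _ ≤ (∫⁻ p, ‖f p.1 - f p.2‖ₑ ∂(α.prod β)) ^ 2 := by
        gcongr; exact enorm_integral_le_lintegral_enorm _
    _ ≤ _ := by
        refine (lintegral_sq_le_mul _ (h1.sub h2).aestronglyMeasurable.enorm).trans ?_
        simp

variable {n : ℕ}

/-- The density of the Slobodeckij seminorm with respect to Lebesgue measure. -/
def slobodeckijDensity (σ : ℝ) (f : UnitAddCircle → E n) (p : UnitAddCircle × UnitAddCircle) :
    ENNReal :=
  ENNReal.ofReal (1 / dist p.2 p.1) * ‖fracDiff σ f p‖ₑ ^ 2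

lemma measurable_slobodeckijDensity {σ : ℝ} {f : UnitAddCircle → E n} (hf : Measurable f) :
    Measurable (slobodeckijDensity σ f) := by
  unfold slobodeckijDensity fracDiff
  have h : Measurable fun p : UnitAddCircle × UnitAddCircle => dist p.2 p.1 :=
    (continuous_snd.dist continuous_fst).measurable
  have h1 : Measurable fun p : UnitAddCircle × UnitAddCircle => f p.2 - f p.1 :=
    (hf.comp measurable_snd).sub (hf.comp measurable_fst)
  exact ((measurable_const.div h).ennreal_ofReal).mul
    ((((h.pow_const σ).inv).smul h1).enorm.pow_const 2)

lemma lintegral_fracDiff_mu {σ : ℝ} {f : UnitAddCircle → E n} (hf : Measurable f) :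
    ∫⁻ p, ‖fracDiff σ f p‖ₑ ^ 2 ∂mu =
      ∫⁻ p, slobodeckijDensity σ f p ∂((volume : Measure UnitAddCircle).prod volume) := by
  have h : Measurable fun p : UnitAddCircle × UnitAddCircle => dist p.2 p.1 :=
    (continuous_snd.dist continuous_fst).measurable
  have h1 : Measurable fun p : UnitAddCircle × UnitAddCircle => f p.2 - f p.1 :=
    (hf.comp measurable_snd).sub (hf.comp measurable_fst)
  rw [mu, lintegral_withDensity_eq_lintegral_mul _ (by simpa using h.inv.ennreal_ofReal)]
  · rfl
  · unfold fracDiff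
    exact (((h.pow_const σ).inv).smul h1).enorm.pow_const 2

lemma dist_coe_le (y z : ℝ) : dist (z : UnitAddCircle) (y : UnitAddCircle) ≤ |z - y| := by
  rw [dist_eq_norm, ← AddCircle.coe_sub]
  exact QuotientAddGroup.norm_mk_le_norm

lemma enorm_sq_le_slobodeckijDensity {σ r : ℝ} (hσ : 0 ≤ σ) (f : UnitAddCircle → E n)
    {x y : UnitAddCircle} (h : dist y x ≤ r) :
    ‖f y - f x‖ₑ ^ 2 ≤ ENNReal.ofReal (r ^ (2 * σ + 1)) * slobodeckijDensity σ f (x, y) := by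
  rcases eq_or_ne y x with rfl | hne
  · simp
  have hd : 0 < dist y x := dist_pos.2 hne
  have hr : 0 < r := hd.trans_le h
  have e : ∀ v : E n, ‖v‖ₑ ^ 2 = ENNReal.ofReal (‖v‖ ^ 2) := fun v => by
    rw [ENNReal.ofReal_pow (norm_nonneg _), ofReal_norm]
  rw [slobodeckijDensity, e, e, ← ENNReal.ofReal_mul (by positivity),
    ← ENNReal.ofReal_mul (by positivity)]
  refine ENNReal.ofReal_le_ofReal ?_
  simp only [fracDiff, norm_smul, norm_inv, Real.norm_eq_abs, mul_pow, inv_pow, sq_abs]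
  rw [← Real.rpow_mul_natCast hd.le]
  have h1 : dist y x ^ (2 * σ + 1) ≤ r ^ (2 * σ + 1) := by gcongr
  rw [Real.rpow_add_one hd.ne'] at h1
  have h2 : 0 < dist y x ^ (2 * σ) := by positivity
  calc ‖f y - f x‖ ^ 2 = dist y x ^ (2 * σ) * dist y x *
        (1 / dist y x * ((dist y x ^ (2 * σ))⁻¹ * ‖f y - f x‖ ^ 2)) := by field_simp
    _ ≤ _ := by
        rw [show (σ * (2 : ℕ)) = 2 * σ by push_cast; ring]
        gcongr

lemma intervalIntegrable_coe {f : UnitAddCircle → E n} (hf : Integrable f) (a b : ℝ) :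
    IntervalIntegrable (fun t : ℝ => f t) volume a b := by
  have hp : Function.Periodic (fun t : ℝ => f t) 1 := fun t => by simp
  refine hp.intervalIntegrable (t := 0) one_ne_zero ?_ a b
  rw [zero_add, intervalIntegrable_iff_integrableOn_Ioc_of_le zero_le_one]
  have h3 := UnitAddCircle.measurePreserving_mk 0
  rw [zero_add] at h3
  exact h3.integrable_comp_of_integrable hf

/-- Any two points of the intervals are within `r`, so the squared increment is at most `r^(2σ+1)`
times the Slobodeckij density. Normalising the two averages costs `2 / r²`, leaving `2 r^(2σ-1) N²`.
Its square root decays in `r` because `σ > 1/2`. -/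
lemma norm_average_sub_average_le {σ : ℝ} (hσ : 1 / 2 < σ) {f : UnitAddCircle → E n}
    (hf : Measurable f) (hfi : Integrable f) {N : ℝ} (hN : 0 ≤ N)
    (hfN : ∫⁻ p, ‖fracDiff σ f p‖ₑ ^ 2 ∂mu ≤ ENNReal.ofReal (N ^ 2)) (x : ℝ) {r : ℝ} (hr : 0 < r)
    (hr1 : r ≤ 1) :
    ‖r⁻¹ • (∫ t in x..x + r, f t) - (r / 2)⁻¹ • ∫ t in x..x + r / 2, f t‖
      ≤ 2 * r ^ (σ - 1 / 2) * N := by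
  have hprob : ∀ q : ℝ, 0 < q →
      IsProbabilityMeasure (ENNReal.ofReal q⁻¹ • volume.restrict (Ioc x (x + q))) := by
    intro q hq
    constructor
    rw [Measure.smul_apply, Measure.restrict_apply_univ, Real.volume_Ioc, add_sub_cancel_left,
      smul_eq_mul, ← ENNReal.ofReal_mul (by positivity), inv_mul_cancel₀ hq.ne', ENNReal.ofReal_one]
  have hint : ∀ q : ℝ, 0 < q → ∫ t, f (t : UnitAddCircle)
      ∂(ENNReal.ofReal q⁻¹ • volume.restrict (Ioc x (x + q))) = q⁻¹ • ∫ t in x..x + q, f t := by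
    intro q hq
    rw [integral_smul_measure, intervalIntegral.integral_of_le (by linarith),
      ENNReal.toReal_ofReal (by positivity)]
  have hI : ∀ q : ℝ, 0 < q → Integrable (fun t : ℝ => f (t : UnitAddCircle))
      (ENNReal.ofReal q⁻¹ • volume.restrict (Ioc x (x + q))) := by
    intro q hq
    have h := intervalIntegrable_coe hfi x (x + q)
    rw [intervalIntegrable_iff_integrableOn_Ioc_of_le (by linarith)] at h
    exact h.smul_measure (by simp)
  have hr2 : 0 < r / 2 := by positivity
  have := hprob r hr
  have := hprob _ hr2
  have key := enorm_integral_sub_sq_le (hI r hr) (hI _ hr2)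
  rw [hint r hr, hint _ hr2] at key
  have hmeas : Measurable fun p : ℝ × ℝ =>
      slobodeckijDensity σ f ((p.2 : UnitAddCircle), (p.1 : UnitAddCircle)) :=
    (measurable_slobodeckijDensity hf).comp
      ((AddCircle.measurable_mk'.comp measurable_snd).prodMk
        (AddCircle.measurable_mk'.comp measurable_fst))
  have hmp := (UnitAddCircle.measurePreserving_mk x).prod (UnitAddCircle.measurePreserving_mk x)
  -- The square `(x, x + 1]²` is a fundamental domain for the torus, so it carries exactly the full
  -- energy.
  have hT : ∫⁻ p : ℝ × ℝ, slobodeckijDensity σ f ((p.2 : UnitAddCircle), (p.1 : UnitAddCircle))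
      ∂((volume.restrict (Ioc x (x + 1))).prod (volume.restrict (Ioc x (x + 1))))
      ≤ ENNReal.ofReal (N ^ 2) := by
    refine le_trans (le_of_eq ?_) hfN
    rw [lintegral_fracDiff_mu hf, ← (Measure.measurePreserving_swap).lintegral_comp
      (measurable_slobodeckijDensity hf)]
    exact hmp.lintegral_comp ((measurable_slobodeckijDensity hf).comp measurable_swap)
  have hle : ∫⁻ p, ‖f (p.1 : ℝ) - f (p.2 : ℝ)‖ₑ ^ 2
      ∂((ENNReal.ofReal r⁻¹ • volume.restrict (Ioc x (x + r))).prod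
        (ENNReal.ofReal (r / 2)⁻¹ • volume.restrict (Ioc x (x + r / 2)))) ≤
      ENNReal.ofReal ((2 * r ^ (σ - 1 / 2) * N) ^ 2) := by
    rw [Measure.prod_smul_left, Measure.prod_smul_right, lintegral_smul_measure,
      lintegral_smul_measure]
    have hsub : ∫⁻ p : ℝ × ℝ, ‖f (p.1 : ℝ) - f (p.2 : ℝ)‖ₑ ^ 2
        ∂((volume.restrict (Ioc x (x + r))).prod (volume.restrict (Ioc x (x + r / 2)))) ≤
        ENNReal.ofReal (r ^ (2 * σ + 1)) * ENNReal.ofReal (N ^ 2) := by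
      calc _ ≤ ∫⁻ p : ℝ × ℝ, ENNReal.ofReal (r ^ (2 * σ + 1)) *
            slobodeckijDensity σ f ((p.2 : UnitAddCircle), (p.1 : UnitAddCircle))
            ∂((volume.restrict (Ioc x (x + r))).prod (volume.restrict (Ioc x (x + r / 2)))) := by
            rw [Measure.prod_restrict]
            refine setLIntegral_mono (hmeas.const_mul _) fun p hp => ?_
            refine enorm_sq_le_slobodeckijDensity (by linarith) f ((dist_coe_le _ _).trans ?_)
            obtain ⟨⟨h1, h2⟩, h3, h4⟩ := hp
            rw [abs_le]; constructor <;> linarith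
        _ ≤ ∫⁻ p : ℝ × ℝ, ENNReal.ofReal (r ^ (2 * σ + 1)) *
            slobodeckijDensity σ f ((p.2 : UnitAddCircle), (p.1 : UnitAddCircle))
            ∂((volume.restrict (Ioc x (x + 1))).prod (volume.restrict (Ioc x (x + 1)))) := by
            rw [Measure.prod_restrict, Measure.prod_restrict]
            refine lintegral_mono_set (prod_mono ?_ ?_) <;>
            exact Ioc_subset_Ioc_right (by linarith)
        _ ≤ _ := by
            rw [lintegral_const_mul _ hmeas]
            gcongr
    refine (mul_le_mul_right (mul_le_mul_right hsub _) _).trans ?_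
    rw [← ENNReal.ofReal_mul (by positivity), ← ENNReal.ofReal_mul (by positivity),
      ← ENNReal.ofReal_mul (by positivity)]
    refine ENNReal.ofReal_le_ofReal ?_
    have e : r ^ (2 * σ + 1) = r * r * (r ^ (σ - 1 / 2)) ^ 2 := by
      rw [← Real.rpow_mul_natCast hr.le, ← sq, ← Real.rpow_natCast, ← Real.rpow_add hr]
      congr 1; push_cast; ring
    rw [e]
    have : r⁻¹ * ((r / 2)⁻¹ * (r * r * (r ^ (σ - 1 / 2)) ^ 2 * N ^ 2)) =
      2 * (r ^ (σ - 1 / 2) * N) ^ 2 := by field_simp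
    rw [this]
    nlinarith [sq_nonneg (r ^ (σ - 1 / 2) * N)]
  have h := key.trans hle
  rw [← ofReal_norm, ← ENNReal.ofReal_pow (norm_nonneg _),
    ENNReal.ofReal_le_ofReal_iff (by positivity)] at h
  exact le_of_sq_le_sq h (by positivity)

/-- The continuous function on the circle induced by a continuous periodic function. -/
def liftPeriodic (G : ℝ → E n) (hG : Continuous G) (hp : Function.Periodic G 1) :
    C(UnitAddCircle, E n) :=
  ⟨hp.lift, continuous_coinduced_dom.2 hG⟩

@[simp] lemma liftPeriodic_coe {G : ℝ → E n} (hG : Continuous G) (hp : Function.Periodic G 1)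
    (t : ℝ) : liftPeriodic G hG hp t = G t := rfl

/-- A function of fractional smoothness `σ > 1/2` has a continuous representative, and its supremum
norm is bounded by an arbitrarily small multiple of the Slobodeckij seminorm plus a multiple of the
`L¹` norm. -/
lemma exists_continuous_rep {σ : ℝ} (hσ : 1 / 2 < σ) : ∃ C ρ : ℝ, 0 ≤ C ∧ 0 ≤ ρ ∧ ρ < 1 ∧
    ∀ {f : UnitAddCircle → E n}, Measurable f → Integrable f → ∀ {N : ℝ}, 0 ≤ N →
      ∫⁻ p, ‖fracDiff σ f p‖ₑ ^ 2 ∂mu ≤ ENNReal.ofReal (N ^ 2) →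
      ∃ g : C(UnitAddCircle, E n), g =ᵐ[volume] f ∧
        ∀ k : ℕ, ‖g‖ ≤ C * ρ ^ k * N + 2 ^ k * ∫ x, ‖f x‖ := by
  -- This is the factor gained each time the averaging interval is halved. Summing the geometric
  -- series gives the constant `2 / (1 - ρ)` below.
  set ρ : ℝ := (1 / 2) ^ (σ - 1 / 2) with hρ
  have hρ0 : 0 ≤ ρ := by positivity
  have hρ1 : ρ < 1 := Real.rpow_lt_one (by norm_num) (by norm_num) (by linarith)
  refine ⟨2 / (1 - ρ), ρ, div_nonneg (by norm_num) (by linarith), hρ0, hρ1, ?_⟩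
  intro f hf hfi N hN hfN
  set a : ℕ → ℝ → E n := fun k x => ((1 / 2 : ℝ) ^ k)⁻¹ • ∫ t in x..x + (1 / 2) ^ k, f (t : ℝ) with ha
  have hii := intervalIntegrable_coe hfi
  have hloc : LocallyIntegrable (fun t : ℝ => f t) :=
    fun x => ⟨Ioc (x - 1) (x + 1), Ioc_mem_nhds (by linarith) (by linarith),
      (intervalIntegrable_iff_integrableOn_Ioc_of_le (by linarith)).1 (hii _ _)⟩
  have hac : ∀ k, Continuous (a k) := by
    intro k
    have hP := intervalIntegral.continuous_primitive hii 0
    have : a k = fun x => ((1 / 2 : ℝ) ^ k)⁻¹ •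
        ((∫ t in (0 : ℝ)..x + (1 / 2) ^ k, f (t : ℝ)) - ∫ t in (0 : ℝ)..x, f (t : ℝ)) := by
      ext1 x
      rw [intervalIntegral.integral_interval_sub_left (hii _ _) (hii _ _)]
    rw [this]
    have hP' : Continuous fun x => ∫ t in (0 : ℝ)..x + (1 / 2) ^ k, f (t : ℝ) :=
      hP.comp (continuous_add_const _)
    exact (hP'.sub hP).const_smul (((1 / 2 : ℝ) ^ k)⁻¹)
  have hap : ∀ k, Function.Periodic (a k) 1 := by
    intro k x
    simp only [ha]
    congr 1
    rw [add_right_comm, ← intervalIntegral.integral_comp_add_right]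
    simp
  have hstep : ∀ x k, dist (a k x) (a (k + 1) x) ≤ 2 * N * ρ ^ k := by
    intro x k
    have h := norm_average_sub_average_le hσ hf hfi hN hfN x (r := (1 / 2) ^ k) (by positivity)
      (pow_le_one₀ (by norm_num) (by norm_num))
    rw [dist_eq_norm]
    convert h using 1
    · simp only [ha, pow_succ, mul_one_div]
    · rw [hρ, ← Real.rpow_natCast, ← Real.rpow_natCast, ← Real.rpow_mul (by norm_num),
        ← Real.rpow_mul (by norm_num), mul_comm (k : ℝ)]
      ring
  choose g hg using fun x => cauchySeq_tendsto_of_complete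
    (cauchySeq_of_le_geometric ρ (2 * N) hρ1 (hstep x))
  have hdist : ∀ x k, dist (a k x) (g x) ≤ 2 * N * ρ ^ k / (1 - ρ) := fun x k =>
    dist_le_of_le_geometric_of_tendsto ρ (2 * N) hρ1 (hstep x) (hg x) k
  have hunif : TendstoUniformly a g Filter.atTop := by
    rw [Metric.tendstoUniformly_iff]
    intro ε hε
    have h0 : Filter.Tendsto (fun k : ℕ => 2 * N * ρ ^ k / (1 - ρ)) Filter.atTop (nhds 0) := by
      simpa using ((tendsto_pow_atTop_nhds_zero_of_lt_one hρ0 hρ1).const_mul (2 * N)).div_const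
        (1 - ρ)
    filter_upwards [h0.eventually (gt_mem_nhds hε)] with k hk x
    rw [dist_comm]; exact (hdist x k).trans_lt hk
  have hgc : Continuous g := hunif.continuous (Filter.Frequently.of_forall hac)
  have hgp : Function.Periodic g 1 := fun x => by
    have h1 := hg (x + 1)
    simp only [hap _ x] at h1
    exact tendsto_nhds_unique h1 (hg x)
  -- By the Lebesgue differentiation theorem the dyadic averages converge to `f` almost everywhere.
  have hae : ∀ᵐ t : ℝ, g t = f t := by
    filter_upwards [LocallyIntegrable.ae_hasDerivAt_integral hloc] with x hx
    have h1 := (hx 0).tendsto_slope_zero_right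
    have h2 : Filter.Tendsto (fun k : ℕ => (1 / 2 : ℝ) ^ k) Filter.atTop (nhdsWithin 0 (Ioi 0)) :=
      tendsto_nhdsWithin_iff.2 ⟨tendsto_pow_atTop_nhds_zero_of_lt_one (by norm_num) (by norm_num),
        Filter.Eventually.of_forall fun k => by simp⟩
    refine tendsto_nhds_unique (hg x) ((h1.comp h2).congr fun k => ?_)
    simp only [Function.comp, ha]
    rw [intervalIntegral.integral_interval_sub_left (hii _ _) (hii _ _)]
  refine ⟨liftPeriodic g hgc hgp, ?_, fun k => ?_⟩
  · have hm := UnitAddCircle.measurePreserving_mk 0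
    rw [Filter.EventuallyEq, ← hm.map_eq, ae_map_iff hm.aemeasurable
      (measurableSet_eq_fun (ContinuousMap.continuous _).measurable hf)]
    exact ae_restrict_of_ae hae
  · have hI : 0 ≤ ∫ x, ‖f x‖ := integral_nonneg fun _ => norm_nonneg _
    refine (ContinuousMap.norm_le _ (by have : 0 < 1 - ρ := by linarith
                                        positivity)).2 fun x => ?_
    induction x using QuotientAddGroup.induction_on with
    | H x =>
    rw [show liftPeriodic g hgc hgp (x : UnitAddCircle) = g x from rfl]
    -- The average at level `k` is controlled by the `L¹` norm, and the distance from it to `g` by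
    -- the tail of the series. Leaving `k` free is what makes the seminorm coefficient arbitrarily
    -- small.
    have h1 : ‖a k x‖ ≤ 2 ^ k * ∫ x, ‖f x‖ := by
      rw [ha, norm_smul]
      have h2 : (1 / 2 : ℝ) ^ k ≤ 1 := pow_le_one₀ (by norm_num) (by norm_num)
      have h3 : (0 : ℝ) < (1 / 2) ^ k := by positivity
      have e : ‖((1 / 2 : ℝ) ^ k)⁻¹‖ = 2 ^ k := by simp
      rw [e]
      gcongr
      refine (intervalIntegral.norm_integral_le_integral_norm (by linarith)).trans ?_
      rw [← UnitAddCircle.intervalIntegral_preimage x]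
      exact intervalIntegral.integral_mono_interval le_rfl (by linarith) (by linarith)
        (Filter.Eventually.of_forall fun _ => norm_nonneg _) (hii _ _).norm
    have h2 := hdist x k
    rw [dist_comm, dist_eq_norm] at h2
    have h3 : g x = (g x - a k x) + a k x := by abel
    rw [h3]
    refine (norm_add_le _ _).trans (add_le_add (h2.trans (le_of_eq (by ring))) h1)

end Morrey

section WeakDerivative

/-! ### Functions with a continuous weak derivative -/

/-- For `k ≠ 0` the derivative of the character `fourier (-k)` is a nonzero multiple of itself.
Testing with its real and imaginary parts thus kills the `k`-th Fourier coefficient. Subtracting the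
mean kills the zeroth, and the Fourier basis is complete in `L²`. -/
lemma ae_const_of_integral_deriv_mul_eq_zero {w : UnitAddCircle → ℝ} (hw : MemLp w 2)
    (H : ∀ φ : UnitAddCircle → ℝ, ContDiff ℝ ∞ (fun t : ℝ => φ t) →
      ∫ t in (0 : ℝ)..1, deriv (fun r : ℝ => φ r) t * w t = 0) :
    ∃ c : ℝ, w =ᵐ[volume] fun _ => c := by
  have hvol : (volume : Measure UnitAddCircle) = AddCircle.haarAddCircle := by
    rw [AddCircle.volume_eq_smul_haarAddCircle]; simp
  refine ⟨∫ x, w x, ?_⟩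
  set c := ∫ x, w x with hc
  have hf : MemLp (fun x => ((w x - c : ℝ) : ℂ)) 2 AddCircle.haarAddCircle := by
    rw [← hvol]; exact (hw.sub (memLp_const c)).ofReal
  have hwi : Integrable w := hw.integrable (by norm_num)
  have hwI : IntervalIntegrable (fun t : ℝ => w t) volume 0 1 := by
    rw [intervalIntegrable_iff_integrableOn_Ioc_of_le zero_le_one]
    have h3 := UnitAddCircle.measurePreserving_mk 0
    rw [zero_add] at h3
    exact h3.integrable_comp_of_integrable hwi
  have hofReal : ∀ {v : ℝ → ℝ}, IntervalIntegrable v volume 0 1 →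
      IntervalIntegrable (fun t => (v t : ℂ)) volume 0 1 := fun hv => ⟨hv.1.ofReal, hv.2.ofReal⟩
  have hsmooth : ∀ k : ℤ, ContDiff ℝ ∞ (fun t : ℝ => (fourier k (t : UnitAddCircle) : ℂ)) := by
    intro k
    simp only [fourier_coe_apply]
    have h : ContDiff ℝ ∞ fun t : ℝ => (t : ℂ) := Complex.ofRealCLM.contDiff
    exact ((contDiff_const.mul h).div_const _).cexp
  have hcoef : ∀ k : ℤ, fourierCoeff (fun x => ((w x - c : ℝ) : ℂ)) k = 0 := by
    intro k
    rw [fourierCoeff_eq_intervalIntegral _ k 0]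
    simp only [zero_add, div_one, one_smul, smul_eq_mul]
    rcases eq_or_ne k 0 with rfl | hk
    · simp only [neg_zero, fourier_zero, one_mul, Complex.ofReal_sub]
      rw [intervalIntegral.integral_sub (hofReal hwI) (by simp)]
      rw [intervalIntegral.integral_ofReal, hc, ← UnitAddCircle.intervalIntegral_preimage 0]
      simp
    · have hd : ∀ t : ℝ, HasDerivAt (fun y : ℝ => (fourier (-k) (y : UnitAddCircle) : ℂ))
          (-2 * Real.pi * Complex.I * k * fourier (-k) (t : UnitAddCircle)) t := by
        intro t
        simpa using hasDerivAt_fourier_neg 1 k t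
      set z : ℝ → ℂ := fun t => -2 * Real.pi * Complex.I * k * fourier (-k) (t : UnitAddCircle)
        with hz
      have hzc : Continuous z := continuous_const.mul (hsmooth (-k)).continuous
      have hzw : ∀ v : ℝ → ℝ, IntervalIntegrable v volume 0 1 →
          IntervalIntegrable (fun t => z t * (v t : ℂ)) volume 0 1 := fun v hv =>
        (hofReal hv).continuousOn_mul hzc.continuousOn
      have hre : ∀ v : ℝ → ℝ, IntervalIntegrable v volume 0 1 →
          (∫ t in (0 : ℝ)..1, z t * (v t : ℂ)).re = ∫ t in (0 : ℝ)..1, (z t).re * v t := by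
        intro v hv
        have := Complex.reCLM.intervalIntegral_comp_comm (hzw v hv)
        rw [Complex.reCLM_apply] at this
        rw [← this]; simp
      have him : ∀ v : ℝ → ℝ, IntervalIntegrable v volume 0 1 →
          (∫ t in (0 : ℝ)..1, z t * (v t : ℂ)).im = ∫ t in (0 : ℝ)..1, (z t).im * v t := by
        intro v hv
        have := Complex.imCLM.intervalIntegral_comp_comm (hzw v hv)
        rw [Complex.imCLM_apply] at this
        rw [← this]; simp
      have hdre : ∀ t, deriv (fun r : ℝ => (fourier (-k) (r : UnitAddCircle) : ℂ).re) t =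
          (z t).re := fun t =>
        (Complex.reCLM.hasFDerivAt.comp_hasDerivAt t (hd t)).deriv
      have hdim : ∀ t, deriv (fun r : ℝ => (fourier (-k) (r : UnitAddCircle) : ℂ).im) t =
          (z t).im := fun t =>
        (Complex.imCLM.hasFDerivAt.comp_hasDerivAt t (hd t)).deriv
      have h1 : ∫ t in (0 : ℝ)..1, z t * (w t : ℂ) = 0 := by
        apply Complex.ext
        · rw [hre _ hwI]
          simpa only [hdre, Complex.zero_re] using H (fun x => (fourier (-k) x : ℂ).re)
            (Complex.reCLM.contDiff.comp (hsmooth (-k)))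
        · rw [him _ hwI]
          simpa only [hdim, Complex.zero_im] using H (fun x => (fourier (-k) x : ℂ).im)
            (Complex.imCLM.contDiff.comp (hsmooth (-k)))
      have h2 : ∫ t in (0 : ℝ)..1, z t = 0 := by
        rw [intervalIntegral.integral_eq_sub_of_hasDerivAt (fun t _ => hd t)
          (hzc.intervalIntegrable _ _)]
        rw [show ((1 : ℝ) : UnitAddCircle) = ((0 : ℝ) : UnitAddCircle) by simp, sub_self]
      have h3 : ∫ t in (0 : ℝ)..1, z t * ((w t - c : ℝ) : ℂ) = 0 := by
        simp only [Complex.ofReal_sub, mul_sub]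
        rw [intervalIntegral.integral_sub (hzw _ hwI) (hzw (fun _ => c) (by simp)), h1,
          intervalIntegral.integral_mul_const, h2]
        simp
      simp only [hz, mul_assoc] at h3
      simp only [← mul_assoc] at h3
      simp only [mul_assoc (_ * _ * _ * _ : ℂ)] at h3
      rw [intervalIntegral.integral_const_mul] at h3
      refine (mul_eq_zero.1 h3).resolve_left ?_
      simp [hk, Real.pi_ne_zero]
  have h0 : hf.toLp _ = 0 := by
    apply fourierBasis.repr.injective
    ext k
    rw [fourierBasis_repr, map_zero]
    rw [show fourierCoeff (hf.toLp _) k = fourierCoeff (fun x => ((w x - c : ℝ) : ℂ)) k from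
      integral_congr_ae (hf.coeFn_toLp.mono fun x hx => by simp only [hx]), hcoef k]
    rfl
  have h1 := (MemLp.toLp_eq_toLp_iff hf (MemLp.zero (ε := ℂ))).1 (by rw [h0]; rfl)
  rw [hvol]
  filter_upwards [h1] with x hx
  have : w x - c = 0 := Complex.ofReal_eq_zero.1 hx
  linarith

variable {n : ℕ}

lemma HasWeakDeriv.congr {u u' g g' : UnitAddCircle → E n} (h : HasWeakDeriv u g)
    (hu : u =ᵐ[volume] u') (hg : g =ᵐ[volume] g') : HasWeakDeriv u' g' := fun φ hφ => by
  rw [← integral_smul_congr _ hu, ← integral_smul_congr _ hg, h φ hφ]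

/-- A function with a continuous weak derivative has a representative that is a primitive of it. -/
lemma exists_primitive_rep {u : UnitAddCircle → E n} (hu : MemLp u 2)
    {g : C(UnitAddCircle, E n)} (h : HasWeakDeriv u g) :
    ∃ U : C(UnitAddCircle, E n), U =ᵐ[volume] u ∧
      ∀ a b : ℝ, U b - U a = ∫ t in a..b, g t := by
  have hgc : Continuous fun t : ℝ => g (t : UnitAddCircle) :=
    g.continuous.comp (AddCircle.continuous_mk' 1)
  have hii : ∀ a b : ℝ, IntervalIntegrable (fun t : ℝ => g (t : UnitAddCircle)) volume a b :=
    fun a b => hgc.intervalIntegrable a b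
  -- Testing with the constant `1` shows that `g` has mean zero, which makes its primitive periodic.
  have h0 : ∫ t in (0 : ℝ)..1, g (t : UnitAddCircle) = 0 := by
    have := h (fun _ => 1) contDiff_const
    simpa using this
  have hgp : Function.Periodic (fun t : ℝ => g (t : UnitAddCircle)) 1 := fun t => by simp
  set P : ℝ → E n := fun t => ∫ r in (0 : ℝ)..t, g (r : UnitAddCircle) with hP
  have hPd : ∀ t : ℝ, HasDerivAt P (g t) t := fun t =>
    hgc.integral_hasStrictDerivAt 0 t |>.hasDerivAt
  have hPc : Continuous P := continuous_iff_continuousAt.2 fun t => (hPd t).continuousAt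
  have hPp : Function.Periodic P 1 := fun t => by
    rw [← sub_eq_zero, hP, intervalIntegral.integral_interval_sub_left (hii _ _) (hii _ _),
      hgp.intervalIntegral_add_eq t 0, zero_add, h0]
  set Q := liftPeriodic P hPc hPp with hQ
  have hQm : MemLp Q 2 (volume : Measure UnitAddCircle) := by
    have := (Lp.memLp (ContinuousMap.toLp 2 (volume : Measure UnitAddCircle) ℝ Q))
    exact this.ae_eq (ContinuousMap.coeFn_toLp _ _)
  -- Integration by parts shows that `u - Q` has weak derivative zero, so each component is
  -- constant.
  have hw : ∀ i, ∃ c : ℝ, (fun x => (u x - Q x) i) =ᵐ[volume] fun _ => c := by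
    intro i
    have hm : MemLp (fun x => (u x - Q x) i) 2 (volume : Measure UnitAddCircle) :=
      (EuclideanSpace.proj (𝕜 := ℝ) i).comp_memLp' (hu.sub hQm)
    refine ae_const_of_integral_deriv_mul_eq_zero hm fun φ hφ => ?_
    have hφ' : Continuous (deriv (fun r : ℝ => φ r)) := hφ.continuous_deriv (by simp)
    have hφd : ∀ t : ℝ, HasDerivAt (fun r : ℝ => φ r) (deriv (fun r : ℝ => φ r) t) t := fun t =>
      ((hφ.differentiable (by simp)) t).hasDerivAt
    have hI1 : IntervalIntegrable (fun t : ℝ => deriv (fun r : ℝ => φ r) t • u t) volume 0 1 := by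
      have := intervalIntegrable_coe (hu.integrable (by norm_num)) 0 1
      exact this.continuousOn_smul hφ'.continuousOn
    have hI3 : IntervalIntegrable (fun t : ℝ => φ t • g (t : UnitAddCircle)) volume 0 1 :=
      (hφ.continuous.smul hgc).intervalIntegrable _ _
    have hI2 : IntervalIntegrable (fun t : ℝ => deriv (fun r : ℝ => φ r) t • P t) volume 0 1 :=
      (hφ'.smul hPc).intervalIntegrable _ _
    have e1 : ∫ t in (0 : ℝ)..1, deriv (fun r : ℝ => φ r) t • (u t - P t) = 0 := by
      simp only [smul_sub]
      rw [intervalIntegral.integral_sub hI1 hI2, h φ hφ]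
      have hparts := intervalIntegral.integral_eq_sub_of_hasDerivAt
        (f := fun t : ℝ => φ t • P t) (a := 0) (b := 1)
        (fun t _ => (hφd t).smul (hPd t))
        (hI3.add hI2)
      rw [intervalIntegral.integral_add hI3 hI2] at hparts
      have : P 1 = 0 := h0
      have h00 : P 0 = 0 := by simp [hP]
      rw [this, h00, smul_zero, smul_zero, sub_zero] at hparts
      rw [sub_eq_add_neg, ← neg_add, hparts, neg_zero]
    have e2 := (EuclideanSpace.proj (𝕜 := ℝ) i).intervalIntegral_comp_comm
      (f := fun t : ℝ => deriv (fun r : ℝ => φ r) t • (u t - P t)) (μ := volume) (a := 0) (b := 1)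
      (by simp only [smul_sub]; exact hI1.sub hI2)
    rw [e1, map_zero] at e2
    refine Eq.trans ?_ e2
    congr 1
  choose c hc using hw
  refine ⟨Q + ContinuousMap.const _ (WithLp.toLp 2 c), ?_, fun a b => ?_⟩
  · filter_upwards [ae_all_iff.2 hc] with x hx
    ext i
    have := hx i
    simp only [PiLp.sub_apply] at this
    simp [← this]
  · have : Q (b : UnitAddCircle) - Q a = ∫ t in a..b, g t := by
      rw [hQ, liftPeriodic_coe, liftPeriodic_coe, hP,
        intervalIntegral.integral_interval_sub_left (hii _ _) (hii _ _)]
    simpa using this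

end WeakDerivative

section SobolevEmbedding

/-! ### The embedding of `H^s` into `C¹` -/

lemma lintegral_enorm_sq_Lp {X V : Type*} [MeasurableSpace X] {μ : Measure X}
    [NormedAddCommGroup V] (F : Lp V 2 μ) :
    ∫⁻ x, ‖F x‖ₑ ^ 2 ∂μ = ENNReal.ofReal (‖F‖ ^ 2) := by
  rw [ENNReal.ofReal_pow (norm_nonneg _), ofReal_norm, Lp.enorm_def]
  simpa using (eLpNorm_nnreal_pow_eq_lintegral (f := F) (μ := μ) (p := 2) two_ne_zero).symm

lemma integral_norm_le_norm_Lp {X V : Type*} [MeasurableSpace X] {μ : Measure X}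
    [IsProbabilityMeasure μ] [NormedAddCommGroup V] (F : Lp V 2 μ) :
    ∫ x, ‖F x‖ ∂μ ≤ ‖F‖ := by
  have h := lintegral_sq_le_mul μ (Lp.aestronglyMeasurable F).enorm
  rw [lintegral_enorm_sq_Lp, measure_univ, one_mul] at h
  rw [integral_norm_eq_lintegral_enorm (Lp.aestronglyMeasurable F)]
  refine ENNReal.toReal_le_of_le_ofReal (norm_nonneg _) ?_
  rw [ENNReal.ofReal_pow (norm_nonneg _)] at h
  exact (ENNReal.pow_le_pow_left_iff two_ne_zero).1 h

instance : IsProbabilityMeasure (volume : Measure UnitAddCircle) := ⟨UnitAddCircle.measure_univ⟩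

variable {s : ℝ} {n : ℕ}

lemma Hs.norm_sq (w : Hs s n) :
    ‖w‖ ^ 2 = ‖w.1.fst‖ ^ 2 + (‖w.1.snd.fst‖ ^ 2 + ‖w.1.snd.snd‖ ^ 2) := by
  change ‖w.1‖ ^ 2 = _
  rw [WithLp.prod_norm_sq_eq_of_L2, WithLp.prod_norm_sq_eq_of_L2]

lemma Hs.norm_fst_le (w : Hs s n) : ‖w.1.fst‖ ≤ ‖w‖ :=
  le_of_sq_le_sq (by rw [w.norm_sq]; nlinarith [sq_nonneg ‖w.1.snd.fst‖, sq_nonneg ‖w.1.snd.snd‖])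
    (norm_nonneg _)

lemma Hs.norm_wderiv_le (w : Hs s n) : ‖w.1.snd.fst‖ ≤ ‖w‖ :=
  le_of_sq_le_sq (by rw [w.norm_sq]; nlinarith [sq_nonneg ‖w.1.fst‖, sq_nonneg ‖w.1.snd.snd‖])
    (norm_nonneg _)

lemma Hs.norm_fracDiff_le (w : Hs s n) : ‖w.1.snd.snd‖ ≤ ‖w‖ :=
  le_of_sq_le_sq (by rw [w.norm_sq]; nlinarith [sq_nonneg ‖w.1.snd.fst‖, sq_nonneg ‖w.1.fst‖])
    (norm_nonneg _)

lemma Hs.measurable_wderiv (w : Hs s n) : Measurable w.wderiv :=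
  (Lp.stronglyMeasurable w.1.snd.fst).measurable

lemma Hs.lintegral_fracDiff (w : Hs s n) :
    ∫⁻ p, ‖fracDiff (s - 1) w.wderiv p‖ₑ ^ 2 ∂mu = ENNReal.ofReal (‖w.1.snd.snd‖ ^ 2) := by
  rw [← lintegral_enorm_sq_Lp]
  refine lintegral_congr_ae ?_
  filter_upwards [w.2.2] with p hp
  rw [hp]; rfl

lemma ContinuousMap.eq_of_ae_eq {V : Type*} [TopologicalSpace V] [T2Space V]
    {f g : C(UnitAddCircle, V)} (h : f =ᵐ[volume] g) : f = g :=
  DFunLike.coe_injective ((f.continuous.ae_eq_iff_eq volume g.continuous).1 h)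

section Representatives

variable [hs : Fact (3 / 2 < s)]

/-- The condition `s > 3/2` enters here: `u'` has fractional smoothness `s - 1 > 1/2`. Increasing
`k` shrinks the coefficient of the full norm at the expense of that of the `L²` norm. -/
lemma Hs.exists_wderiv_rep : ∃ C ρ : ℝ, 0 ≤ C ∧ 0 ≤ ρ ∧ ρ < 1 ∧
    ∀ w : Hs s n, ∃ g : C(UnitAddCircle, E n), g =ᵐ[volume] w.wderiv ∧
      ∀ k : ℕ, ‖g‖ ≤ C * ρ ^ k * ‖w‖ + 2 ^ k * ‖w.1.snd.fst‖ := by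
  have hs' := hs.out
  obtain ⟨C, ρ, hC, hρ, hρ1, H⟩ := exists_continuous_rep (n := n) (σ := s - 1) (by linarith)
  refine ⟨C, ρ, hC, hρ, hρ1, fun w => ?_⟩
  obtain ⟨g, hg, hg'⟩ := H w.measurable_wderiv ((Lp.memLp w.1.snd.fst).integrable (by norm_num))
    (norm_nonneg w.1.snd.snd) w.lintegral_fracDiff.le
  refine ⟨g, hg, fun k => (hg' k).trans ?_⟩
  have h1 := w.norm_fracDiff_le
  have h2 : ∫ x, ‖w.wderiv x‖ ≤ ‖w.1.snd.fst‖ := integral_norm_le_norm_Lp w.1.snd.fst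
  gcongr

/-- The continuous representative of the weak derivative of an element of `H^s`. -/
def Hs.wderivFun (w : Hs s n) : C(UnitAddCircle, E n) :=
  ((Hs.exists_wderiv_rep (s := s) (n := n)).choose_spec.choose_spec.2.2.2 w).choose

lemma Hs.wderivFun_ae (w : Hs s n) : w.wderivFun =ᵐ[volume] w.wderiv :=
  ((Hs.exists_wderiv_rep (s := s) (n := n)).choose_spec.choose_spec.2.2.2 w).choose_spec.1

lemma Hs.exists_norm_wderivFun_le : ∃ C ρ : ℝ, 0 ≤ C ∧ 0 ≤ ρ ∧ ρ < 1 ∧ ∀ (w : Hs s n) (k : ℕ),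
    ‖w.wderivFun‖ ≤ C * ρ ^ k * ‖w‖ + 2 ^ k * ‖w.1.snd.fst‖ := by
  obtain ⟨C, ρ, hC, hρ, hρ1, H⟩ := Hs.exists_wderiv_rep (s := s) (n := n)
  refine ⟨C, ρ, hC, hρ, hρ1, fun w k => ?_⟩
  obtain ⟨g, hg, hg'⟩ := H w
  rw [ContinuousMap.eq_of_ae_eq (w.wderivFun_ae.trans hg.symm)]
  exact hg' k

/-- The derivative as a continuous linear map from `H^s` to `C(𝕋)`. -/
def derivCLM : Hs s n →L[ℝ] C(UnitAddCircle, E n) :=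
  LinearMap.mkContinuousOfExistsBound
    { toFun := Hs.wderivFun
      map_add' := fun v w => ContinuousMap.eq_of_ae_eq <| by
        refine (v + w).wderivFun_ae.trans ?_
        filter_upwards [Lp.coeFn_add v.1.snd.fst w.1.snd.fst, v.wderivFun_ae, w.wderivFun_ae]
          with x h1 h2 h3
        rw [ContinuousMap.add_apply, h2, h3]
        exact h1
      map_smul' := fun c w => ContinuousMap.eq_of_ae_eq <| by
        refine (c • w).wderivFun_ae.trans ?_
        filter_upwards [Lp.coeFn_smul c w.1.snd.fst, w.wderivFun_ae] with x h1 h2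
        rw [RingHom.id_apply, ContinuousMap.smul_apply, h2]
        exact h1 }
    (by
      obtain ⟨C, ρ, -, -, -, H⟩ := Hs.exists_norm_wderivFun_le (s := s) (n := n)
      refine ⟨C + 1, fun w => (H w 0).trans ?_⟩
      have := w.norm_wderiv_le
      simp only [pow_zero]
      linarith)

lemma derivCLM_ae (w : Hs s n) : derivCLM w =ᵐ[volume] w.wderiv := w.wderivFun_ae

/-- The supremum norm of the derivative is small compared to the `H^s` norm, up to the `L²` norm. -/
lemma norm_derivCLM_le {ε : ℝ} (hε : 0 < ε) : ∃ C : ℝ, 0 ≤ C ∧ ∀ w : Hs s n,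
    ‖derivCLM w‖ ≤ ε * ‖w‖ + C * ‖w.1.snd.fst‖ := by
  obtain ⟨C, ρ, hC, hρ, hρ1, H⟩ := Hs.exists_norm_wderivFun_le (s := s) (n := n)
  have h0 : Filter.Tendsto (fun k : ℕ => C * ρ ^ k) Filter.atTop (nhds 0) := by
    simpa using (tendsto_pow_atTop_nhds_zero_of_lt_one hρ hρ1).const_mul C
  obtain ⟨k, hk⟩ := (h0.eventually (gt_mem_nhds hε)).exists
  refine ⟨2 ^ k, by positivity, fun w => (H w k).trans ?_⟩
  gcongr

lemma Hs.exists_fun_rep (w : Hs s n) : ∃ U : C(UnitAddCircle, E n), U =ᵐ[volume] w.fn ∧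
    ∀ a b : ℝ, U b - U a = ∫ t in a..b, derivCLM w t :=
  exists_primitive_rep (Lp.memLp w.1.fst)
    (w.2.1.congr (Filter.EventuallyEq.rfl) (derivCLM_ae w).symm)

/-- The continuous representative of an element of `H^s`. -/
def Hs.fun (w : Hs s n) : C(UnitAddCircle, E n) := w.exists_fun_rep.choose

lemma Hs.fun_ae (w : Hs s n) : w.fun =ᵐ[volume] w.fn := w.exists_fun_rep.choose_spec.1

lemma Hs.fun_sub_fun (w : Hs s n) (a b : ℝ) :
    w.fun b - w.fun a = ∫ t in a..b, derivCLM w t := w.exists_fun_rep.choose_spec.2 a b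

/-- A function is its mean plus its deviation from the mean. The circle has length one, so the
deviation is at most the sup norm of the derivative; the mean is at most the `L²` norm. -/
lemma Hs.norm_fun_le (w : Hs s n) : ‖w.fun‖ ≤ ‖derivCLM w‖ + ‖w‖ := by
  refine (ContinuousMap.norm_le _ (by positivity)).2 fun x => ?_
  have h1 : ∀ y, ‖w.fun x - w.fun y‖ ≤ ‖derivCLM w‖ := by
    intro y
    induction x using QuotientAddGroup.induction_on with
    | H a =>
    obtain ⟨b, hb, rfl⟩ : ∃ b ∈ Icc a (a + 1), (b : UnitAddCircle) = y := by
      have := AddCircle.coe_image_Icc_eq (1 : ℝ) a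
      have hy : y ∈ ((↑) '' Icc a (a + 1) : Set (AddCircle (1 : ℝ))) := by rw [this]; trivial
      exact hy
    rw [w.fun_sub_fun]
    refine (intervalIntegral.norm_integral_le_of_norm_le_const
      (fun t _ => (derivCLM w).norm_coe_le_norm t)).trans ?_
    have : |a - b| ≤ 1 := by rw [abs_le]; constructor <;> linarith [hb.1, hb.2]
    exact mul_le_of_le_one_right (norm_nonneg _) this
  have hc : ∀ f : C(UnitAddCircle, E n), Integrable f := fun f =>
    f.continuous.integrable_of_hasCompactSupport (HasCompactSupport.of_compactSpace _)
  have h2 : w.fun x = (∫ y, (w.fun x - w.fun y)) + ∫ y, w.fun y := by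
    rw [integral_sub (integrable_const _) (hc _)]; simp
  rw [h2]
  refine (norm_add_le _ _).trans (add_le_add ?_ ?_)
  · refine (norm_integral_le_of_norm_le_const (Filter.Eventually.of_forall h1)).trans ?_
    simp
  · rw [integral_congr_ae w.fun_ae]
    exact (norm_integral_le_integral_norm _).trans
      ((integral_norm_le_norm_Lp w.1.fst).trans w.norm_fst_le)

/-- The inclusion of `H^s` into `C(𝕋)`. -/
def funCLM : Hs s n →L[ℝ] C(UnitAddCircle, E n) :=
  LinearMap.mkContinuous
    { toFun := Hs.fun
      map_add' := fun v w => ContinuousMap.eq_of_ae_eq <| by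
        refine (v + w).fun_ae.trans ?_
        filter_upwards [Lp.coeFn_add v.1.fst w.1.fst, v.fun_ae, w.fun_ae] with x h1 h2 h3
        rw [ContinuousMap.add_apply, h2, h3]
        exact h1
      map_smul' := fun c w => ContinuousMap.eq_of_ae_eq <| by
        refine (c • w).fun_ae.trans ?_
        filter_upwards [Lp.coeFn_smul c w.1.fst, w.fun_ae] with x h1 h2
        rw [RingHom.id_apply, ContinuousMap.smul_apply, h2]
        exact h1 }
    (‖derivCLM (s := s) (n := n)‖ + 1)
    (fun w => w.norm_fun_le.trans (by
      have := (derivCLM (s := s) (n := n)).le_opNorm w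
      linarith))

lemma funCLM_ae (w : Hs s n) : funCLM w =ᵐ[volume] w.fn := w.fun_ae

lemma funCLM_sub (w : Hs s n) (a b : ℝ) :
    funCLM w (b : UnitAddCircle) - funCLM w (a : UnitAddCircle) = ∫ t in a..b, derivCLM w t :=
  w.fun_sub_fun a b

lemma hasDerivAt_funCLM (w : Hs s n) (t : ℝ) :
    HasDerivAt (fun r : ℝ => funCLM w r) (derivCLM w t) t := by
  have hc : Continuous fun r : ℝ => derivCLM w (r : UnitAddCircle) :=
    (derivCLM w).continuous.comp (AddCircle.continuous_mk' 1)
  have h := (hc.integral_hasStrictDerivAt 0 t).hasDerivAt.add_const (funCLM w ((0 : ℝ) : UnitAddCircle))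
  refine h.congr_of_eventuallyEq (Filter.Eventually.of_forall fun r => ?_)
  simp [← funCLM_sub]

end Representatives

/-! ### The parametrisation of pairs of points by position and displacement -/

/-- The interval of displacements. -/
abbrev Disp : Type := Icc (-(1 / 2) : ℝ) (1 / 2)

/-- Pairs `(x, t)` of a point of the circle and a displacement. -/
abbrev Strip : Type := UnitAddCircle × Disp

instance : MeasureSpace Disp := Measure.Subtype.measureSpace

instance : Nonempty Disp := ⟨⟨0, by norm_num, by norm_num⟩⟩

lemma measurePreserving_disp_val : MeasurePreserving (Subtype.val : Disp → ℝ) volume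
    (volume.restrict (Icc (-(1 / 2)) (1 / 2))) :=
  ⟨measurable_subtype_coe, map_comap_subtype_coe measurableSet_Icc volume⟩

/-- The displacements `±1/2` give the same point. The closed interval is used for compactness, and
the duplicate point is a null set. -/
lemma measurePreserving_disp_coe :
    MeasurePreserving (fun t : Disp => ((t : ℝ) : UnitAddCircle)) volume volume := by
  have h2 := UnitAddCircle.measurePreserving_mk (-(1 / 2))
  rw [show (-(1 / 2) + 1 : ℝ) = 1 / 2 by norm_num, restrict_Ioc_eq_restrict_Icc] at h2
  exact h2.comp measurePreserving_disp_val

instance : IsProbabilityMeasure (volume : Measure Disp) :=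
  ⟨by rw [← preimage_univ (f := fun t : Disp => ((t : ℝ) : UnitAddCircle)),
    measurePreserving_disp_coe.measure_preimage MeasurableSet.univ.nullMeasurableSet]; simp⟩

/-- The end point `x + t` of the displacement `t` at `x`. -/
def endPoint : C(Strip, UnitAddCircle) :=
  ⟨fun p => p.1 + ((p.2 : ℝ) : UnitAddCircle), by
    have : Continuous fun t : ℝ => (t : UnitAddCircle) := AddCircle.continuous_mk' 1
    fun_prop⟩

lemma endPoint_apply (p : Strip) : endPoint p = p.1 + ((p.2 : ℝ) : UnitAddCircle) := rfl

/-- The shear `(x, t) ↦ (x, x + t)` preserves the product of translation-invariant measures. This is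
the change of variables for all double integrals. -/
lemma measurePreserving_pair :
    MeasurePreserving (fun p : Strip => (p.1, endPoint p)) volume
      ((volume : Measure UnitAddCircle).prod volume) :=
  (measurePreserving_prod_add volume volume).comp
    ((MeasurePreserving.id volume).prod measurePreserving_disp_coe)

lemma measurePreserving_endPoint : MeasurePreserving endPoint (volume : Measure Strip) volume :=
  measurePreserving_snd.comp measurePreserving_pair

lemma dist_endPoint (p : Strip) : dist (endPoint p) p.1 = |(p.2 : ℝ)| := by
  rw [endPoint_apply, dist_eq_norm, add_sub_cancel_left, (AddCircle.norm_coe_eq_abs_iff 1 one_ne_zero).2]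
  rw [abs_one, abs_le]
  exact ⟨by linarith [p.2.2.1], by linarith [p.2.2.2]⟩

/-- The reversal `(x, t) ↦ (x + t, -t)`. -/
def reversal (p : Strip) : Strip :=
  (endPoint p, ⟨-p.2, by constructor <;> linarith [p.2.2.1, p.2.2.2]⟩)

/-- The averages `(x, t) ↦ ∫₀¹ f(x + θt) dθ`. -/
def avgCLM : C(UnitAddCircle, E n) →L[ℝ] C(Strip, E n) :=
  have hc : ∀ f : C(UnitAddCircle, E n), Continuous (Function.uncurry fun (p : Strip) (θ : ℝ) =>
      f (p.1 + ((θ * p.2 : ℝ) : UnitAddCircle))) := fun f => by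
    have : Continuous fun t : ℝ => (t : UnitAddCircle) := AddCircle.continuous_mk' 1
    simp only [Function.uncurry_def]
    fun_prop
  have hi : ∀ (f : C(UnitAddCircle, E n)) (p : Strip), IntervalIntegrable (fun θ : ℝ =>
      f (p.1 + ((θ * p.2 : ℝ) : UnitAddCircle))) volume 0 1 := fun f p =>
    ((hc f).comp (Continuous.prodMk_right p)).intervalIntegrable 0 1
  LinearMap.mkContinuous
    { toFun := fun f => ⟨fun p => ∫ θ in (0 : ℝ)..1, f (p.1 + ((θ * p.2 : ℝ) : UnitAddCircle)),
        intervalIntegral.continuous_parametric_intervalIntegral_of_continuous' (hc f) 0 1⟩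
      map_add' := fun f g => by
        ext1 p
        exact intervalIntegral.integral_add (hi f p) (hi g p)
      map_smul' := fun c f => by
        ext1 p
        exact intervalIntegral.integral_smul c _ }
    1
    (fun f => by
      refine (ContinuousMap.norm_le _ (by positivity)).2 fun p => ?_
      refine (intervalIntegral.norm_integral_le_of_norm_le_const
        (fun t _ => f.norm_coe_le_norm _)).trans ?_
      simp)

lemma avgCLM_apply (f : C(UnitAddCircle, E n)) (p : Strip) :
    avgCLM f p = ∫ θ in (0 : ℝ)..1, f (p.1 + ((θ * p.2 : ℝ) : UnitAddCircle)) := rfl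

/-- Precomposition with the initial point. -/
def startCLM : C(UnitAddCircle, E n) →L[ℝ] C(Strip, E n) :=
  ContinuousMap.compCLM ℝ (E n) ⟨Prod.fst, continuous_fst⟩

/-- Precomposition with the end point. -/
def endCLM : C(UnitAddCircle, E n) →L[ℝ] C(Strip, E n) := ContinuousMap.compCLM ℝ (E n) endPoint

lemma avgCLM_of_zero (f : C(UnitAddCircle, E n)) {p : Strip} (hp : (p.2 : ℝ) = 0) :
    avgCLM f p = f p.1 := by
  simp [avgCLM_apply, hp]

/-- The fundamental theorem of calculus with `r = a + θ t`. It removes the singularity of the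
difference quotient: the mean of `w'` is continuous up to `t = 0`. -/
lemma smul_avgCLM_derivCLM [Fact (3 / 2 < s)] (w : Hs s n) (p : Strip) :
    (p.2 : ℝ) • avgCLM (derivCLM w) p = funCLM w (endPoint p) - funCLM w p.1 := by
  obtain ⟨x, t⟩ := p
  induction x using QuotientAddGroup.induction_on with
  | H a =>
  have h := funCLM_sub w a (a + t)
  have e : endPoint ((a : UnitAddCircle), t) = ((a + t : ℝ) : UnitAddCircle) := by
    rw [endPoint_apply]; exact (AddCircle.coe_add 1 a t).symm
  rw [e]
  refine Eq.trans ?_ h.symm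
  rw [avgCLM_apply]
  have h2 := intervalIntegral.smul_integral_comp_mul_add
    (fun r : ℝ => derivCLM w (r : UnitAddCircle)) (a := 0) (b := 1) (t : ℝ) a
  rw [mul_zero, mul_one, zero_add, add_comm] at h2
  rw [← h2]
  congr 1
  refine intervalIntegral.integral_congr fun θ _ => ?_
  rw [add_comm, mul_comm (t : ℝ)]
  rfl

end SobolevEmbedding

section TaylorRemainder

/-! ### The first-order Taylor remainder -/

lemma enorm_inv_rpow_smul_sq {V : Type*} [NormedAddCommGroup V] [NormedSpace ℝ V] {a : ℝ}
    (ha : 0 ≤ a) (σ : ℝ) (v : V) :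
    ‖(a ^ σ)⁻¹ • v‖ₑ ^ 2 = ENNReal.ofReal ((a ^ (2 * σ))⁻¹) * ‖v‖ₑ ^ 2 := by
  rw [enorm_smul, mul_pow]
  congr 1
  rw [← ofReal_norm, ← ENNReal.ofReal_pow (norm_nonneg _), norm_inv, inv_pow, Real.norm_eq_abs,
    sq_abs, ← Real.rpow_mul_natCast ha, mul_comm σ]
  norm_num

lemma memLp_two_of_lintegral_le {X V : Type*} [MeasurableSpace X] {μ : Measure X}
    [NormedAddCommGroup V] {F : X → V} (hF : AEStronglyMeasurable F μ) {c : ENNReal} (hc : c ≠ ⊤)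
    (h : ∫⁻ x, ‖F x‖ₑ ^ 2 ∂μ ≤ c) : MemLp F 2 μ := by
  refine ⟨hF, (eLpNorm_lt_top_iff_lintegral_rpow_enorm_lt_top two_ne_zero ENNReal.ofNat_ne_top).2 ?_⟩
  simpa using h.trans_lt hc.lt_top

lemma lintegral_enorm_sq_of_ae {X V : Type*} [MeasurableSpace X] {μ : Measure X}
    [NormedAddCommGroup V] {F : Lp V 2 μ} {f : X → V} (h : F =ᵐ[μ] f) :
    ∫⁻ x, ‖f x‖ₑ ^ 2 ∂μ = ENNReal.ofReal (‖F‖ ^ 2) := by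
  rw [← lintegral_enorm_sq_Lp]
  exact lintegral_congr_ae (h.mono fun x hx => by simp only [hx])

variable {s : ℝ} {n : ℕ}

lemma measurable_disp_rpow (σ : ℝ) : Measurable fun p : Strip => |(p.2 : ℝ)| ^ σ :=
  ((measurable_subtype_coe.comp measurable_snd).abs).pow_const σ

lemma slobodeckijDensity_pair (f : UnitAddCircle → E n) (hs : s ≠ 1 / 2) (p : Strip) :
    slobodeckijDensity (s - 1) f (p.1, endPoint p) =
      ENNReal.ofReal ((|(p.2 : ℝ)| ^ (2 * s - 1))⁻¹) * ‖f (endPoint p) - f p.1‖ₑ ^ 2 := by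
  simp only [slobodeckijDensity, fracDiff, dist_endPoint]
  rw [enorm_inv_rpow_smul_sq (abs_nonneg _), ← mul_assoc, ← ENNReal.ofReal_mul (by positivity)]
  congr 2
  rcases eq_or_ne (p.2 : ℝ) 0 with h | h
  -- On the diagonal the left factor is `0` by the convention `1 / 0 = 0`. The right one agrees only
  -- if the exponent is nonzero, since `0 ^ 0 = 1`.
  · rw [h, abs_zero, div_zero, zero_mul, Real.zero_rpow, inv_zero]
    intro h'; apply hs; linarith
  · have hp : 0 < |(p.2 : ℝ)| := abs_pos.2 h
    rw [show 2 * s - 1 = 1 + 2 * (s - 1) by ring, Real.rpow_add hp, Real.rpow_one, mul_inv, one_div]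

/-- The remainder `(∫₀¹ f(x + θt) dθ - f(x)) / |t|^(s - 1/2)`. -/
def remainder (s : ℝ) (f : C(UnitAddCircle, E n)) (p : Strip) : E n :=
  (|(p.2 : ℝ)| ^ (s - 1 / 2))⁻¹ • (avgCLM f p - f p.1)

lemma measurable_remainder (f : C(UnitAddCircle, E n)) : Measurable (remainder s f) :=
  (measurable_disp_rpow _).inv.smul
    (((avgCLM f).continuous.sub (f.continuous.comp continuous_fst)).measurable)

lemma lintegral_disp (F : ℝ → ENNReal) :
    ∫⁻ t : Disp, F t = ∫⁻ t in Icc (-(1 / 2)) (1 / 2), F t := by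
  exact lintegral_subtype_comap measurableSet_Icc F

/-- Substitute `τ = θ t`. The weight contributes `θ^(2s-1)` and the measure `θ⁻¹`, in total
`θ^(2s-2) ≤ 1`, while the range of `τ` only shrinks. -/
lemma lintegral_scaled_increment_le (hs : 1 < s) (f : C(UnitAddCircle, E n)) {θ : ℝ}
    (hθ : θ ∈ Ioc (0 : ℝ) 1) :
    ∫⁻ p : Strip, ENNReal.ofReal ((|(p.2 : ℝ)| ^ (2 * s - 1))⁻¹) *
        ‖f (p.1 + ((θ * p.2 : ℝ) : UnitAddCircle)) - f p.1‖ₑ ^ 2 ≤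
      ∫⁻ p : Strip, ENNReal.ofReal ((|(p.2 : ℝ)| ^ (2 * s - 1))⁻¹) *
        ‖f (endPoint p) - f p.1‖ₑ ^ 2 := by
  have hcoe : Continuous fun t : ℝ => (t : UnitAddCircle) := AddCircle.continuous_mk' 1
  set H : ℝ → ENNReal := fun τ => ∫⁻ x, ‖f (x + (τ : UnitAddCircle)) - f x‖ₑ ^ 2 with hH
  set w : ℝ → ENNReal := fun t => ENNReal.ofReal ((|t| ^ (2 * s - 1))⁻¹) with hw
  have hwm : Measurable w := ((measurable_id.abs.pow_const _).inv).ennreal_ofReal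
  have hHm : Measurable H := by
    have : Continuous fun q : ℝ × UnitAddCircle => f (q.2 + (q.1 : UnitAddCircle)) - f q.2 := by
      fun_prop
    exact Measurable.lintegral_prod_right' (f := fun q : ℝ × UnitAddCircle =>
      ‖f (q.2 + (q.1 : UnitAddCircle)) - f q.2‖ₑ ^ 2) (this.measurable.enorm.pow_const 2)
  have key : ∀ η : ℝ, ∫⁻ p : Strip, w p.2 *
      ‖f (p.1 + ((η * p.2 : ℝ) : UnitAddCircle)) - f p.1‖ₑ ^ 2 =
      ∫⁻ t in Icc (-(1 / 2)) (1 / 2), w t * H (η * t) := by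
    intro η
    have hc : Continuous fun p : Strip =>
        f (p.1 + ((η * p.2 : ℝ) : UnitAddCircle)) - f p.1 := by fun_prop
    have hm : Measurable fun p : Strip =>
        w p.2 * ‖f (p.1 + ((η * p.2 : ℝ) : UnitAddCircle)) - f p.1‖ₑ ^ 2 :=
      (hwm.comp (measurable_subtype_coe.comp measurable_snd)).mul
        (hc.measurable.enorm.pow_const 2)
    rw [← lintegral_disp (fun t => w t * H (η * t)), Measure.volume_eq_prod,
      lintegral_prod_symm' _ hm]
    refine lintegral_congr fun t => ?_
    exact lintegral_const_mul (w t)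
      ((hc.comp (Continuous.prodMk_left t)).measurable.enorm.pow_const 2)
  have h1 := key 1
  simp only [one_mul] at h1
  change ∫⁻ p : Strip, w p.2 * ‖f (p.1 + ((θ * p.2 : ℝ) : UnitAddCircle)) - f p.1‖ₑ ^ 2 ≤
    ∫⁻ p : Strip, w p.2 * ‖f (p.1 + ((p.2 : ℝ) : UnitAddCircle)) - f p.1‖ₑ ^ 2
  rw [key θ, h1]
  have hθ0 : 0 < θ := hθ.1
  set Φ : ℝ → ENNReal := (Icc (-(1 / 2)) (1 / 2)).indicator (fun τ => w τ * H τ) with hΦ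
  have hΦm : Measurable Φ := (hwm.mul hHm).indicator measurableSet_Icc
  calc ∫⁻ t in Icc (-(1 / 2)) (1 / 2), w t * H (θ * t)
      ≤ ∫⁻ t in Icc (-(1 / 2)) (1 / 2), ENNReal.ofReal (θ ^ (2 * s - 1)) * Φ (θ * t) := by
        refine setLIntegral_mono' measurableSet_Icc fun t ht => ?_
        have hmem : θ * t ∈ Icc (-(1 / 2) : ℝ) (1 / 2) := by
          constructor <;> nlinarith [ht.1, ht.2, hθ.2]
        rw [hΦ, indicator_of_mem hmem, ← mul_assoc]
        gcongr
        rw [hw, ← ENNReal.ofReal_mul (by positivity)]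
        refine ENNReal.ofReal_le_ofReal (le_of_eq ?_)
        rw [abs_mul, abs_of_pos hθ0, Real.mul_rpow hθ0.le (abs_nonneg _), mul_inv,
          mul_inv_cancel_left₀ (by positivity)]
    _ ≤ ∫⁻ t, ENNReal.ofReal (θ ^ (2 * s - 1)) * Φ (θ * t) := setLIntegral_le_lintegral _ _
    _ = ENNReal.ofReal (θ ^ (2 * s - 1)) * (ENNReal.ofReal θ⁻¹ * ∫⁻ t, Φ t) := by
        have hΦθ : Measurable fun t => Φ (θ * t) := hΦm.comp (measurable_const_mul θ)
        rw [lintegral_const_mul _ hΦθ,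
          ← lintegral_map hΦm (measurable_const_mul θ), Real.map_volume_mul_left hθ0.ne',
          lintegral_smul_measure, abs_of_pos (inv_pos.2 hθ0), smul_eq_mul]
    _ ≤ 1 * ∫⁻ t, Φ t := by
        rw [← mul_assoc, ← ENNReal.ofReal_mul (by positivity)]
        gcongr
        rw [← ENNReal.ofReal_one]
        refine ENNReal.ofReal_le_ofReal ?_
        rw [← Real.rpow_neg_one, ← Real.rpow_add hθ0]
        exact Real.rpow_le_one hθ0.le hθ.2 (by linarith)
    _ = ∫⁻ t in Icc (-(1 / 2)) (1 / 2), w t * H t := by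
        rw [one_mul, hΦ, lintegral_indicator measurableSet_Icc]

/-- The remainder is a mean over `θ` of weighted increments `f(x + θt) - f(x)`. Apply Jensen,
exchange the integrals, and bound each `θ` by scaling. -/
lemma lintegral_remainder_le (hs : 1 < s) (f : C(UnitAddCircle, E n)) :
    ∫⁻ p, ‖remainder s f p‖ₑ ^ 2 ≤ ∫⁻ p, ‖fracDiff (s - 1) f p‖ₑ ^ 2 ∂mu := by
  have hcoe : Continuous fun t : ℝ => (t : UnitAddCircle) := AddCircle.continuous_mk' 1
  have hc : Continuous fun q : Strip × ℝ =>
      f (q.1.1 + ((q.2 * q.1.2 : ℝ) : UnitAddCircle)) - f q.1.1 := by fun_prop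
  have hprob : IsProbabilityMeasure (volume.restrict (Ioc (0 : ℝ) 1)) := ⟨by simp⟩
  rw [lintegral_fracDiff_mu f.continuous.measurable, ← measurePreserving_pair.lintegral_comp
    (measurable_slobodeckijDensity f.continuous.measurable)]
  simp only [slobodeckijDensity_pair f (by linarith : s ≠ 1 / 2)]
  have hpt : ∀ p : Strip, ‖remainder s f p‖ₑ ^ 2 ≤ ∫⁻ θ in Ioc (0 : ℝ) 1,
      ENNReal.ofReal ((|(p.2 : ℝ)| ^ (2 * s - 1))⁻¹) *
        ‖f (p.1 + ((θ * p.2 : ℝ) : UnitAddCircle)) - f p.1‖ₑ ^ 2 := by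
    intro p
    have hcp := hc.comp (Continuous.prodMk_right p)
    have hm : Measurable fun θ : ℝ => ‖f (p.1 + ((θ * p.2 : ℝ) : UnitAddCircle)) - f p.1‖ₑ :=
      hcp.measurable.enorm
    rw [remainder, enorm_inv_rpow_smul_sq (abs_nonneg _), lintegral_const_mul _ (hm.pow_const 2),
      show 2 * (s - 1 / 2) = 2 * s - 1 by ring]
    gcongr
    have e : avgCLM f p - f p.1 = ∫ θ in Ioc (0 : ℝ) 1,
        (f (p.1 + ((θ * p.2 : ℝ) : UnitAddCircle)) - f p.1) := by
      rw [← intervalIntegral.integral_of_le zero_le_one, intervalIntegral.integral_sub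
        (Continuous.intervalIntegrable (by fun_prop) _ _) (by simp), avgCLM_apply]
      simp
    rw [e]
    calc _ ≤ (∫⁻ θ in Ioc (0 : ℝ) 1, ‖f (p.1 + ((θ * p.2 : ℝ) : UnitAddCircle)) - f p.1‖ₑ) ^ 2 := by
          gcongr; exact enorm_integral_le_lintegral_enorm _
      _ ≤ _ := by
          refine (lintegral_sq_le_mul _ hm.aemeasurable).trans ?_
          simp
  calc ∫⁻ p, ‖remainder s f p‖ₑ ^ 2 ≤ _ := lintegral_mono hpt
    _ = ∫⁻ θ in Ioc (0 : ℝ) 1, ∫⁻ p : Strip, ENNReal.ofReal ((|(p.2 : ℝ)| ^ (2 * s - 1))⁻¹) *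
        ‖f (p.1 + ((θ * p.2 : ℝ) : UnitAddCircle)) - f p.1‖ₑ ^ 2 := by
        refine lintegral_lintegral_swap (Measurable.aemeasurable ?_)
        exact (((measurable_disp_rpow _).inv.ennreal_ofReal).comp measurable_fst).mul
          (hc.measurable.enorm.pow_const 2)
    _ ≤ ∫⁻ θ in Ioc (0 : ℝ) 1, _ :=
        setLIntegral_mono' measurableSet_Ioc fun θ hθ => lintegral_scaled_increment_le hs f hθ
    _ = _ := by simp

/-- After swapping factors, the reversal is a skew product of the reflection `t ↦ -t` with
translations of the circle. -/
lemma measurePreserving_reversal : MeasurePreserving reversal volume volume := by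
  have hneg : MeasurePreserving (fun t : Disp =>
      (⟨-t, by constructor <;> linarith [t.2.1, t.2.2]⟩ : Disp)) volume volume := by
    have hm : Measurable (fun t : Disp =>
        (⟨-t, by constructor <;> linarith [t.2.1, t.2.2]⟩ : Disp)) :=
      measurable_subtype_coe.neg.subtype_mk
    refine ⟨hm, Measure.ext fun A hA => ?_⟩
    rw [Measure.map_apply hm hA]
    change Measure.comap Subtype.val volume _ = Measure.comap Subtype.val volume _
    rw [comap_subtype_coe_apply measurableSet_Icc, comap_subtype_coe_apply measurableSet_Icc,
      ← Measure.measure_neg volume (Subtype.val '' A)]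
    congr 1
    ext x
    simp only [mem_image, mem_preimage, Subtype.exists, mem_neg]
    constructor
    · rintro ⟨a, ha, h1, rfl⟩; exact ⟨-a, ⟨by linarith [ha.2], by linarith [ha.1]⟩, h1, rfl⟩
    · rintro ⟨a, ha, h1, h2⟩
      subst h2
      exact ⟨x, ⟨by linarith [ha.2], by linarith [ha.1]⟩, h1, rfl⟩
  have h1 : MeasurePreserving (fun q : Disp × UnitAddCircle =>
      ((⟨-q.1, by constructor <;> linarith [q.1.2.1, q.1.2.2]⟩ : Disp),
        q.2 + ((q.1 : ℝ) : UnitAddCircle))) (volume.prod volume) (volume.prod volume) := by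
    refine hneg.skew_product (g := fun t x => x + ((t : ℝ) : UnitAddCircle)) ?_
      (Filter.Eventually.of_forall fun t => ?_)
    · have hcoe : Continuous fun t : ℝ => (t : UnitAddCircle) := AddCircle.continuous_mk' 1
      exact Continuous.measurable (by simp only [Function.uncurry_def]; fun_prop)
    · exact (measurePreserving_add_right volume _).map_eq
  exact (Measure.measurePreserving_swap.comp h1).comp Measure.measurePreserving_swap

/-- Substituting `θ ↦ 1 - θ` traverses the same segment backwards. -/
lemma avgCLM_reversal (f : C(UnitAddCircle, E n)) (p : Strip) :
    avgCLM f (reversal p) = avgCLM f p := by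
  have h := intervalIntegral.integral_comp_sub_left
    (fun θ : ℝ => f (p.1 + ((θ * p.2 : ℝ) : UnitAddCircle))) (1 : ℝ) (a := 0) (b := 1)
  rw [sub_self, sub_zero] at h
  rw [avgCLM_apply, avgCLM_apply, ← h]
  refine intervalIntegral.integral_congr fun θ _ => ?_
  simp only [reversal, endPoint_apply]
  rw [add_assoc, ← AddCircle.coe_add]
  congr 3
  ring

/-- The mean over a segment is the same from both ends, so it cancels: the weighted increment `f(y)
- f(x)` is the remainder at `x` minus the remainder at `y`. The factor `4` comes from `(a + b)² ≤ 2
(a² + b²)` and the invariance of the measure under reversal. -/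
lemma lintegral_fracDiff_le_remainder (hs : 1 < s) (f : C(UnitAddCircle, E n)) :
    ∫⁻ p, ‖fracDiff (s - 1) f p‖ₑ ^ 2 ∂mu ≤ 4 * ∫⁻ p, ‖remainder s f p‖ₑ ^ 2 := by
  rw [lintegral_fracDiff_mu f.continuous.measurable, ← measurePreserving_pair.lintegral_comp
    (measurable_slobodeckijDensity f.continuous.measurable)]
  have hm : Measurable fun p => ‖remainder s f p‖ₑ ^ 2 :=
    (measurable_remainder f).enorm.pow_const 2
  have hm' : Measurable fun p => ‖remainder s f (reversal p)‖ₑ ^ 2 :=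
    hm.comp measurePreserving_reversal.measurable
  have hpt : ∀ p : Strip, slobodeckijDensity (s - 1) f (p.1, endPoint p) ≤
      2 * (‖remainder s f p‖ₑ ^ 2 + ‖remainder s f (reversal p)‖ₑ ^ 2) := by
    intro p
    have e : (|(p.2 : ℝ)| ^ (s - 1 / 2))⁻¹ • (f (endPoint p) - f p.1) =
        remainder s f p - remainder s f (reversal p) := by
      rw [remainder, remainder, avgCLM_reversal]
      simp only [reversal, abs_neg]
      rw [← smul_sub]; congr 1; abel
    rw [slobodeckijDensity_pair f (by linarith : s ≠ 1 / 2),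
      show 2 * s - 1 = 2 * (s - 1 / 2) by ring, ← enorm_inv_rpow_smul_sq (abs_nonneg _), e]
    calc _ ≤ (‖remainder s f p‖ₑ + ‖remainder s f (reversal p)‖ₑ) ^ 2 := by
          gcongr; exact enorm_sub_le
      _ ≤ _ := by
          have := ENNReal.rpow_add_le_mul_rpow_add_rpow ‖remainder s f p‖ₑ
            ‖remainder s f (reversal p)‖ₑ (p := 2) (by norm_num)
          norm_num at this
          exact this
  calc _ ≤ ∫⁻ p : Strip, 2 * (‖remainder s f p‖ₑ ^ 2 + ‖remainder s f (reversal p)‖ₑ ^ 2) :=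
        lintegral_mono hpt
    _ = 4 * ∫⁻ p, ‖remainder s f p‖ₑ ^ 2 := by
        have hadd : Measurable fun p => ‖remainder s f p‖ₑ ^ 2 + ‖remainder s f (reversal p)‖ₑ ^ 2 :=
          hm.add hm'
        rw [lintegral_const_mul _ hadd, lintegral_add_left hm, measurePreserving_reversal.lintegral_comp hm, ← two_mul, ← mul_assoc]
        norm_num

section

variable [hs : Fact (3 / 2 < s)]

lemma Hs.lintegral_fracDiff_derivCLM (w : Hs s n) :
    ∫⁻ p, ‖fracDiff (s - 1) (derivCLM w) p‖ₑ ^ 2 ∂mu = ENNReal.ofReal (‖w.1.snd.snd‖ ^ 2) := by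
  rw [← w.lintegral_fracDiff]
  refine lintegral_congr_ae ?_
  filter_upwards [ae_mu_fst (derivCLM_ae w), ae_mu_snd (derivCLM_ae w)] with p h1 h2
  rw [fracDiff, fracDiff, h1, h2]

lemma Hs.lintegral_remainder_le (w : Hs s n) :
    ∫⁻ p, ‖remainder s (derivCLM w) p‖ₑ ^ 2 ≤ ENNReal.ofReal (‖w.1.snd.snd‖ ^ 2) :=
  (SobolevCurves.lintegral_remainder_le (by linarith [hs.out]) _).trans
    w.lintegral_fracDiff_derivCLM.le

lemma Hs.memLp_remainder (w : Hs s n) : MemLp (remainder s (derivCLM w)) 2 :=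
  memLp_two_of_lintegral_le (measurable_remainder _).aestronglyMeasurable ENNReal.ofReal_ne_top
    w.lintegral_remainder_le

lemma remainder_add (v w : Hs s n) (p : Strip) : remainder s (derivCLM (v + w)) p =
    (remainder s (derivCLM v) + remainder s (derivCLM w)) p := by
  simp only [remainder, map_add, ContinuousMap.add_apply, Pi.add_apply, ← smul_add]
  congr 1; abel

lemma remainder_smul (c : ℝ) (w : Hs s n) (p : Strip) : remainder s (derivCLM (c • w)) p =
    (c • remainder s (derivCLM w)) p := by
  simp only [remainder, map_smul, ContinuousMap.smul_apply, Pi.smul_apply, ← smul_sub]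
  rw [smul_comm]

/-- The Taylor remainder as a continuous linear map from `H^s` to `L²`. -/
def remainderCLM : Hs s n →L[ℝ] Lp (E n) 2 (volume : Measure Strip) :=
  LinearMap.mkContinuous
    { toFun := fun w => w.memLp_remainder.toLp _
      map_add' := fun v w => (MemLp.toLp_congr _ (v.memLp_remainder.add w.memLp_remainder)
        (Filter.Eventually.of_forall (remainder_add _ _))).trans (MemLp.toLp_add _ _)
      map_smul' := fun c w => (MemLp.toLp_congr _ (w.memLp_remainder.const_smul c)
        (Filter.Eventually.of_forall (remainder_smul _ _))).trans (MemLp.toLp_const_smul _ _) } 1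
    (fun w => by
      have h := w.lintegral_remainder_le
      rw [one_mul]
      refine le_trans ?_ w.norm_fracDiff_le
      rw [lintegral_enorm_sq_of_ae w.memLp_remainder.coeFn_toLp, ENNReal.ofReal_le_ofReal_iff (by positivity)] at h
      exact le_of_sq_le_sq h (norm_nonneg _))

lemma remainderCLM_ae (w : Hs s n) : remainderCLM w =ᵐ[volume] remainder s (derivCLM w) :=
  w.memLp_remainder.coeFn_toLp

lemma Hs.norm_fracDiff_le_remainder (w : Hs s n) : ‖w.1.snd.snd‖ ≤ 2 * ‖remainderCLM w‖ := by
  have h := lintegral_fracDiff_le_remainder (by linarith [hs.out]) (derivCLM w)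
  rw [w.lintegral_fracDiff_derivCLM,
    lintegral_enorm_sq_of_ae (remainderCLM_ae w), show (4 : ENNReal) = ENNReal.ofReal 4 by norm_num,
    ← ENNReal.ofReal_mul (by norm_num), ENNReal.ofReal_le_ofReal_iff (by positivity)] at h
  exact le_of_sq_le_sq (by rw [mul_pow]; linarith) (by positivity)

end

end TaylorRemainder

section MetricModel

/-! ### Pointwise bilinear operations -/

section Pointwise

variable {X V W Z : Type*} [TopologicalSpace X] [CompactSpace X]
  [NormedAddCommGroup V] [NormedSpace ℝ V] [NormedAddCommGroup W] [NormedSpace ℝ W]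
  [NormedAddCommGroup Z] [NormedSpace ℝ Z]

/-- The pointwise application of a bilinear map to continuous functions. -/
def pointwise (B : V →L[ℝ] W →L[ℝ] Z) : C(X, V) →L[ℝ] C(X, W) →L[ℝ] C(X, Z) :=
  LinearMap.mkContinuous₂
    (LinearMap.mk₂ ℝ (fun f g => ⟨fun x => B (f x) (g x), by fun_prop⟩)
      (fun f f' g => by ext x; simp) (fun c f g => by ext x; simp)
      (fun f g g' => by ext x; simp) (fun c f g => by ext x; simp)) ‖B‖
    (fun f g => (ContinuousMap.norm_le _ (by positivity)).2 fun x => by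
      refine (B.le_opNorm₂ _ _).trans ?_
      gcongr
      · exact f.norm_coe_le_norm x
      · exact g.norm_coe_le_norm x)

@[simp] lemma pointwise_apply (B : V →L[ℝ] W →L[ℝ] Z) (f : C(X, V)) (g : C(X, W)) (x : X) :
    pointwise B f g x = B (f x) (g x) := rfl

end Pointwise

section PointwiseLp

variable {V W Z : Type*}
  [NormedAddCommGroup V] [NormedSpace ℝ V] [NormedAddCommGroup W] [NormedSpace ℝ W]
  [NormedAddCommGroup Z] [NormedSpace ℝ Z]

/-- The pointwise application of a bilinear map to a continuous and a square integrable function. -/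
def pointwiseLp (B : V →L[ℝ] W →L[ℝ] Z) : C(Strip, V) →L[ℝ]
    Lp W 2 (volume : Measure Strip) →L[ℝ] Lp Z 2 (volume : Measure Strip) :=
  (B.holderL volume ⊤ 2 2).comp (ContinuousMap.toLp ⊤ volume ℝ)

lemma pointwiseLp_ae (B : V →L[ℝ] W →L[ℝ] Z) (f : C(Strip, V))
    (F : Lp W 2 (volume : Measure Strip)) :
    pointwiseLp B f F =ᵐ[volume] fun p => B (f p) (F p) := by
  have h := B.coeFn_holder (r := 2) (ContinuousMap.toLp ⊤ volume ℝ f) F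
  filter_upwards [h, ContinuousMap.coeFn_toLp (p := ⊤) (𝕜 := ℝ) (volume : Measure Strip) f]
    with p h1 h2
  rw [← h2]; exact h1

end PointwiseLp

/-- Integration of continuous functions. -/
def integralCLM : C(Strip, ℝ) →L[ℝ] ℝ :=
  have hi : ∀ f : C(Strip, ℝ), Integrable f := fun f =>
    f.continuous.integrable_of_hasCompactSupport (HasCompactSupport.of_compactSpace _)
  LinearMap.mkContinuous
    { toFun := fun f => ∫ p, f p
      map_add' := fun f g => integral_add (hi f) (hi g)
      map_smul' := fun c f => integral_smul c f } 1
    (fun f => (norm_integral_le_of_norm_le_const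
      (Filter.Eventually.of_forall f.norm_coe_le_norm)).trans (by simp))

lemma integralCLM_apply (f : C(Strip, ℝ)) : integralCLM f = ∫ p, f p := rfl

variable {s : ℝ} {n : ℕ}

/-- The pointwise power `‖f‖ ^ r` of a nowhere vanishing function. -/
def normPow (r : ℝ) (f : C(Strip, E n)) : C(Strip, ℝ) :=
  rpowMap (r / 2) (pointwise (innerSL ℝ) f f)

lemma pointwise_inner_self_pos {f : C(Strip, E n)} (hf : ∀ p, f p ≠ 0) (p : Strip) :
    0 < pointwise (innerSL ℝ) f f p := by
  rw [pointwise_apply, innerSL_apply_apply]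
  exact real_inner_self_pos.2 (hf p)

lemma normPow_apply (r : ℝ) {f : C(Strip, E n)} (hf : ∀ p, f p ≠ 0) (p : Strip) :
    normPow r f p = ‖f p‖ ^ r := by
  rw [normPow, rpowMap_apply _ (pointwise_inner_self_pos hf), pointwise_apply, innerSL_apply_apply,
    real_inner_self_eq_norm_sq, ← Real.rpow_natCast, ← Real.rpow_mul (norm_nonneg _)]
  congr 1; push_cast; ring

/-- Going through `‖f‖²`, which is quadratic in `f`, avoids differentiating the norm itself. -/
lemma contDiffOn_normPow (r : ℝ) : ContDiffOn ℝ ∞ (normPow (n := n) r) {f | ∀ p, f p ≠ 0} := by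
  refine (contDiffOn_rpowMap (r / 2)).comp
    (ContDiffOn.bilin _ contDiffOn_id contDiffOn_id) fun f hf => pointwise_inner_self_pos hf

lemma isOpen_forall_ne_zero : IsOpen {f : C(Strip, E n) | ∀ p, f p ≠ 0} := by
  have h := ContinuousMap.isOpen_setOfPred_mapsTo (X := Strip) (Y := E n) isCompact_univ
    (isOpen_compl_singleton (x := (0 : E n)))
  convert h using 1
  ext f; simp [MapsTo]

section

variable [hs : Fact (3 / 2 < s)]

variable (s n) in
/-- The derivative at the initial point. -/
def derivStart : Hs s n →L[ℝ] C(Strip, E n) := startCLM.comp derivCLM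

variable (s n) in
/-- The derivative at the end point. -/
def derivEnd : Hs s n →L[ℝ] C(Strip, E n) := endCLM.comp derivCLM

variable (s n) in
/-- The difference quotient. -/
def diffQuot : Hs s n →L[ℝ] C(Strip, E n) := avgCLM.comp derivCLM

variable (s n) in
/-- The value at the initial point. -/
def valStart : Hs s n →L[ℝ] C(Strip, E n) := startCLM.comp funCLM

lemma derivStart_apply (u : Hs s n) (p : Strip) : derivStart s n u p = derivCLM u p.1 := rfl
lemma derivEnd_apply (u : Hs s n) (p : Strip) : derivEnd s n u p = derivCLM u (endPoint p) := rfl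

lemma smul_diffQuot (u : Hs s n) (p : Strip) :
    (p.2 : ℝ) • diffQuot s n u p = funCLM u (endPoint p) - funCLM u p.1 :=
  smul_avgCLM_derivCLM u p

lemma remainder_derivCLM (u : Hs s n) (p : Strip) : remainder s (derivCLM u) p =
    (|(p.2 : ℝ)| ^ (s - 1 / 2))⁻¹ • (diffQuot s n u p - derivStart s n u p) := rfl

/-! ### The set of embeddings -/

lemma exists_endPoint_eq (x y : UnitAddCircle) : ∃ t : Disp, endPoint (x, t) = y := by
  have h := AddCircle.coe_image_Icc_eq (1 : ℝ) (-(1 / 2))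
  have hy : y - x ∈ (univ : Set (AddCircle (1 : ℝ))) := trivial
  rw [← h] at hy
  obtain ⟨t, ht, ht'⟩ := hy
  refine ⟨⟨t, ht.1, by linarith [ht.2]⟩, ?_⟩
  rw [endPoint_apply]
  simp only []
  rw [ht', add_sub_cancel]

/-- For `t ≠ 0` a zero of the difference quotient is a double point of `γ`; at `t = 0` it is a zero
of `γ'`. Conversely, a continuous injection of the compact circle is an embedding. One nonvanishing
condition on a compact space thus encodes both requirements. -/
lemma mem_embeddings_iff {γ : Hs s n} :
    γ ∈ embeddings s n ↔ ∀ p, diffQuot s n γ p ≠ 0 := by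
  have hcoe : Continuous fun t : ℝ => (t : UnitAddCircle) := AddCircle.continuous_mk' 1
  constructor
  · rintro ⟨c, hc, hc1, hc2, hc3⟩ p hp
    have hcc : Continuous c := continuous_coinduced_dom.2 hc1.continuous
    have hcγ : c = funCLM γ := (hcc.ae_eq_iff_eq volume (funCLM γ).continuous).1
      (hc.trans (funCLM_ae γ).symm)
    rcases eq_or_ne (p.2 : ℝ) 0 with h0 | h0
    · obtain ⟨x, t⟩ := p
      induction x using QuotientAddGroup.induction_on with
      | H a =>
      apply hc2 a
      rw [hcγ]
      refine (hasDerivAt_funCLM γ a).deriv.trans ?_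
      rw [← hp]
      exact (avgCLM_of_zero (derivCLM γ) (p := ((a : UnitAddCircle), t)) h0).symm
    · have h1 := smul_diffQuot γ p
      rw [hp, smul_zero, ← hcγ, eq_comm, sub_eq_zero] at h1
      have h2 := hc3.injective h1
      have h3 := dist_endPoint p
      rw [h2, dist_self, eq_comm, abs_eq_zero] at h3
      exact h0 h3
  · intro h
    refine ⟨funCLM γ, funCLM_ae γ, ?_, fun t ht => ?_, ?_⟩
    · rw [contDiff_one_iff_deriv]
      refine ⟨fun t => (hasDerivAt_funCLM γ t).differentiableAt, ?_⟩
      rw [funext fun t => (hasDerivAt_funCLM γ t).deriv]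
      exact (derivCLM γ).continuous.comp hcoe
    · rw [(hasDerivAt_funCLM γ t).deriv] at ht
      exact h ((t : UnitAddCircle), ⟨0, by norm_num, by norm_num⟩) ((avgCLM_of_zero _ rfl).trans ht)
    · refine ((funCLM γ).continuous.isClosedEmbedding fun x y hxy => ?_).isEmbedding
      obtain ⟨t, rfl⟩ := exists_endPoint_eq x y
      have h1 := smul_diffQuot γ (x, t)
      rw [← hxy, sub_self, smul_eq_zero] at h1
      have h2 : (t : ℝ) = 0 := h1.resolve_right (h _)
      rw [endPoint_apply]; simp [h2]

lemma isOpen_embeddings : IsOpen (embeddings s n) := by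
  convert isOpen_forall_ne_zero.preimage (diffQuot s n).continuous using 1
  ext γ; exact mem_embeddings_iff

lemma derivCLM_ne_zero {γ : Hs s n} (hγ : γ ∈ embeddings s n) (x : UnitAddCircle) :
    derivCLM γ x ≠ 0 := by
  have h := mem_embeddings_iff.1 hγ (x, ⟨0, by norm_num, by norm_num⟩)
  rwa [diffQuot, ContinuousLinearMap.comp_apply, avgCLM_of_zero _ rfl] at h

/-! ### The metric in terms of smooth operations -/

/-- The Taylor remainder with the contribution of the base curve removed. -/
def geomRemainder (γ u : Hs s n) : Lp (E n) 2 (volume : Measure Strip) :=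
  remainderCLM u - pointwiseLp (ContinuousLinearMap.lsmul ℝ ℝ (E := E n)).flip
    (pointwise (ContinuousLinearMap.lsmul ℝ ℝ) (normPow (-2) (derivStart s n γ)) (derivStart s n u))
    (pointwiseLp (innerSL ℝ) (derivStart s n γ) (remainderCLM γ))

/-- The pointwise form of the geometric remainder. -/
def geomRemainderFun (γ u : Hs s n) (p : Strip) : E n :=
  remainder s (derivCLM u) p - (‖derivCLM γ p.1‖ ^ (-2 : ℝ) *
    inner ℝ (derivCLM γ p.1) (remainder s (derivCLM γ) p)) • derivCLM u p.1

lemma geomRemainder_ae {γ : Hs s n} (hγ : γ ∈ embeddings s n) (u : Hs s n) :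
    geomRemainder γ u =ᵐ[volume] geomRemainderFun γ u := by
  filter_upwards [Lp.coeFn_sub (remainderCLM u) (pointwiseLp
    (ContinuousLinearMap.lsmul ℝ ℝ (E := E n)).flip
    (pointwise (ContinuousLinearMap.lsmul ℝ ℝ) (normPow (-2) (derivStart s n γ)) (derivStart s n u))
    (pointwiseLp (innerSL ℝ) (derivStart s n γ) (remainderCLM γ))), remainderCLM_ae u,
    pointwiseLp_ae (ContinuousLinearMap.lsmul ℝ ℝ (E := E n)).flip
    (pointwise (ContinuousLinearMap.lsmul ℝ ℝ) (normPow (-2) (derivStart s n γ)) (derivStart s n u))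
    (pointwiseLp (innerSL ℝ) (derivStart s n γ) (remainderCLM γ)),
    pointwiseLp_ae (innerSL ℝ) (derivStart s n γ) (remainderCLM γ), remainderCLM_ae γ]
    with p h1 h2 h3 h4 h5
  rw [geomRemainder, h1, Pi.sub_apply, h2, h3, h4, h5]
  simp only [ContinuousLinearMap.flip_apply, ContinuousLinearMap.lsmul_apply, pointwise_apply,
    geomRemainderFun]
  rw [normPow_apply _ (fun p => derivCLM_ne_zero hγ p.1), smul_smul, mul_comm]
  rfl

/-- The density of the first term of the metric. -/
def weight (r : ℝ) (γ : Hs s n) : C(Strip, ℝ) :=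
  normPow 1 (derivStart s n γ) * normPow 1 (derivEnd s n γ) * normPow (-r) (diffQuot s n γ)

/-- The pointwise product `⟨D_γ u(x), D_γ v(x)⟩ + ⟨D_γ u(y), D_γ v(y)⟩`. -/
def derivProduct (γ u v : Hs s n) : C(Strip, ℝ) :=
  normPow (-2) (derivStart s n γ) * pointwise (innerSL ℝ) (derivStart s n u) (derivStart s n v) +
    normPow (-2) (derivEnd s n γ) * pointwise (innerSL ℝ) (derivEnd s n u) (derivEnd s n v)

/-- The weighted `L²` product `∫ ρ ⟨F, G⟩`. -/
def weightedInner (ρ : C(Strip, ℝ)) (F G : Lp (E n) 2 (volume : Measure Strip)) : ℝ :=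
  innerSL ℝ (pointwiseLp (ContinuousLinearMap.lsmul ℝ ℝ) ρ F) G

lemma weightedInner_eq (ρ : C(Strip, ℝ)) (F G : Lp (E n) 2 (volume : Measure Strip)) :
    weightedInner ρ F G = ∫ p, ρ p * inner ℝ (F p) (G p) := by
  rw [weightedInner, innerSL_apply_apply, L2.inner_def]
  refine integral_congr_ae ?_
  filter_upwards [pointwiseLp_ae (ContinuousLinearMap.lsmul ℝ ℝ) ρ F] with p hp
  rw [hp, ContinuousLinearMap.lsmul_apply, real_inner_smul_left]

/-- The metric expressed through continuous functions and `L²` remainders. -/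
def metricModel (γ u v : Hs s n) : ℝ :=
  2 * weightedInner (weight (2 * s + 1) γ) (geomRemainder γ u) (geomRemainder γ v) +
  (2 * s + 1) * weightedInner (weight (2 * s + 3) γ *
    pointwise (innerSL ℝ) (diffQuot s n u) (diffQuot s n v)) (geomRemainder γ γ) (geomRemainder γ γ) +
  weightedInner (weight (2 * s + 1) γ * derivProduct γ u v) (geomRemainder γ γ) (geomRemainder γ γ) +
  integralCLM (normPow (-1) (derivStart s n γ) *
    pointwise (innerSL ℝ) (derivStart s n u) (derivStart s n v)) +
  integralCLM (normPow 1 (derivStart s n γ) *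
    pointwise (innerSL ℝ) (valStart s n u) (valStart s n v))

end

end MetricModel

section StripCoordinates

variable {s : ℝ} {n : ℕ} [hs : Fact (3 / 2 < s)]

/-! ### Smoothness of the metric -/

omit hs in
lemma contDiffOn_normPow_comp (r : ℝ) (L : Hs s n →L[ℝ] C(Strip, E n))
    (hL : ∀ γ ∈ embeddings s n, ∀ p, L γ p ≠ 0) :
    ContDiffOn ℝ ∞ (fun γ => normPow r (L γ)) (embeddings s n) :=
  (contDiffOn_normPow r).comp L.contDiff.contDiffOn hL

lemma derivStart_ne_zero (γ : Hs s n) (hγ : γ ∈ embeddings s n) (p : Strip) :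
    derivStart s n γ p ≠ 0 := derivCLM_ne_zero hγ _

lemma derivEnd_ne_zero (γ : Hs s n) (hγ : γ ∈ embeddings s n) (p : Strip) :
    derivEnd s n γ p ≠ 0 := derivCLM_ne_zero hγ _

lemma diffQuot_ne_zero (γ : Hs s n) (hγ : γ ∈ embeddings s n) (p : Strip) :
    diffQuot s n γ p ≠ 0 := mem_embeddings_iff.1 hγ p

lemma contDiffOn_weight (r : ℝ) : ContDiffOn ℝ ∞ (weight (s := s) (n := n) r) (embeddings s n) :=
  ((contDiffOn_normPow_comp 1 _ derivStart_ne_zero).mul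
    (contDiffOn_normPow_comp 1 _ derivEnd_ne_zero)).mul
    (contDiffOn_normPow_comp (-r) _ diffQuot_ne_zero)

section

variable {P : Type*} [NormedAddCommGroup P] [NormedSpace ℝ P] {U : Set P} {f g h : P → Hs s n}

omit hs in
lemma ContDiffOn.clm_comp_Hs {Z : Type*} [NormedAddCommGroup Z] [NormedSpace ℝ Z]
    (L : Hs s n →L[ℝ] Z) (hg : ContDiffOn ℝ ∞ g U) : ContDiffOn ℝ ∞ (fun x => L (g x)) U :=
  L.contDiff.comp_contDiffOn hg

omit hs in
lemma contDiffOn_pointwise_inner (L : Hs s n →L[ℝ] C(Strip, E n)) (hg : ContDiffOn ℝ ∞ g U)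
    (hh : ContDiffOn ℝ ∞ h U) :
    ContDiffOn ℝ ∞ (fun x => pointwise (innerSL ℝ) (L (g x)) (L (h x))) U :=
  ContDiffOn.bilin _ (L.contDiff.comp_contDiffOn hg) (L.contDiff.comp_contDiffOn hh)

/-- The only nonlinear ingredient beyond bounded bilinear maps is the power `|γ'|⁻²`. -/
lemma contDiffOn_geomRemainder (hf : ContDiffOn ℝ ∞ f U) (hfm : MapsTo f U (embeddings s n))
    (hg : ContDiffOn ℝ ∞ g U) : ContDiffOn ℝ ∞ (fun x => geomRemainder (f x) (g x)) U := by
  unfold geomRemainder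
  refine (ContDiffOn.clm_comp_Hs _ hg).sub (ContDiffOn.bilin _ (ContDiffOn.bilin _ ?_ ?_)
    (ContDiffOn.bilin _ ?_ ?_))
  · exact (contDiffOn_normPow_comp (-2) _ derivStart_ne_zero).comp hf hfm
  · exact ContDiffOn.clm_comp_Hs _ hg
  · exact ContDiffOn.clm_comp_Hs _ hf
  · exact ContDiffOn.clm_comp_Hs _ hf

lemma contDiffOn_derivProduct (hf : ContDiffOn ℝ ∞ f U) (hfm : MapsTo f U (embeddings s n))
    (hg : ContDiffOn ℝ ∞ g U) (hh : ContDiffOn ℝ ∞ h U) :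
    ContDiffOn ℝ ∞ (fun x => derivProduct (f x) (g x) (h x)) U := by
  unfold derivProduct
  refine (ContDiffOn.mul ?_ (contDiffOn_pointwise_inner _ hg hh)).add
    (ContDiffOn.mul ?_ (contDiffOn_pointwise_inner _ hg hh))
  · exact (contDiffOn_normPow_comp (-2) _ derivStart_ne_zero).comp hf hfm
  · exact (contDiffOn_normPow_comp (-2) _ derivEnd_ne_zero).comp hf hfm

lemma contDiffOn_weightedInner {ρ : P → C(Strip, ℝ)} {F G : P → Lp (E n) 2 (volume : Measure Strip)}
    (hρ : ContDiffOn ℝ ∞ ρ U) (hF : ContDiffOn ℝ ∞ F U) (hG : ContDiffOn ℝ ∞ G U) :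
    ContDiffOn ℝ ∞ (fun x => weightedInner (ρ x) (F x) (G x)) U := by
  unfold weightedInner
  exact ContDiffOn.bilin _ (ContDiffOn.bilin _ hρ hF) hG

lemma contDiffOn_metricModel (hf : ContDiffOn ℝ ∞ f U) (hfm : MapsTo f U (embeddings s n))
    (hg : ContDiffOn ℝ ∞ g U) (hh : ContDiffOn ℝ ∞ h U) :
    ContDiffOn ℝ ∞ (fun x => metricModel (f x) (g x) (h x)) U := by
  have hS := contDiffOn_geomRemainder hf hfm hf
  have hw : ∀ r, ContDiffOn ℝ ∞ (fun x => weight r (f x)) U := fun r =>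
    (contDiffOn_weight r).comp hf hfm
  have hn : ∀ r, ContDiffOn ℝ ∞ (fun x => normPow r (derivStart s n (f x))) U := fun r =>
    (contDiffOn_normPow_comp r _ derivStart_ne_zero).comp hf hfm
  have h1 := contDiffOn_weightedInner (hw (2 * s + 1)) (contDiffOn_geomRemainder hf hfm hg)
    (contDiffOn_geomRemainder hf hfm hh)
  have h2 := contDiffOn_weightedInner ((hw (2 * s + 3)).mul
    (contDiffOn_pointwise_inner (diffQuot s n) hg hh)) hS hS
  have h3 := contDiffOn_weightedInner ((hw (2 * s + 1)).mul
    (contDiffOn_derivProduct hf hfm hg hh)) hS hS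
  have h4 := integralCLM.contDiff.comp_contDiffOn
    ((hn (-1)).mul (contDiffOn_pointwise_inner (derivStart s n) hg hh))
  have h5 := integralCLM.contDiff.comp_contDiffOn
    ((hn 1).mul (contDiffOn_pointwise_inner (valStart s n) hg hh))
  exact ((((contDiffOn_const.mul h1).add (contDiffOn_const.mul h2)).add h3).add h4).add h5

end

/-! ### The metric in the coordinates of the strip -/

omit hs in
lemma Hs.measurable_fn (w : Hs s n) : Measurable w.fn := (Lp.stronglyMeasurable w.1.fst).measurable

omit hs in
-- The displacement variable has total mass one, so single integrals can also be taken over the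
-- strip.
lemma integral_lineElement (γ : Hs s n) (F : UnitAddCircle → ℝ) :
    ∫ x, F x ∂(lineElement γ) = ∫ p : Strip, ‖γ.wderiv p.1‖ * F p.1 := by
  rw [lineElement, integral_withDensity_eq_integral_toReal_smul
    γ.measurable_wderiv.norm.ennreal_ofReal (by simp), Measure.volume_eq_prod,
    integral_fun_fst (fun x => ‖γ.wderiv x‖ * F x)]
  simp

omit hs in
lemma integral_muGeom (γ : Hs s n) {F : UnitAddCircle × UnitAddCircle → ℝ} (hF : Measurable F) :
    ∫ p, F p ∂(muGeom γ) = ∫ p : Strip, (‖γ.wderiv p.1‖ * ‖γ.wderiv (endPoint p)‖ *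
      ‖γ.fn (endPoint p) - γ.fn p.1‖⁻¹) * F (p.1, endPoint p) := by
  have hm := γ.measurable_wderiv.norm
  have hd : Measurable fun p : UnitAddCircle × UnitAddCircle => ‖γ.fn p.2 - γ.fn p.1‖ :=
    ((γ.measurable_fn.comp measurable_snd).sub (γ.measurable_fn.comp measurable_fst)).norm
  have hG : Measurable fun p : UnitAddCircle × UnitAddCircle =>
      (‖γ.wderiv p.1‖ * ‖γ.wderiv p.2‖ * ‖γ.fn p.2 - γ.fn p.1‖⁻¹) * F p :=
    (((hm.comp measurable_fst).mul (hm.comp measurable_snd)).mul hd.inv).mul hF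
  have hw : Measurable fun p : UnitAddCircle × UnitAddCircle =>
      ENNReal.ofReal ‖γ.wderiv p.1‖ * ENNReal.ofReal ‖γ.wderiv p.2‖ :=
    (hm.ennreal_ofReal.comp measurable_fst).mul (hm.ennreal_ofReal.comp measurable_snd)
  have h := integral_map (μ := (volume : Measure Strip)) measurePreserving_pair.aemeasurable
    hG.aestronglyMeasurable
  rw [measurePreserving_pair.map_eq] at h
  rw [← h, muGeom, integral_withDensity_eq_integral_toReal_smul
    (by simpa using hd.inv.ennreal_ofReal) (by simp), lineElement,
    prod_withDensity hm.ennreal_ofReal hm.ennreal_ofReal,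
    integral_withDensity_eq_integral_toReal_smul hw
      (Filter.Eventually.of_forall fun p => ENNReal.mul_lt_top (by simp) (by simp))]
  refine integral_congr_ae (Filter.Eventually.of_forall fun p => ?_)
  simp only [ENNReal.toReal_mul, smul_eq_mul, ENNReal.toReal_ofReal (norm_nonneg _),
    ENNReal.toReal_ofReal (inv_nonneg.2 (norm_nonneg _)), one_div]
  ring

omit hs in
lemma measurable_arcDeriv (γ u : Hs s n) : Measurable (arcDeriv γ u) :=
  γ.measurable_wderiv.norm.inv.smul u.measurable_wderiv

omit hs in
lemma measurable_fn_sub (u : Hs s n) :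
    Measurable fun p : UnitAddCircle × UnitAddCircle => u.fn p.2 - u.fn p.1 :=
  (u.measurable_fn.comp measurable_snd).sub (u.measurable_fn.comp measurable_fst)

omit hs in
lemma measurable_opR (γ u : Hs s n) : Measurable (opR γ u) := by
  have h1 : Measurable fun p : UnitAddCircle × UnitAddCircle =>
      inner ℝ (arcDeriv γ γ p.1) (γ.fn p.2 - γ.fn p.1) :=
    ((measurable_arcDeriv γ γ).comp measurable_fst).inner (measurable_fn_sub γ)
  have h2 : Measurable fun p : UnitAddCircle × UnitAddCircle => arcDeriv γ u p.1 :=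
    (measurable_arcDeriv γ u).comp measurable_fst
  exact ((measurable_fn_sub γ).norm.pow_const s).inv.smul
    ((measurable_fn_sub u).sub (h1.smul h2))

lemma ae_strip_displacement_ne_zero : ∀ᵐ p : Strip, (p.2 : ℝ) ≠ 0 :=
  Measure.quasiMeasurePreserving_snd.ae (measurePreserving_disp_val.quasiMeasurePreserving.ae
    (ae_restrict_of_ae (Measure.ae_ne volume 0)))

lemma ae_strip_eq (u : Hs s n) : ∀ᵐ p : Strip, u.fn p.1 = funCLM u p.1 ∧
    u.fn (endPoint p) = funCLM u (endPoint p) ∧ u.wderiv p.1 = derivCLM u p.1 ∧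
    u.wderiv (endPoint p) = derivCLM u (endPoint p) := by
  have h1 := (funCLM_ae u).symm
  have h2 := (derivCLM_ae u).symm
  filter_upwards [Measure.quasiMeasurePreserving_fst.ae h1,
    Measure.quasiMeasurePreserving_fst.ae h2,
    measurePreserving_endPoint.quasiMeasurePreserving.ae h1,
    measurePreserving_endPoint.quasiMeasurePreserving.ae h2] with p e1 e2 e3 e4
  exact ⟨e1, e3, e2, e4⟩

/-- The scalar relating `R_γ^s u` to the geometric remainder. -/
def remainderFactor (γ : Hs s n) (p : Strip) : ℝ :=
  (‖(p.2 : ℝ) • diffQuot s n γ p‖ ^ s)⁻¹ * ((p.2 : ℝ) * |(p.2 : ℝ)| ^ (s - 1 / 2))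

/-- Here `x = q_u`, `y = u'`, `N = |γ'|`, `i = ⟨γ', q_γ⟩` and `A = |t|^(s-1/2)`. Since `N⁻² ⟨γ', γ'⟩
= 1`, one may subtract `u'` from `q_u` and `γ'` from `q_γ` at once without changing `q_u - N⁻² ⟨γ',
q_γ⟩ u'`; both quotients become Taylor remainders. -/
lemma smul_remainder_identity {V : Type*} [AddCommGroup V] [Module ℝ V] {A N : ℝ} (hA : A ≠ 0)
    (hN : N ≠ 0) (t i : ℝ) (x y : V) :
    t • x - (t * (N⁻¹ * i)) • N⁻¹ • y =
      t • A • (A⁻¹ • (x - y) - ((N ^ 2)⁻¹ * (A⁻¹ * (i - N ^ 2))) • y) := by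
  match_scalars <;> field_simp
  ring

lemma ae_opR {γ : Hs s n} (hγ : γ ∈ embeddings s n) (u : Hs s n) : ∀ᵐ p : Strip,
    opR γ u (p.1, endPoint p) = remainderFactor γ p • geomRemainder γ u p := by
  filter_upwards [ae_strip_displacement_ne_zero, ae_strip_eq γ, ae_strip_eq u,
    geomRemainder_ae hγ u] with p hp hγp hup hS
  rw [hS]
  have ha : derivCLM γ p.1 ≠ 0 := derivCLM_ne_zero hγ _
  have hna : ‖derivCLM γ p.1‖ ≠ 0 := norm_ne_zero_iff.2 ha
  have hpos : |(p.2 : ℝ)| ^ (s - 1 / 2) ≠ 0 := (Real.rpow_pos_of_pos (abs_pos.2 hp) _).ne'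
  simp only [opR, fullDeriv, arcDeriv, hγp.1, hγp.2.1, hγp.2.2.1, hup.1, hup.2.1, hup.2.2.1,
    ← smul_diffQuot, remainderFactor, mul_smul]
  congr 1
  rw [geomRemainderFun, remainder_derivCLM, remainder_derivCLM, derivStart_apply, derivStart_apply]
  have e : ‖derivCLM γ p.1‖ ^ (-2 : ℝ) = (‖derivCLM γ p.1‖ ^ 2)⁻¹ := by
    rw [Real.rpow_neg (norm_nonneg _)]; norm_cast
  rw [e]
  simp only [real_inner_smul_left, real_inner_smul_right, inner_sub_right,
    real_inner_self_eq_norm_sq]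
  exact smul_remainder_identity hpos hna _ _ _ _

/-- Counting exponents of `|t|`: `-1 - 2s + 2 + (2s - 1) = 0`. The singularity of the measure and of
`R_γ^s` is absorbed entirely by the remainders, leaving a continuous weight. -/
lemma rpow_weight_identity (s : ℝ) {t q : ℝ} (ht : t ≠ 0) (hq : 0 < q) :
    (|t| * q)⁻¹ * (((|t| * q) ^ s)⁻¹ * (t * |t| ^ (s - 1 / 2))) ^ 2 = q ^ (-(2 * s + 1)) := by
  have hτ : 0 < |t| := abs_pos.2 ht
  have e1 : (|t| ^ s) ^ 2 = |t| * (|t| ^ (s - 1 / 2)) ^ 2 := by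
    rw [← Real.rpow_mul_natCast hτ.le, ← Real.rpow_mul_natCast hτ.le,
      show s * (2 : ℕ) = 1 + (s - 1 / 2) * (2 : ℕ) by push_cast; ring, Real.rpow_add hτ,
      Real.rpow_one]
  have e2 : q ^ (-(2 * s + 1)) = (q * (q ^ s) ^ 2)⁻¹ := by
    rw [Real.rpow_neg hq.le, Real.rpow_add_one hq.ne', ← Real.rpow_mul_natCast hq.le, mul_comm q]
    congr 3; push_cast; ring
  have hT : |t| ^ s ≠ 0 := (Real.rpow_pos_of_pos hτ s).ne'
  rw [Real.mul_rpow hτ.le hq.le, e2, mul_pow, mul_pow t, ← sq_abs t, inv_pow, mul_pow]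
  generalize |t| ^ (s - 1 / 2) = A at *
  generalize |t| ^ s = T at *
  generalize |t| = τ at *
  have hQ : q ^ s ≠ 0 := (Real.rpow_pos_of_pos hq s).ne'
  generalize q ^ s = Q at *
  have : τ ^ 2 * A ^ 2 = τ * T ^ 2 := by rw [e1]; ring
  rw [this]
  field_simp

lemma metric_weight_eq {γ : Hs s n} (hγ : γ ∈ embeddings s n) {p : Strip} (hp : (p.2 : ℝ) ≠ 0) :
    ‖derivCLM γ p.1‖ * ‖derivCLM γ (endPoint p)‖ * ‖(p.2 : ℝ) • diffQuot s n γ p‖⁻¹ *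
      remainderFactor γ p ^ 2 = weight (2 * s + 1) γ p := by
  have hq : 0 < ‖diffQuot s n γ p‖ := norm_pos_iff.2 (diffQuot_ne_zero γ hγ p)
  rw [weight, ContinuousMap.mul_apply, ContinuousMap.mul_apply,
    normPow_apply _ (derivStart_ne_zero γ hγ), normPow_apply _ (derivEnd_ne_zero γ hγ),
    normPow_apply _ (diffQuot_ne_zero γ hγ), Real.rpow_one, Real.rpow_one, derivStart_apply,
    derivEnd_apply, mul_assoc]
  congr 1
  rw [remainderFactor, norm_smul, Real.norm_eq_abs]
  exact rpow_weight_identity s hp hq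

lemma weight_add_two {γ : Hs s n} (hγ : γ ∈ embeddings s n) (p : Strip) :
    weight (2 * s + 3) γ p = weight (2 * s + 1) γ p * ‖diffQuot s n γ p‖⁻¹ ^ 2 := by
  have hq : 0 < ‖diffQuot s n γ p‖ := norm_pos_iff.2 (diffQuot_ne_zero γ hγ p)
  simp only [weight, ContinuousMap.mul_apply]
  rw [normPow_apply (-(2 * s + 3)) (diffQuot_ne_zero γ hγ),
    normPow_apply (-(2 * s + 1)) (diffQuot_ne_zero γ hγ),
    mul_assoc (normPow 1 (derivStart s n γ) p * normPow 1 (derivEnd s n γ) p)]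
  congr 1
  rw [← Real.rpow_neg_one, ← Real.rpow_mul_natCast hq.le, ← Real.rpow_add hq]
  congr 1; push_cast; ring

lemma B1_eq {γ : Hs s n} (hγ : γ ∈ embeddings s n) (u v : Hs s n) :
    B1 γ u v = weightedInner (weight (2 * s + 1) γ) (geomRemainder γ u) (geomRemainder γ v) := by
  rw [B1, integral_muGeom γ ((measurable_opR γ u).inner (measurable_opR γ v)), weightedInner_eq]
  refine integral_congr_ae ?_
  filter_upwards [ae_strip_displacement_ne_zero, ae_strip_eq γ, ae_opR hγ u, ae_opR hγ v]
    with p hp hγp hu hv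
  rw [hu, hv, hγp.1, hγp.2.1, hγp.2.2.1, hγp.2.2.2, ← smul_diffQuot, ← metric_weight_eq hγ hp,
    real_inner_smul_left, real_inner_smul_right]
  ring

end StripCoordinates

/-! ### Identification of the metric with its smooth model -/

section MetricFormula

variable {s : ℝ} {n : ℕ} [hs : Fact (3 / 2 < s)]

section Identities

variable {V : Type*} [NormedAddCommGroup V] [InnerProductSpace ℝ V]

lemma product_identity_quot (m : ℝ) {t : ℝ} (ht : t ≠ 0) {q : V} (hq : q ≠ 0) (c : ℝ) (S x y : V) :
    m * ‖t • q‖⁻¹ * (‖c • S‖ ^ 2 * inner ℝ (‖t • q‖⁻¹ • t • x) (‖t • q‖⁻¹ • t • y)) =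
      m * ‖t • q‖⁻¹ * c ^ 2 * ‖q‖⁻¹ ^ 2 * inner ℝ x y * ‖S‖ ^ 2 := by
  have hq' : ‖q‖ ≠ 0 := norm_ne_zero_iff.2 hq
  have ht' : |t| ≠ 0 := abs_ne_zero.2 ht
  have e : ‖t • q‖⁻¹ * t * (‖t • q‖⁻¹ * t) = ‖q‖⁻¹ ^ 2 := by
    rw [norm_smul, Real.norm_eq_abs, mul_inv]
    have : |t|⁻¹ * |t|⁻¹ * (t * t) = 1 := by rw [← abs_mul_abs_self t]; field_simp
    linear_combination ‖q‖⁻¹ ^ 2 * this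
  rw [norm_smul c, mul_pow, Real.norm_eq_abs, sq_abs, smul_smul, smul_smul, real_inner_smul_left,
    real_inner_smul_right, ← e]
  ring

lemma product_identity_deriv (a b D c : ℝ) (S x y x' y' : V) :
    a * b * D * (‖c • S‖ ^ 2 * (inner ℝ (a⁻¹ • x) (a⁻¹ • y) + inner ℝ (b⁻¹ • x') (b⁻¹ • y'))) =
      a * b * D * c ^ 2 * ((a ^ 2)⁻¹ * inner ℝ x y + (b ^ 2)⁻¹ * inner ℝ x' y') * ‖S‖ ^ 2 := by
  rw [norm_smul c, mul_pow, Real.norm_eq_abs, sq_abs, real_inner_smul_left, real_inner_smul_right,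
    real_inner_smul_left, real_inner_smul_right]
  ring

end Identities

lemma derivProduct_apply {γ : Hs s n} (hγ : γ ∈ embeddings s n) (u v : Hs s n) (p : Strip) :
    derivProduct γ u v p =
      (‖derivCLM γ p.1‖ ^ 2)⁻¹ * inner ℝ (derivCLM u p.1) (derivCLM v p.1) +
      (‖derivCLM γ (endPoint p)‖ ^ 2)⁻¹ *
        inner ℝ (derivCLM u (endPoint p)) (derivCLM v (endPoint p)) := by
  have e : ∀ a : ℝ, 0 ≤ a → a ^ (-2 : ℝ) = (a ^ 2)⁻¹ := fun a ha => by
    rw [Real.rpow_neg ha]; norm_cast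
  have h1 : normPow (-2) (derivStart s n γ) p = (‖derivCLM γ p.1‖ ^ 2)⁻¹ :=
    (normPow_apply _ (derivStart_ne_zero γ hγ) p).trans (e _ (norm_nonneg _))
  have h2 : normPow (-2) (derivEnd s n γ) p = (‖derivCLM γ (endPoint p)‖ ^ 2)⁻¹ :=
    (normPow_apply _ (derivEnd_ne_zero γ hγ) p).trans (e _ (norm_nonneg _))
  rw [← h1, ← h2]
  rfl

set_option maxHeartbeats 1000000 in
lemma B2_eq {γ : Hs s n} (hγ : γ ∈ embeddings s n) (u v : Hs s n) :
    B2 γ u v = weightedInner (weight (2 * s + 3) γ *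
      pointwise (innerSL ℝ) (diffQuot s n u) (diffQuot s n v)) (geomRemainder γ γ)
      (geomRemainder γ γ) := by
  have hm : ∀ w : Hs s n, Measurable fun p : UnitAddCircle × UnitAddCircle =>
      ‖γ.fn p.2 - γ.fn p.1‖⁻¹ • (w.fn p.2 - w.fn p.1) := fun w =>
    (measurable_fn_sub γ).norm.inv.smul (measurable_fn_sub w)
  have hF : Measurable fun p : UnitAddCircle × UnitAddCircle => ‖opR γ γ p‖ ^ 2 *
      inner ℝ (‖γ.fn p.2 - γ.fn p.1‖⁻¹ • (u.fn p.2 - u.fn p.1))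
        (‖γ.fn p.2 - γ.fn p.1‖⁻¹ • (v.fn p.2 - v.fn p.1)) :=
    ((measurable_opR γ γ).norm.pow_const 2).mul ((hm u).inner (hm v))
  rw [B2, integral_muGeom γ hF, weightedInner_eq]
  refine integral_congr_ae ?_
  filter_upwards [ae_strip_displacement_ne_zero, ae_strip_eq γ, ae_strip_eq u, ae_strip_eq v,
    ae_opR hγ γ] with p hp hγp hup hvp hγR
  have h1 : (weight (2 * s + 3) γ * pointwise (innerSL ℝ) (diffQuot s n u) (diffQuot s n v)) p =
      ‖derivCLM γ p.1‖ * ‖derivCLM γ (endPoint p)‖ * ‖(p.2 : ℝ) • diffQuot s n γ p‖⁻¹ *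
      remainderFactor γ p ^ 2 * ‖diffQuot s n γ p‖⁻¹ ^ 2 *
      inner ℝ (diffQuot s n u p) (diffQuot s n v p) := by
    rw [metric_weight_eq hγ hp, ← weight_add_two hγ]
    rfl
  rw [h1, hγR, hγp.1, hγp.2.1, hγp.2.2.1, hγp.2.2.2, hup.1, hup.2.1, hvp.1, hvp.2.1,
    ← smul_diffQuot, ← smul_diffQuot, ← smul_diffQuot, real_inner_self_eq_norm_sq]
  exact product_identity_quot _ hp (diffQuot_ne_zero γ hγ p) _ _ _ _

set_option maxHeartbeats 1000000 in
lemma B3_eq {γ : Hs s n} (hγ : γ ∈ embeddings s n) (u v : Hs s n) :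
    B3 γ u v = weightedInner (weight (2 * s + 1) γ * derivProduct γ u v) (geomRemainder γ γ)
      (geomRemainder γ γ) := by
  have hm : ∀ w : Hs s n, Measurable (arcDeriv γ w) := measurable_arcDeriv γ
  have hF : Measurable fun p : UnitAddCircle × UnitAddCircle => ‖opR γ γ p‖ ^ 2 *
      (inner ℝ (arcDeriv γ u p.1) (arcDeriv γ v p.1)
        + inner ℝ (arcDeriv γ u p.2) (arcDeriv γ v p.2)) :=
    ((measurable_opR γ γ).norm.pow_const 2).mul
      ((((hm u).comp measurable_fst).inner ((hm v).comp measurable_fst)).add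
        (((hm u).comp measurable_snd).inner ((hm v).comp measurable_snd)))
  rw [B3, integral_muGeom γ hF, weightedInner_eq]
  refine integral_congr_ae ?_
  filter_upwards [ae_strip_displacement_ne_zero, ae_strip_eq γ, ae_strip_eq u, ae_strip_eq v,
    ae_opR hγ γ] with p hp hγp hup hvp hγR
  have h1 : (weight (2 * s + 1) γ * derivProduct γ u v) p =
      ‖derivCLM γ p.1‖ * ‖derivCLM γ (endPoint p)‖ * ‖(p.2 : ℝ) • diffQuot s n γ p‖⁻¹ *
      remainderFactor γ p ^ 2 * ((‖derivCLM γ p.1‖ ^ 2)⁻¹ *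
        inner ℝ (derivCLM u p.1) (derivCLM v p.1) + (‖derivCLM γ (endPoint p)‖ ^ 2)⁻¹ *
        inner ℝ (derivCLM u (endPoint p)) (derivCLM v (endPoint p))) := by
    rw [metric_weight_eq hγ hp, ← derivProduct_apply hγ]
    rfl
  simp only [arcDeriv]
  rw [h1, hγR, hγp.1, hγp.2.1, hγp.2.2.1, hγp.2.2.2, hup.2.2.1, hup.2.2.2, hvp.2.2.1, hvp.2.2.2,
    ← smul_diffQuot, real_inner_self_eq_norm_sq]
  exact product_identity_deriv _ _ _ _ _ _ _ _ _

lemma innerH1_eq {γ : Hs s n} (hγ : γ ∈ embeddings s n) (u v : Hs s n) :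
    innerH1 γ u v = integralCLM (normPow (-1) (derivStart s n γ) *
      pointwise (innerSL ℝ) (derivStart s n u) (derivStart s n v)) := by
  rw [innerH1, integral_lineElement, integralCLM_apply]
  refine integral_congr_ae ?_
  filter_upwards [ae_strip_eq γ, ae_strip_eq u, ae_strip_eq v] with p hγp hup hvp
  have hna : ‖derivCLM γ p.1‖ ≠ 0 := norm_ne_zero_iff.2 (derivCLM_ne_zero hγ _)
  simp only [arcDeriv]
  rw [hγp.2.2.1, hup.2.2.1, hvp.2.2.1, ContinuousMap.mul_apply, pointwise_apply,
    innerSL_apply_apply, normPow_apply _ (derivStart_ne_zero γ hγ), Real.rpow_neg_one,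
    real_inner_smul_left, real_inner_smul_right]
  simp only [derivStart_apply]
  field_simp

lemma innerL2_eq {γ : Hs s n} (hγ : γ ∈ embeddings s n) (u v : Hs s n) :
    innerL2 γ u v = integralCLM (normPow 1 (derivStart s n γ) *
      pointwise (innerSL ℝ) (valStart s n u) (valStart s n v)) := by
  rw [innerL2, integral_lineElement, integralCLM_apply]
  refine integral_congr_ae ?_
  filter_upwards [ae_strip_eq γ, ae_strip_eq u, ae_strip_eq v] with p hγp hup hvp
  rw [hγp.2.2.1, hup.1, hvp.1, ContinuousMap.mul_apply, pointwise_apply,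
    innerSL_apply_apply, normPow_apply _ (derivStart_ne_zero γ hγ) p, Real.rpow_one]
  rfl

lemma metricG_eq {γ : Hs s n} (hγ : γ ∈ embeddings s n) (u v : Hs s n) :
    metricG γ u v = metricModel γ u v := by
  rw [metricG, metricModel, B1_eq hγ, B2_eq hγ, B3_eq hγ, innerH1_eq hγ, innerL2_eq hγ]

lemma contDiffOn_metricG :
    ContDiffOn ℝ ∞ (fun p : Hs s n × Hs s n × Hs s n => metricG p.1 p.2.1 p.2.2)
      (embeddings s n ×ˢ univ) :=
  (contDiffOn_metricModel contDiff_fst.contDiffOn (fun _ hp => hp.1)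
    (contDiff_fst.comp contDiff_snd).contDiffOn
    (contDiff_snd.comp contDiff_snd).contDiffOn).congr fun _ hp => metricG_eq hp.1 _ _

end MetricFormula

/-! ### Christoffel symbols of a strong Riemannian metric -/

section Abstract

variable {X : Type*} [NormedAddCommGroup X] [InnerProductSpace ℝ X] [CompleteSpace X]

/-- Lax–Milgram combined with the Riesz isomorphism makes `B` bijective onto the dual. -/
lemma exists_continuousLinearEquiv_of_coercive {B : X →L[ℝ] X →L[ℝ] ℝ} {c : ℝ} (hc : 0 < c)
    (h : ∀ u, c * ‖u‖ ^ 2 ≤ B u u) :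
    ∃ e : X ≃L[ℝ] (X →L[ℝ] ℝ), (e : X →L[ℝ] (X →L[ℝ] ℝ)) = B := by
  have hB : IsCoercive B := ⟨c, hc, fun u => by rw [mul_assoc, ← sq]; exact h u⟩
  have hinj : Function.Injective B := fun a b h => by
    refine hB.continuousLinearEquivOfBilin.injective (ext_inner_right ℝ fun w => ?_)
    rw [hB.continuousLinearEquivOfBilin_apply, hB.continuousLinearEquivOfBilin_apply, h]
  have hsurj : Function.Surjective B := fun f => by
    refine ⟨hB.continuousLinearEquivOfBilin.symm ((InnerProductSpace.toDual ℝ X).symm f), ?_⟩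
    ext w
    rw [← hB.continuousLinearEquivOfBilin_apply, ContinuousLinearEquiv.apply_symm_apply,
      InnerProductSpace.toDual_symm_apply]
  refine ⟨ContinuousLinearEquiv.ofBijective B (LinearMap.ker_eq_bot.2 hinj)
    (LinearMap.range_eq_top.2 hsurj), ?_⟩
  ext a w
  simp

end Abstract

-- Koszul's formula says that `G_x`, viewed as a map to the dual, sends `a` to a functional `ℓ`
-- smooth in `(x, u, v)`. Hence `a = G_x⁻¹ ℓ`, and inversion of operators is smooth at invertible
-- ones.
set_option maxSynthPendingDepth 3 in
theorem exists_christoffel {X : Type*} [NormedAddCommGroup X] [NormedSpace ℝ X] [CompleteSpace X]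
    {U : Set X} (hU : IsOpen U) {G : X → X → X → ℝ}
    (hG : ContDiffOn ℝ ∞ (fun p : X × X × X => G p.1 p.2.1 p.2.2) (U ×ˢ univ))
    (h1 : ∀ x ∈ U, ∀ v, IsLinearMap ℝ fun u => G x u v) (h2 : ∀ x ∈ U, ∀ u, IsLinearMap ℝ (G x u))
    (hc : ∀ x ∈ U, ∀ B : X →L[ℝ] X →L[ℝ] ℝ, (∀ u v, B u v = G x u v) →
      ∃ e : X ≃L[ℝ] (X →L[ℝ] ℝ), (e : X →L[ℝ] (X →L[ℝ] ℝ)) = B) :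
    ∃ A : X → X → X → X, ContDiffOn ℝ ∞ (fun p : X × X × X => A p.1 p.2.1 p.2.2) (U ×ˢ univ) ∧
      ∀ x ∈ U, ∀ u v a, (∀ w, G x a w = 1 / 2 * (fderiv ℝ (fun y => G y v w) x u +
        fderiv ℝ (fun y => G y u w) x v - fderiv ℝ (fun y => G y u v) x w)) ↔ a = A x u v := by
  obtain ⟨L, hL, hLG⟩ := exists_contDiffOn_bilin hU hG h1 h2
  have hD : ContDiffOn ℝ ∞ (fderiv ℝ L) U := hL.fderiv_of_isOpen hU (by simp)
  -- Derivatives of the scalar functions are evaluations of one derivative of the form-valued map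
  -- `L`; this makes them jointly smooth and linear in the direction.
  have hfd : ∀ x ∈ U, ∀ h u v, fderiv ℝ (fun y => G y u v) x h = fderiv ℝ L x h u v := by
    intro x hx h u v
    have hd : HasFDerivAt L (fderiv ℝ L x) x :=
      ((hL.contDiffAt (hU.mem_nhds hx)).differentiableAt (by simp)).hasFDerivAt
    have e : (fun y => G y u v) =ᶠ[nhds x] fun y => L y u v := by
      filter_upwards [hU.mem_nhds hx] with y hy using (hLG y hy u v).symm
    rw [e.fderiv_eq, ((hd.clm_apply (hasFDerivAt_const u x)).clm_apply
      (hasFDerivAt_const v x)).fderiv]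
    simp
  have hequiv : ∀ x ∈ U, ∃ e : X ≃L[ℝ] (X →L[ℝ] ℝ), (e : X →L[ℝ] (X →L[ℝ] ℝ)) = L x :=
    fun x hx => hc x hx _ (hLG x hx)
  -- In the last term `w` is the direction of differentiation; the flips move it to the final
  -- argument.
  let ℓ : X × X × X → (X →L[ℝ] ℝ) := fun p => (1 / 2 : ℝ) • (fderiv ℝ L p.1 p.2.1 p.2.2 +
    fderiv ℝ L p.1 p.2.2 p.2.1 - ((fderiv ℝ L p.1).flip p.2.1).flip p.2.2)
  have hfst : MapsTo (Prod.fst : X × X × X → X) (U ×ˢ univ) U := fun p hp => hp.1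
  have hD' : ContDiffOn ℝ ∞ (fun p : X × X × X => fderiv ℝ L p.1) (U ×ˢ univ) :=
    hD.comp contDiff_fst.contDiffOn hfst
  have hu : ContDiffOn ℝ ∞ (fun p : X × X × X => p.2.1) (U ×ˢ univ) :=
    (contDiff_fst.comp contDiff_snd).contDiffOn
  have hv : ContDiffOn ℝ ∞ (fun p : X × X × X => p.2.2) (U ×ˢ univ) :=
    (contDiff_snd.comp contDiff_snd).contDiffOn
  have hℓ : ContDiffOn ℝ ∞ ℓ (U ×ˢ univ) := by
    have f1 := (ContinuousLinearMap.flipₗᵢ ℝ X X (X →L[ℝ] ℝ)).contDiff (n := ∞)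
      |>.comp_contDiffOn hD'
    have f2 := (ContinuousLinearMap.flipₗᵢ ℝ X X ℝ).contDiff (n := ∞)
      |>.comp_contDiffOn (f1.clm_apply hu)
    exact ((((hD'.clm_apply hu).clm_apply hv).add ((hD'.clm_apply hv).clm_apply hu)).sub
      (f2.clm_apply hv)).const_smul (1 / 2 : ℝ)
  refine ⟨fun x u v => ContinuousLinearMap.inverse (L x) (ℓ (x, u, v)), ?_, ?_⟩
  · refine ContDiffOn.clm_apply ?_ hℓ
    refine ContDiffOn.comp (t := U) (g := fun x => ContinuousLinearMap.inverse (L x)) ?_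
      contDiff_fst.contDiffOn hfst
    intro x hx
    obtain ⟨e, he⟩ := hequiv x hx
    have h := contDiffAt_map_inverse (n := ∞) e
    rw [he] at h
    exact (h.comp x (hL.contDiffAt (hU.mem_nhds hx))).contDiffWithinAt
  · intro x hx u v a
    obtain ⟨e, he⟩ := hequiv x hx
    have hLe : ∀ b, L x b = e b := fun b => by rw [← he]; rfl
    simp only []
    rw [← he, ContinuousLinearMap.inverse_equiv]
    change _ ↔ a = e.symm _
    rw [e.eq_symm_apply, ← hLe, ContinuousLinearMap.ext_iff]
    refine forall_congr' fun w => ?_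
    rw [hfd x hx, hfd x hx, hfd x hx, hLG x hx]
    simp [ℓ]

section Completeness

variable {s : ℝ} {n : ℕ}

/-! ### Completeness of the Sobolev--Slobodeckij space -/

lemma norm_integral_smul_Lp_le {ψ : ℝ → ℝ} {C : ℝ} (hC : ∀ t ∈ Icc (0 : ℝ) 1, |ψ t| ≤ C)
    (f : Lp (E n) 2 (volume : Measure UnitAddCircle)) :
    ‖∫ t in (0 : ℝ)..1, ψ t • f (t : UnitAddCircle)‖ ≤ C * ‖f‖ := by
  have hC0 : 0 ≤ C := (abs_nonneg _).trans (hC 0 ⟨le_rfl, zero_le_one⟩)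
  have hi : IntervalIntegrable (fun t : ℝ => C * ‖f (t : UnitAddCircle)‖) volume 0 1 := by
    have h := (intervalIntegrable_smul (continuous_const (y := (1 : ℝ))) f).norm.const_mul C
    simpa using h
  refine (intervalIntegral.norm_integral_le_of_norm_le zero_le_one
    (g := fun t : ℝ => C * ‖f (t : UnitAddCircle)‖) ?_ hi).trans ?_
  · refine Filter.Eventually.of_forall fun t ht => ?_
    rw [norm_smul]
    gcongr
    exact hC t ⟨ht.1.le, ht.2⟩
  · rw [intervalIntegral.integral_const_mul]
    gcongr
    have h := UnitAddCircle.intervalIntegral_preimage 0 (fun x => ‖f x‖)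
    rw [zero_add] at h
    rw [h]
    exact integral_norm_le_norm_Lp f

lemma continuous_integral_smul_Lp {ψ : ℝ → ℝ} (hψ : Continuous ψ) :
    Continuous fun f : Lp (E n) 2 (volume : Measure UnitAddCircle) =>
      ∫ t in (0 : ℝ)..1, ψ t • f (t : UnitAddCircle) := by
  obtain ⟨C, hC⟩ := isCompact_Icc.exists_bound_of_continuousOn (s := Icc (0 : ℝ) 1) hψ.continuousOn
  refine continuous_iff_continuousAt.2 fun f => ?_
  rw [ContinuousAt, tendsto_iff_norm_sub_tendsto_zero]
  have h0 : Filter.Tendsto (fun g => C * ‖g - f‖) (nhds f) (nhds 0) := by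
    have h : Continuous fun g : Lp (E n) 2 (volume : Measure UnitAddCircle) => C * ‖g - f‖ := by
      fun_prop
    simpa using h.tendsto f
  refine squeeze_zero (fun _ => norm_nonneg _) (fun g => ?_) h0
  refine le_trans (le_of_eq ?_) (norm_integral_smul_Lp_le hC (g - f))
  rw [← intervalIntegral.integral_sub (intervalIntegrable_smul hψ _) (intervalIntegrable_smul hψ _),
    integral_smul_congr ψ (Lp.coeFn_sub g f)]
  simp only [Pi.sub_apply, smul_sub]

/-- Pairings with fixed test functions are continuous on `L²`, so the weak derivative survives
limits. The relation between the last two entries survives by passing to almost everywhere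
convergent subsequences. -/
lemma isClosed_sobolevSlobodeckij :
    IsClosed (sobolevSlobodeckij s n : Set (Ambient n)) := by
  refine IsSeqClosed.isClosed fun w a hw hwa => ⟨fun φ hφ => ?_, ?_⟩
  · have hφ' : Continuous (deriv (fun r : ℝ => φ r)) := hφ.continuous_deriv (by simp)
    have hf : Filter.Tendsto (fun k => (w k).fst) Filter.atTop (nhds a.fst) :=
      ((WithLp.fstL 2 ℝ _ _).continuous.tendsto a).comp hwa
    have hg : Filter.Tendsto (fun k => (w k).snd.fst) Filter.atTop (nhds a.snd.fst) :=
      (((WithLp.fstL 2 ℝ _ _).comp (WithLp.sndL 2 ℝ _ _)).continuous.tendsto a).comp hwa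
    have h1 := ((continuous_integral_smul_Lp hφ').tendsto _).comp hf
    have h2 := (((continuous_integral_smul_Lp hφ.continuous).tendsto _).comp hg).neg
    refine tendsto_nhds_unique h1 (h2.congr fun k => ?_)
    exact ((hw k).1 φ hφ).symm
  · have hg : Filter.Tendsto (fun k => (w k).snd.fst) Filter.atTop (nhds a.snd.fst) :=
      (((WithLp.fstL 2 ℝ _ _).comp (WithLp.sndL 2 ℝ _ _)).continuous.tendsto a).comp hwa
    have hq : Filter.Tendsto (fun k => (w k).snd.snd) Filter.atTop (nhds a.snd.snd) :=
      (((WithLp.sndL 2 ℝ _ _).comp (WithLp.sndL 2 ℝ _ _)).continuous.tendsto a).comp hwa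
    obtain ⟨i, hi, hi'⟩ := (tendstoInMeasure_of_tendsto_Lp hg).exists_seq_tendsto_ae
    -- The second subsequence is taken inside the first, so both entries converge along it.
    obtain ⟨j, hj, hj'⟩ := (tendstoInMeasure_of_tendsto_Lp
      (hq.comp hi.tendsto_atTop)).exists_seq_tendsto_ae
    have hall : ∀ᵐ p ∂(mu), ∀ k, (w k).snd.snd p = fracDiff (s - 1) (w k).snd.fst p :=
      ae_all_iff.2 fun k => (hw k).2
    filter_upwards [hall, hj', ae_mu_fst hi', ae_mu_snd hi'] with p h1 h2 h3 h4
    refine tendsto_nhds_unique h2 (Filter.Tendsto.congr (fun k => (h1 _).symm) ?_)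
    exact ((h4.comp hj.tendsto_atTop).sub (h3.comp hj.tendsto_atTop)).const_smul _

instance : CompleteSpace (Hs s n) :=
  (isClosed_sobolevSlobodeckij (s := s) (n := n)).completeSpace_coe

end Completeness

section Coercivity

variable {s : ℝ} {n : ℕ}

/-! ### Bilinearity of the metric -/

lemma weightedInner_add_left (ρ : C(Strip, ℝ)) (F F' G : Lp (E n) 2 (volume : Measure Strip)) :
    weightedInner ρ (F + F') G = weightedInner ρ F G + weightedInner ρ F' G := by
  simp only [weightedInner, map_add, add_apply]

lemma weightedInner_smul_left (ρ : C(Strip, ℝ)) (c : ℝ)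
    (F G : Lp (E n) 2 (volume : Measure Strip)) :
    weightedInner ρ (c • F) G = c * weightedInner ρ F G := by
  simp only [weightedInner, map_smul, smul_apply, smul_eq_mul]

lemma weightedInner_add (ρ ρ' : C(Strip, ℝ)) (F G : Lp (E n) 2 (volume : Measure Strip)) :
    weightedInner (ρ + ρ') F G = weightedInner ρ F G + weightedInner ρ' F G := by
  simp only [weightedInner, map_add, add_apply]

lemma weightedInner_smul (c : ℝ) (ρ : C(Strip, ℝ)) (F G : Lp (E n) 2 (volume : Measure Strip)) :
    weightedInner (c • ρ) F G = c * weightedInner ρ F G := by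
  simp only [weightedInner, map_smul, smul_apply, smul_eq_mul]

lemma weightedInner_comm (ρ : C(Strip, ℝ)) (F G : Lp (E n) 2 (volume : Measure Strip)) :
    weightedInner ρ F G = weightedInner ρ G F := by
  simp only [weightedInner_eq, real_inner_comm]

lemma weightedInner_nonneg {ρ : C(Strip, ℝ)} (hρ : ∀ p, 0 ≤ ρ p)
    (F : Lp (E n) 2 (volume : Measure Strip)) : 0 ≤ weightedInner ρ F F := by
  rw [weightedInner_eq]
  exact integral_nonneg fun p => mul_nonneg (hρ p) real_inner_self_nonneg

lemma le_weightedInner {ρ : C(Strip, ℝ)} {c : ℝ} (hρ : ∀ p, c ≤ ρ p)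
    (F : Lp (E n) 2 (volume : Measure Strip)) : c * ‖F‖ ^ 2 ≤ weightedInner ρ F F := by
  have h1 : weightedInner (ContinuousMap.const Strip c) F F = c * ‖F‖ ^ 2 := by
    rw [weightedInner_eq, ← real_inner_self_eq_norm_sq, L2.inner_def, ← integral_const_mul]
    rfl
  have h2 := weightedInner_nonneg (ρ := ρ - ContinuousMap.const Strip c)
    (fun p => sub_nonneg.2 (hρ p)) F
  have h3 := weightedInner_add (ρ - ContinuousMap.const Strip c) (ContinuousMap.const Strip c) F F
  rw [sub_add_cancel, h1] at h3
  linarith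

lemma pointwise_inner_comm (f g : C(Strip, E n)) :
    pointwise (innerSL ℝ) f g = pointwise (innerSL ℝ) g f := by
  ext p
  exact real_inner_comm (g p) (f p)

section

variable [hs : Fact (3 / 2 < s)]

lemma geomRemainder_add (γ u v : Hs s n) :
    geomRemainder γ (u + v) = geomRemainder γ u + geomRemainder γ v := by
  simp only [geomRemainder, map_add, add_apply]
  abel

lemma geomRemainder_smul (γ : Hs s n) (c : ℝ) (u : Hs s n) :
    geomRemainder γ (c • u) = c • geomRemainder γ u := by
  simp only [geomRemainder, map_smul, smul_apply, smul_sub]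

lemma derivProduct_add_left (γ u u' v : Hs s n) :
    derivProduct γ (u + u') v = derivProduct γ u v + derivProduct γ u' v := by
  simp only [derivProduct, map_add, add_apply]
  ring

lemma derivProduct_smul_left (γ : Hs s n) (c : ℝ) (u v : Hs s n) :
    derivProduct γ (c • u) v = c • derivProduct γ u v := by
  simp only [derivProduct, map_smul, smul_apply, smul_add, mul_smul_comm]

lemma derivProduct_comm (γ u v : Hs s n) : derivProduct γ u v = derivProduct γ v u := by
  simp only [derivProduct, pointwise_inner_comm (derivStart s n u),
    pointwise_inner_comm (derivEnd s n u)]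

lemma isLinearMap_metricModel_left (γ v : Hs s n) : IsLinearMap ℝ fun u => metricModel γ u v where
  map_add u u' := by
    simp only [metricModel, geomRemainder_add, derivProduct_add_left, map_add,
      add_apply, weightedInner_add_left, mul_add, weightedInner_add]
    ring
  map_smul c u := by
    simp only [metricModel, geomRemainder_smul, derivProduct_smul_left, map_smul, mul_smul_comm,
      smul_apply, weightedInner_smul_left, weightedInner_smul, smul_eq_mul]
    ring

lemma metricModel_comm (γ u v : Hs s n) : metricModel γ u v = metricModel γ v u := by
  simp only [metricModel, derivProduct_comm γ u v, pointwise_inner_comm (derivStart s n u),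
    pointwise_inner_comm (diffQuot s n u), pointwise_inner_comm (valStart s n u),
    weightedInner_comm _ (geomRemainder γ u) (geomRemainder γ v)]

lemma isLinearMap_metricModel_right (γ u : Hs s n) : IsLinearMap ℝ (metricModel γ u) := by
  have h : metricModel γ u = fun v => metricModel γ v u := funext fun v => metricModel_comm γ u v
  rw [h]
  exact isLinearMap_metricModel_left γ u

/-! ### Coercivity of the metric -/

omit hs in
lemma exists_pos_le {f : C(Strip, ℝ)} (hf : ∀ p, 0 < f p) : ∃ c : ℝ, 0 < c ∧ ∀ p, c ≤ f p := by
  obtain ⟨p, -, hp⟩ := isCompact_univ.exists_isMinOn (univ_nonempty (α := Strip))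
    f.continuous.continuousOn
  exact ⟨f p, hf p, fun q => hp (mem_univ q)⟩

omit hs in
lemma normPow_pos (r : ℝ) {f : C(Strip, E n)} (hf : ∀ p, f p ≠ 0) (p : Strip) :
    0 < normPow r f p := by
  rw [normPow_apply r hf]
  exact Real.rpow_pos_of_pos (norm_pos_iff.2 (hf p)) r

lemma weight_pos (r : ℝ) {γ : Hs s n} (hγ : γ ∈ embeddings s n) (p : Strip) : 0 < weight r γ p :=
  mul_pos (mul_pos (normPow_pos 1 (derivStart_ne_zero γ hγ) p)
    (normPow_pos 1 (derivEnd_ne_zero γ hγ) p)) (normPow_pos (-r) (diffQuot_ne_zero γ hγ) p)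

omit hs in
lemma pointwise_inner_self_nonneg (f : C(Strip, E n)) (p : Strip) :
    0 ≤ pointwise (innerSL ℝ) f f p :=
  real_inner_self_nonneg (x := f p)

lemma derivProduct_self_nonneg {γ : Hs s n} (hγ : γ ∈ embeddings s n) (u : Hs s n) (p : Strip) :
    0 ≤ derivProduct γ u u p :=
  add_nonneg (mul_nonneg (normPow_pos _ (derivStart_ne_zero γ hγ) p).le
    (pointwise_inner_self_nonneg _ p)) (mul_nonneg (normPow_pos _ (derivEnd_ne_zero γ hγ) p).le
    (pointwise_inner_self_nonneg _ p))

omit hs in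
lemma le_integralCLM_mul {ρ f : C(Strip, ℝ)} {c : ℝ} (hρ : ∀ p, c ≤ ρ p) (hf : ∀ p, 0 ≤ f p) :
    c * integralCLM f ≤ integralCLM (ρ * f) := by
  have h1 : 0 ≤ integralCLM ((ρ - ContinuousMap.const Strip c) * f) := by
    rw [integralCLM_apply]
    exact integral_nonneg fun p => mul_nonneg (sub_nonneg.2 (hρ p)) (hf p)
  have h2 : ContinuousMap.const Strip c * f = c • f := by ext p; rfl
  rw [sub_mul, map_sub, h2, map_smul, smul_eq_mul] at h1
  linarith

omit hs in
lemma integralCLM_startCLM {f : C(UnitAddCircle, E n)}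
    {F : Lp (E n) 2 (volume : Measure UnitAddCircle)} (h : f =ᵐ[volume] F) :
    integralCLM (pointwise (innerSL ℝ) (startCLM f) (startCLM f)) = ‖F‖ ^ 2 := by
  have h1 : ∫ p : Strip, (inner ℝ (f p.1) (f p.1) : ℝ) = ∫ x, inner ℝ (f x) (f x) := by
    rw [Measure.volume_eq_prod, integral_fun_fst (fun x => (inner ℝ (f x) (f x) : ℝ))]
    simp
  rw [integralCLM_apply, ← real_inner_self_eq_norm_sq, L2.inner_def]
  refine h1.trans (integral_congr_ae ?_)
  filter_upwards [h] with x hx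
  rw [hx]

/-- The correction term multiplies `u'` by a fixed `L²` function built from `γ`, so it is bounded by
the sup norm of `u'`. -/
lemma exists_norm_remainderCLM_le (γ : Hs s n) : ∃ M : ℝ, 0 ≤ M ∧ ∀ u : Hs s n,
    ‖remainderCLM u‖ ≤ ‖geomRemainder γ u‖ + M * ‖derivCLM u‖ := by
  let T : C(UnitAddCircle, E n) →L[ℝ] Lp (E n) 2 (volume : Measure Strip) :=
    ((pointwiseLp (ContinuousLinearMap.lsmul ℝ ℝ (E := E n)).flip).flip
      (pointwiseLp (innerSL ℝ) (derivStart s n γ) (remainderCLM γ))).comp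
      ((pointwise (ContinuousLinearMap.lsmul ℝ ℝ) (normPow (-2) (derivStart s n γ))).comp startCLM)
  refine ⟨‖T‖, T.opNorm_nonneg, fun u => ?_⟩
  have h : remainderCLM u = geomRemainder γ u + T (derivCLM u) := (sub_add_cancel _ _).symm
  rw [h]
  exact (norm_add_le _ _).trans (by gcongr; exact T.le_opNorm _)

omit hs in
lemma sq_le_of_le_add_div_four {a b d r N m : ℝ} (ha : 0 ≤ a) (hd : 0 ≤ d)
    (h : d ≤ 2 * r + N / 4 + 2 * (m * b)) (hN : N ^ 2 = a + (b ^ 2 + d ^ 2)) :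
    N ^ 2 ≤ 2 * (12 + 12 * m ^ 2) * (a + b ^ 2 + r ^ 2) := by
  have h7 : d ^ 2 ≤ (2 * r + N / 4 + 2 * (m * b)) ^ 2 := by gcongr
  -- From `(x + y + z)² ≤ 3 (x² + y² + z²)`. The coefficient `3/16` is below `1/2`, so `N²` can be
  -- absorbed on the left.
  have h8 : (2 * r + N / 4 + 2 * (m * b)) ^ 2 ≤ 12 * r ^ 2 + 3 / 16 * N ^ 2 + 12 * (m * b) ^ 2 := by
    linarith [sq_nonneg (2 * r - N / 4), sq_nonneg (2 * r - 2 * (m * b)),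
      sq_nonneg (N / 4 - 2 * (m * b))]
  have h9 : 0 ≤ m ^ 2 * a := by positivity
  have h10 : 0 ≤ m ^ 2 * r ^ 2 := by positivity
  have h11 : (m * b) ^ 2 = m ^ 2 * b ^ 2 := by ring
  have h12 : 0 ≤ m ^ 2 * b ^ 2 := by positivity
  linarith [sq_nonneg b, sq_nonneg r]

lemma exists_norm_sq_le (γ : Hs s n) : ∃ K : ℝ, 0 < K ∧ ∀ u : Hs s n,
    ‖u‖ ^ 2 ≤ K * (‖u.1.fst‖ ^ 2 + ‖u.1.snd.fst‖ ^ 2 + ‖geomRemainder γ u‖ ^ 2) := by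
  obtain ⟨M, hM, hMu⟩ := exists_norm_remainderCLM_le γ
  -- This `ε` gives `2 M ε ≤ 1/4`, the share of `‖u‖` that the absorption tolerates; `M + 1` avoids
  -- division by zero.
  obtain ⟨C, hC, hCu⟩ := norm_derivCLM_le (s := s) (n := n) (ε := 1 / (8 * (M + 1))) (by positivity)
  refine ⟨2 * (12 + 12 * (M * C) ^ 2), by positivity, fun u => ?_⟩
  have h1 := u.norm_fracDiff_le_remainder
  have h2 := hMu u
  have h3 := hCu u
  have h4 := u.norm_sq
  have hN := norm_nonneg u
  have hd := norm_nonneg u.1.snd.snd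
  have hb := norm_nonneg u.1.snd.fst
  have hr := norm_nonneg (geomRemainder γ u)
  have h5 : M * ‖derivCLM u‖ ≤ ‖u‖ / 8 + M * C * ‖u.1.snd.fst‖ := by
    have e1 : M * ‖derivCLM u‖ ≤ M * (1 / (8 * (M + 1)) * ‖u‖ + C * ‖u.1.snd.fst‖) := by gcongr
    have e2 : M * (1 / (8 * (M + 1))) ≤ 1 / 8 := by
      rw [mul_one_div, div_le_div_iff₀ (by positivity) (by positivity)]; linarith
    have e3 := mul_le_mul_of_nonneg_right e2 hN
    linarith
  have h6 : ‖u.1.snd.snd‖ ≤ 2 * ‖geomRemainder γ u‖ + ‖u‖ / 4 + 2 * (M * C * ‖u.1.snd.fst‖) := by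
    linarith
  exact sq_le_of_le_add_div_four (sq_nonneg _) hd h6 h4

/-- The second and third terms are nonnegative and are dropped. The weights of the other three are
positive on a compact space, hence bounded below, and `exists_norm_sq_le` finishes. -/
lemma metricModel_coercive {γ : Hs s n} (hγ : γ ∈ embeddings s n) :
    ∃ c : ℝ, 0 < c ∧ ∀ u, c * ‖u‖ ^ 2 ≤ metricModel γ u u := by
  obtain ⟨K, hK, hKu⟩ := exists_norm_sq_le γ
  obtain ⟨c₁, h₁, hc₁⟩ := exists_pos_le (weight_pos (2 * s + 1) hγ)
  obtain ⟨c₂, h₂, hc₂⟩ := exists_pos_le (normPow_pos (-1) (derivStart_ne_zero γ hγ))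
  obtain ⟨c₃, h₃, hc₃⟩ := exists_pos_le (normPow_pos 1 (derivStart_ne_zero γ hγ))
  have hs0 := hs.out
  set c := min c₁ (min c₂ c₃) with hc
  have h0 : 0 < c := lt_min h₁ (lt_min h₂ h₃)
  have l1 : c ≤ c₁ := min_le_left _ _
  have l2 : c ≤ c₂ := (min_le_right _ _).trans (min_le_left _ _)
  have l3 : c ≤ c₃ := (min_le_right _ _).trans (min_le_right _ _)
  refine ⟨c / K, by positivity, fun u => ?_⟩
  have e1 := le_weightedInner (fun p => l1.trans (hc₁ p)) (geomRemainder γ u)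
  have e2 : 0 ≤ weightedInner (weight (2 * s + 3) γ *
      pointwise (innerSL ℝ) (diffQuot s n u) (diffQuot s n u)) (geomRemainder γ γ)
      (geomRemainder γ γ) := weightedInner_nonneg (fun p =>
    mul_nonneg (weight_pos _ hγ p).le (pointwise_inner_self_nonneg _ p)) _
  have e3 : 0 ≤ weightedInner (weight (2 * s + 1) γ * derivProduct γ u u) (geomRemainder γ γ)
      (geomRemainder γ γ) := weightedInner_nonneg (fun p =>
    mul_nonneg (weight_pos _ hγ p).le (derivProduct_self_nonneg hγ u p)) _
  have e4 := le_integralCLM_mul (fun p => l2.trans (hc₂ p))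
    (pointwise_inner_self_nonneg (derivStart s n u))
  have e5 := le_integralCLM_mul (fun p => l3.trans (hc₃ p))
    (pointwise_inner_self_nonneg (valStart s n u))
  have e6 : integralCLM (pointwise (innerSL ℝ) (derivStart s n u) (derivStart s n u)) =
    ‖u.1.snd.fst‖ ^ 2 := integralCLM_startCLM (derivCLM_ae u)
  have e7 : integralCLM (pointwise (innerSL ℝ) (valStart s n u) (valStart s n u)) =
    ‖u.1.fst‖ ^ 2 := integralCLM_startCLM (funCLM_ae u)
  rw [e6] at e4
  rw [e7] at e5
  have e8 := mul_nonneg (by linarith : 0 ≤ 2 * s + 1) e2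
  have e9 : c / K * ‖u‖ ^ 2 ≤
      c * (‖u.1.fst‖ ^ 2 + ‖u.1.snd.fst‖ ^ 2 + ‖geomRemainder γ u‖ ^ 2) := by
    refine (mul_le_mul_of_nonneg_left (hKu u) (by positivity)).trans (le_of_eq ?_)
    field_simp
  have e10 : 0 ≤ c * ‖geomRemainder γ u‖ ^ 2 := by positivity
  rw [metricModel]
  linarith

end

end Coercivity

section Geodesics

variable {s : ℝ} {n : ℕ} [hs : Fact (3 / 2 < s)]

/-! ### The geodesic spray -/

variable (s n) in
lemma exists_koszul_iff : ∃ A : Hs s n → Hs s n → Hs s n → Hs s n,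
    ContDiffOn ℝ ∞ (fun p : Hs s n × Hs s n × Hs s n => A p.1 p.2.1 p.2.2)
      (embeddings s n ×ˢ univ) ∧
    ∀ γ ∈ embeddings s n, ∀ u v a, Koszul γ u v a ↔ a = A γ u v := by
  refine exists_christoffel isOpen_embeddings contDiffOn_metricG (fun γ hγ v => ?_)
    (fun γ hγ u => ?_) (fun γ hγ B hB => ?_)
  · simp only [metricG_eq hγ]
    exact isLinearMap_metricModel_left γ v
  · have h : metricG γ u = metricModel γ u := funext (metricG_eq hγ u)
    rw [h]
    exact isLinearMap_metricModel_right γ u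
  · obtain ⟨c, hc, hcu⟩ := metricModel_coercive hγ
    have h : ∀ u, c * ‖u‖ ^ 2 ≤ B u u := fun u => by
      rw [hB, metricG_eq hγ]
      exact hcu u
    exact exists_continuousLinearEquiv_of_coercive (X := Hs s n) hc h

lemma existsUnique_koszul {γ : Hs s n} (hγ : γ ∈ embeddings s n) (u v : Hs s n) :
    ∃! a, Koszul γ u v a := by
  obtain ⟨A, -, hA⟩ := exists_koszul_iff s n
  exact ⟨A γ u v, (hA γ hγ u v _).2 rfl, fun a ha => (hA γ hγ u v a).1 ha⟩

lemma contDiffOn_spray : ContDiffOn ℝ ∞ (spray (s := s) (n := n)) (embeddings s n ×ˢ univ) := by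
  obtain ⟨A, hA, hAk⟩ := exists_koszul_iff s n
  have hmap : ContDiff ℝ ∞ fun p : Hs s n × Hs s n => (p.1, p.2, p.2) :=
    contDiff_fst.prodMk (contDiff_snd.prodMk contDiff_snd)
  have h := hA.comp (s := embeddings s n ×ˢ univ) hmap.contDiffOn fun p hp => ⟨hp.1, trivial⟩
  refine (contDiff_snd.contDiffOn.prodMk h.neg).congr fun p hp => ?_
  -- The arbitrary choice in `christoffel` is harmless: a solution exists, and any solution equals
  -- the smooth `A`.
  have he : Koszul p.1 p.2 p.2 (christoffel p.1 p.2 p.2) :=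
    Classical.epsilon_spec (existsUnique_koszul hp.1 p.2 p.2).exists
  rw [spray, (hAk _ hp.1 _ _ _).1 he]
  rfl

/-! ### The geodesic initial value problem -/

omit hs in
lemma IsGeodesicIVPSolution.exists_integralCurve {γ₀ v₀ : Hs s n} {T : ℝ} {Γ : ℝ → Hs s n}
    (h : IsGeodesicIVPSolution γ₀ v₀ T Γ) : ∃ V : ℝ → Hs s n, V 0 = v₀ ∧
      ∀ t ∈ Icc 0 T, HasDerivWithinAt (fun t => (Γ t, V t)) (spray (Γ t, V t)) (Icc 0 T) t := by
  obtain ⟨-, -, V, hV0, hΓ, hV⟩ := h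
  refine ⟨V, hV0, fun t ht => ?_⟩
  obtain ⟨a, ha, ha'⟩ := hV t ht
  rw [spray, ← eq_neg_of_add_eq_zero_left ha']
  exact (hΓ t ht).prodMk ha

/-- Position and velocity together form an integral curve of the spray on the open set `embeddings s
n ×ˢ univ`, so the first-order theory gives both existence and uniqueness. -/
lemma exists_geodesic {γ₀ : Hs s n} (hγ₀ : γ₀ ∈ embeddings s n) (v₀ : Hs s n) :
    ∃ T : ℝ, 0 < T ∧ ∃ Γ : ℝ → Hs s n, IsGeodesicIVPSolution γ₀ v₀ T Γ ∧
      ∀ Γ' : ℝ → Hs s n, IsGeodesicIVPSolution γ₀ v₀ T Γ' → EqOn Γ' Γ (Icc 0 T) := by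
  have hU : IsOpen (embeddings s n ×ˢ (univ : Set (Hs s n))) := isOpen_embeddings.prod isOpen_univ
  have hf : ContDiffOn ℝ 1 (spray (s := s) (n := n)) (embeddings s n ×ˢ univ) :=
    contDiffOn_spray.of_le (by simp)
  obtain ⟨T, hT, α, h0, hαU, hα⟩ := exists_solution_Icc hU hf
    (x₀ := (γ₀, v₀)) ⟨hγ₀, trivial⟩
  refine ⟨T, hT, fun t => (α t).1, ⟨fun t ht => (hαU t ht).1, by simp [h0],
    fun t => (α t).2, by simp [h0], fun t ht => (hα t ht).fst, fun t ht =>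
      ⟨_, (hα t ht).snd, neg_add_cancel _⟩⟩, fun Γ' hΓ' t ht => ?_⟩
  obtain ⟨V, hV0, hV⟩ := hΓ'.exists_integralCurve
  have h := solution_unique_Icc hU hf (α := fun t => (Γ' t, V t)) (β := α)
    (by rw [h0, hΓ'.2.1, hV0]) (fun t ht => ⟨hΓ'.1 t ht, trivial⟩) hV hα ht
  exact congrArg Prod.fst h

end Geodesics

end SobolevCurves

end

/-! ### Well-posedness and short-time existence -/

open SobolevCurves

theorem mainTheorem10 (n : ℕ) (s : ℝ) (hs : 3 / 2 < s) (hs' : s < 2) :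
    -- the geodesic equation is meaningful: `M` is open, the metric is smooth on `M`,
    -- Koszul's formula determines the Christoffel symbol, and the spray is smooth
    (IsOpen (embeddings s n) ∧
      ContDiffOn ℝ ∞ (fun p : Hs s n × Hs s n × Hs s n => metricG p.1 p.2.1 p.2.2)
        (embeddings s n ×ˢ univ) ∧
      (∀ γ ∈ embeddings s n, ∀ u v : Hs s n, ∃! a : Hs s n, Koszul γ u v a) ∧
      ContDiffOn ℝ ∞ (spray (s := s) (n := n)) (embeddings s n ×ˢ univ)) ∧
    -- short-time existence and uniqueness
    ∀ γ₀ ∈ embeddings s n, ∀ v₀ : Hs s n, ∃ T : ℝ, 0 < T ∧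
      ∃ Γ : ℝ → Hs s n, IsGeodesicIVPSolution γ₀ v₀ T Γ ∧
        ∀ Γ' : ℝ → Hs s n, IsGeodesicIVPSolution γ₀ v₀ T Γ' → EqOn Γ' Γ (Icc 0 T) := by
  have : Fact (3 / 2 < s) := ⟨hs⟩
  exact ⟨⟨isOpen_embeddings, contDiffOn_metricG, fun γ hγ => existsUnique_koszul hγ,
    contDiffOn_spray⟩, fun γ₀ hγ₀ v₀ => exists_geodesic hγ₀ v₀⟩
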